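/- Let $k$ be a perfect field of characteristic $2$, let $A=W(k)[[x,y,z]]$, let $n\ge 0$ and $r<n$ be integers, put $N=n-r\ge 1$, and let $G\in A$ be a power series whose $xz$-coefficient is divisible by $2$. Let $$f=z^2+x^2y+xy^n+xy^{n-r}z+2G\qquad\text{or}\qquad f=z^2+x^2y+y^nz+xy^{n-r}z+2G .$$ Multi-height. For a ring $R$ and a prime $p$ write $\overline R=R/pR$. For $n_0\ge 1$ let $\Phi_{R,n_0}\colon\overline R\to W_{n_0}(R)/p$ be the ring homomorphism induced by the Witt vector Frobenius, that is, $x_0\bmod p\mapsto F(x_0,x_1,\dots)$, and let $Q_{R,(n_0)}$ be $W_{n_0}(R)/p$ viewed as an $\overline R$-module through $\Phi_{R,n_0}$. Put $Q_{R,()}=\overline R$, $\Psi_{R,(n_0)}=\Phi_{R,n_0}$, and let $V^{n_0-1}\colon F^{n_0}_*\overline R\to Q_{R,(n_0)}$ be induced by the iterated Verschiebung, where $F^{e}_*$ is restriction of scalars along $a\mapsto a^{p^e}$. For $m\ge 1$ let $Q_{R,(n_0,\dots,n_m)}$ be the pushout, in the category of $\overline R$-modules, of $$F^{n_0}_*\Psi_{R,(n_1,\dots,n_m)}\colon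 F^{n_0}_*Q_{R,(n_1,\dots,n_{m-1})}\to F^{n_0}_*Q_{R,(n_1,\dots,n_m)}$$ and $$V^{n_0-1}\colon F^{n_0}_*Q_{R,(n_1,\dots,n_{m-1})}\to Q_{R,(n_0,\dots,n_{m-1})},$$ with its canonical maps $\Psi_{R,(n_0,\dots,n_m)}\colon Q_{R,(n_0,\dots,n_{m-1})}\to Q_{R,(n_0,\dots,n_m)}$ and $V^{n_0-1}\colon F^{n_0}_*Q_{R,(n_1,\dots,n_m)}\to Q_{R,(n_0,\dots,n_m)}$. Let $\Phi_{R,(n_0,\dots,n_m)}\colon\overline R\to Q_{R,(n_0,\dots,n_m)}$ be the composition $\Psi_{R,(n_0,\dots,n_m)}\circ\cdots\circ\Psi_{R,(n_0)}$. A sequence $(h_0,h_1,\dots)$ of positive integers is the multi-height of $R$ if for every $i\ge 0$ the number $h_i$ is the least $h\ge 1$ such that $\Phi_{R,(h_0,\dots,h_{i-1},h)}$ splits as a homomorphism of $\overline R$-modules. Define $(\alpha_i)_{i\ge0}$ and $(e_i)_{i\ge 0}$ by $\alpha_0=0$, by letting $e_i$ be the smallest integer with $2^{e_i}(1+\alpha_i)-2^{e_i-1}-N\ge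 0$ (it satisfies $e_i\ge 1$), and $\alpha_{i+1}=2^{e_i}(1+\alpha_i)-2^{e_i-1}-N$. These sequences depend only on $N=n-r$. Then $A/(f)$ has a multi-height $(h_0,h_1,\dots)$ (for $p=2$), and the following hold. 1. There are integers $0\le s<t$ with $\alpha_{s+i}=\alpha_{t+i}$ for every $i\ge 0$. 2. $h_i\le e_i$ for every $i\ge 0$. 3. If $h_j<e_j$ for some $j\ge 0$, then $h_i=1$ for all $i>j$. 4. Let $s<t$ be any integers as in (1). If $h_{t+j}\ge 2$ for some $j\ge 0$, then $h_i=e_i$ for every $i\ge 0$. In particular, for any $s<t$ as in (1), $(h_0,h_1,\dots)$ is an element of the finite set $$\bigl([1,e_0]\times[1,e_1]\times\cdots\times[1,e_t]\times\{1\}\times\{1\}\times\cdots\bigr)\cup\{(e_0,e_1,\dots)\}.$$ -/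

import Mathlib

open CategoryTheory

namespace MultiHeight

noncomputable section

universe u

section Construction

variable (p : ℕ) [Fact p.Prime] (R : Type u) [CommRing R]

/-- The reduction `R̄ = R / pR`. -/
abbrev ModP : Type u := R ⧸ Ideal.span {(p : R)}

/-- The Frobenius endomorphism `a ↦ a ^ p` of `R̄ = R / pR`. -/
def frob : ModP p R →+* ModP p R where
  toFun a := a ^ p
  map_one' := one_pow p
  map_zero' := zero_pow (Fact.out : p.Prime).ne_zero
  map_mul' a b := mul_pow a b p
  map_add' a b := by
    obtain ⟨r, hr⟩ := exists_add_pow_prime_eq (Fact.out : p.Prime) a b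
    have h0 : (p : ModP p R) = 0 := by
      have : Ideal.Quotient.mk (Ideal.span {(p : R)}) (p : R) = 0 :=
        Ideal.Quotient.eq_zero_iff_mem.mpr (Ideal.mem_span_singleton_self _)
      simpa using this
    rw [hr, h0]; ring

lemma frob_pow_apply (n : ℕ) (a : ModP p R) : (frob p R ^ n) a = a ^ p ^ n := by
  induction n with
  | zero => simp
  | succ n ih =>
    rw [pow_succ', RingHom.mul_def, RingHom.comp_apply, ih]
    change (a ^ p ^ n) ^ p = _
    rw [← pow_mul, pow_succ]

/-- `W_n(R) / p W_n(R)`, where `W_n` denotes `p`-typical Witt vectors of length `n`. -/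
abbrev WBar (n : ℕ) : Type u :=
  TruncatedWittVector p n R ⧸ Ideal.span {(p : TruncatedWittVector p n R)}

/-- The projection `W(R) → W_n(R) → W_n(R) / p`. -/
def toWBar (n : ℕ) : WittVector p R →+* WBar p R n :=
  (Ideal.Quotient.mk _).comp (WittVector.truncate n)

/-- The projection `W(R) → R → R / p`, `(x₀, x₁, …) ↦ x₀ mod p`. -/
def toModP : WittVector p R →+* ModP p R :=
  (Ideal.Quotient.mk _).comp WittVector.constantCoeff

lemma toModP_surjective : Function.Surjective (toModP p R) := by
  intro a
  obtain ⟨b, rfl⟩ := Ideal.Quotient.mk_surjective a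
  exact ⟨WittVector.teichmuller p b, by
    simp [toModP, WittVector.constantCoeff, WittVector.teichmuller_coeff_zero]⟩

lemma toWBar_p (n : ℕ) : toWBar p R n (p : WittVector p R) = 0 := by
  simp only [toWBar, map_natCast]
  have : Ideal.Quotient.mk (Ideal.span {(p : TruncatedWittVector p n R)})
      (p : TruncatedWittVector p n R) = 0 :=
    Ideal.Quotient.eq_zero_iff_mem.mpr (Ideal.mem_span_singleton_self _)
  simpa using this

lemma exists_of_toModP_eq_zero (x : WittVector p R) (hx : toModP p R x = 0) :
    ∃ y z : WittVector p R, x = WittVector.verschiebung y + (p : WittVector p R) * z := by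
  have h1 : x.coeff 0 ∈ Ideal.span {(p : R)} := Ideal.Quotient.eq_zero_iff_mem.mp hx
  obtain ⟨c, hc⟩ := Ideal.mem_span_singleton'.mp h1
  set z := WittVector.teichmuller p c with hz
  have h2 : (x - (p : WittVector p R) * z).coeff 0 = 0 := by
    have : WittVector.constantCoeff (x - (p : WittVector p R) * z) = 0 := by
      rw [map_sub, map_mul, map_natCast]
      have hz0 : WittVector.constantCoeff z = c := WittVector.teichmuller_coeff_zero p c
      have hx0 : WittVector.constantCoeff x = x.coeff 0 := rfl
      rw [hz0, hx0, ← hc]; ring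
    exact this
  refine ⟨(x - (p : WittVector p R) * z).shift 1, z, ?_⟩
  have : WittVector.verschiebung ((x - (p : WittVector p R) * z).shift 1) = x - (p : WittVector p R) * z := by
    have h0 : (x - (p : WittVector p R) * z).shift 0 = x - (p : WittVector p R) * z := by
      ext i
      rw [WittVector.shift_coeff, Nat.zero_add]
    refine Eq.trans ?_ h0
    exact WittVector.verschiebung_shift (x - (p : WittVector p R) * z) 0 (by
      intro i hi
      have : i = 0 := by omega
      rw [this, h2])
  rw [this]; ring

lemma toModP_frobenius (x : WittVector p R) :
    toModP p R (WittVector.frobenius x) = toModP p R x ^ p := by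
  have h : (WittVector.frobenius x).coeff 0 = x.coeff 0 ^ p + p * x.coeff 1 := by
    have := WittVector.ghostComponent_frobenius 0 x
    simpa [WittVector.ghostComponent_apply, wittPolynomial, Finset.sum_range_succ,
      MvPolynomial.aeval_def, MvPolynomial.eval₂_monomial, Finsupp.prod_single_index] using this
  have hp : Ideal.Quotient.mk (Ideal.span {(p : R)}) (p : R) = 0 :=
    Ideal.Quotient.eq_zero_iff_mem.mpr (Ideal.mem_span_singleton_self _)
  change Ideal.Quotient.mk _ ((WittVector.frobenius x).coeff 0) =
    (Ideal.Quotient.mk _ (x.coeff 0)) ^ p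
  rw [h, map_add, map_mul, hp, map_pow, zero_mul, add_zero]

/-- The ring homomorphism `Φ_{R,n} : R / p → W_n(R) / p` induced by the Witt vector Frobenius
`F : W(R) → W(R)`: it sends `x₀ mod p` to the class of `F(x₀, x₁, …)`. -/
def phiRing (n : ℕ) : ModP p R →+* WBar p R n :=
  (toModP p R).liftOfSurjective (toModP_surjective p R)
    ⟨(toWBar p R n).comp WittVector.frobenius, by
      intro x hx
      obtain ⟨y, z, rfl⟩ := exists_of_toModP_eq_zero p R x hx
      rw [RingHom.mem_ker, RingHom.comp_apply, map_add, WittVector.frobenius_verschiebung,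
        map_mul, map_natCast, map_add, map_mul, map_mul, toWBar_p]
      ring⟩

lemma phiRing_toModP (n : ℕ) (x : WittVector p R) :
    phiRing p R n (toModP p R x) = toWBar p R n (WittVector.frobenius x) :=
  RingHom.liftOfRightInverse_comp_apply _ _ _ _ _

/-- The additive map `W(R) → W_n(R) / p`, `x ↦ V^{n-1} x`. -/
def verAux (n : ℕ) : WittVector p R →+ WBar p R n where
  toFun x := toWBar p R n (WittVector.verschiebung^[n - 1] x)
  map_zero' := by rw [iterate_map_zero, map_zero]
  map_add' x y := by rw [iterate_map_add, map_add]

lemma verAux_eq_zero (n : ℕ) (x : WittVector p R) (hx : toModP p R x = 0) :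
    verAux p R n x = 0 := by
  obtain ⟨y, z, rfl⟩ := exists_of_toModP_eq_zero p R x hx
  have h1 : verAux p R n (WittVector.verschiebung y) = 0 := by
    change Ideal.Quotient.mk _ (WittVector.truncate n
      (WittVector.verschiebung^[n - 1] (WittVector.verschiebung y))) = 0
    rw [← Function.iterate_succ_apply]
    have : WittVector.truncate n (WittVector.verschiebung^[(n - 1).succ] y) = 0 := by
      rw [← RingHom.mem_ker, WittVector.mem_ker_truncate]
      intro i hi
      exact WittVector.iterate_verschiebung_coeff_eq_zero y (by omega)
    rw [this, map_zero]
  have h2 : verAux p R n ((p : WittVector p R) * z) = 0 := by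
    rw [← nsmul_eq_mul, map_nsmul, nsmul_eq_mul]
    have : (p : WBar p R n) = 0 := by
      have := toWBar_p p R n
      rwa [map_natCast] at this
    rw [this, zero_mul]
  rw [map_add, h1, h2, add_zero]

/-- The additive map `V^{n-1} : R / p → W_n(R) / p`, sending `x₀ mod p` to the class of
`V^{n-1}(x₀, x₁, …)` (used for `n ≥ 1` only). -/
def verAdd (n : ℕ) : ModP p R →+ WBar p R n :=
  (toModP p R).toAddMonoidHom.liftOfSurjective (toModP_surjective p R)
    ⟨verAux p R n, fun x hx => verAux_eq_zero p R n x hx⟩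

lemma verAdd_toModP (n : ℕ) (x : WittVector p R) :
    verAdd p R n (toModP p R x) = toWBar p R n (WittVector.verschiebung^[n - 1] x) :=
  AddMonoidHom.liftOfRightInverse_comp_apply _ _ _ _ _

lemma toModP_iterate_frobenius (n : ℕ) (x : WittVector p R) :
    toModP p R (WittVector.frobenius^[n] x) = toModP p R x ^ p ^ n := by
  induction n with
  | zero => simp
  | succ n ih =>
    rw [Function.iterate_succ_apply', toModP_frobenius, ih, ← pow_mul, pow_succ]

lemma verAdd_mul (n : ℕ) (a b : ModP p R) :
    verAdd p R n ((frob p R ^ n) a * b) = phiRing p R n a * verAdd p R n b := by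
  obtain ⟨x, rfl⟩ := toModP_surjective p R a
  obtain ⟨y, rfl⟩ := toModP_surjective p R b
  rcases n with _ | m
  · have hs : ∀ c d : WBar p R 0, c = d := by
      intro c d
      obtain ⟨c, rfl⟩ := Ideal.Quotient.mk_surjective c
      obtain ⟨d, rfl⟩ := Ideal.Quotient.mk_surjective d
      exact congrArg _ (TruncatedWittVector.ext fun i => i.elim0)
    exact hs _ _
  · rw [frob_pow_apply, ← toModP_iterate_frobenius, ← map_mul, verAdd_toModP, verAdd_toModP,
      phiRing_toModP, ← map_mul, mul_comm _ y, mul_comm _ (WittVector.verschiebung^[_] y),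
      WittVector.iterate_verschiebung_mul_left, Nat.add_sub_cancel, Function.iterate_succ_apply]

/-- The functor `F^n_*` on `R̄`-modules: restriction of scalars along `a ↦ a ^ (p ^ n)`. -/
abbrev frobPush (n : ℕ) : ModuleCat.{u} (ModP p R) ⥤ ModuleCat.{u} (ModP p R) :=
  ModuleCat.restrictScalars (frob p R ^ n)

/-- `R̄` as a module over itself. -/
abbrev unitMod : ModuleCat.{u} (ModP p R) := ModuleCat.of (ModP p R) (ModP p R)

/-- The `R̄`-module `Q_{R,n}`: the group `W_n(R) / p` with `R̄` acting through `Φ_{R,n}`. -/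
abbrev Q (n : ℕ) : ModuleCat.{u} (ModP p R) :=
  (ModuleCat.restrictScalars (phiRing p R n)).obj (ModuleCat.of (WBar p R n) (WBar p R n))

/-- `Φ_{R,n} : R̄ → Q_{R,n}` as a homomorphism of `R̄`-modules. -/
def phi (n : ℕ) : unitMod p R ⟶ Q p R n :=
  ModuleCat.ofHom (Y := Q p R n)
    { toFun := fun a => phiRing p R n a
      map_add' := fun a b => map_add (phiRing p R n) a b
      map_smul' := fun a b => map_mul (phiRing p R n) a b }

/-- `V^{n-1} : F^n_* R̄ → Q_{R,n}` as a homomorphism of `R̄`-modules. -/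
def ver (n : ℕ) : (frobPush p R n).obj (unitMod p R) ⟶ Q p R n :=
  ModuleCat.ofHom (X := (frobPush p R n).obj (unitMod p R)) (Y := Q p R n)
    { toFun := fun a => verAdd p R n a
      map_add' := fun a b => map_add (verAdd p R n) a b
      map_smul' := fun a b => verAdd_mul p R n a b }

/-- The sequence `(n₁, n₂, …)` obtained from `(n₀, n₁, …)`. -/
def tail (n : ℕ → ℕ) : ℕ → ℕ := fun i => n (i + 1)

/-- The data attached to the initial segments `(n₀, …, n_r)`, for a fixed `r`, of all sequences
`n = (n₀, n₁, …)`: `lower n = Q_{R,(n₀,…,n_{r-1})}` (which is `R̄` if `r = 0`),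
`upper n = Q_{R,(n₀,…,n_r)}`, the maps `Ψ_{R,(n₀,…,n_r)}`, `V^{n₀-1}`, and
`Φ_{R,(n₀,…,n_r)}`. -/
structure Level where
  lower : (ℕ → ℕ) → ModuleCat.{u} (ModP p R)
  upper : (ℕ → ℕ) → ModuleCat.{u} (ModP p R)
  psi : ∀ n, lower n ⟶ upper n
  ver : ∀ n, (frobPush p R (n 0)).obj (lower (tail n)) ⟶ upper n
  phi : ∀ n, unitMod p R ⟶ upper n

/-- The case `r = 0`. -/
def levelZero : Level p R where
  lower _ := unitMod p R
  upper n := Q p R (n 0)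
  psi n := phi p R (n 0)
  ver n := ver p R (n 0)
  phi n := phi p R (n 0)

/-- The passage from `r` to `r + 1`: `Q_{R,(n₀,…,n_{r+1})}` is the pushout of
`F^{n₀}_* Ψ_{R,(n₁,…,n_{r+1})}` and `V^{n₀-1} : F^{n₀}_* Q_{R,(n₁,…,n_r)} → Q_{R,(n₀,…,n_r)}`
in the category of `R̄`-modules. -/
def Level.next (L : Level p R) : Level p R where
  lower := L.upper
  upper n := Limits.pushout ((frobPush p R (n 0)).map (L.psi (tail n))) (L.ver n)
  psi n := Limits.pushout.inr ((frobPush p R (n 0)).map (L.psi (tail n))) (L.ver n)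
  ver n := Limits.pushout.inl ((frobPush p R (n 0)).map (L.psi (tail n))) (L.ver n)
  phi n := L.phi n ≫
    Limits.pushout.inr ((frobPush p R (n 0)).map (L.psi (tail n))) (L.ver n)

/-- The data for all `r ≥ 0`. -/
def level : ℕ → Level p R
  | 0 => levelZero p R
  | r + 1 => (level r).next

/-- `Φ_{R,(n₀,…,n_r)} : R̄ → Q_{R,(n₀,…,n_r)}`; only the entries `n₀, …, n_r` of the sequence `n`
are used. -/
def multiPhi (r : ℕ) (n : ℕ → ℕ) : unitMod p R ⟶ (level p R r).upper n :=
  (level p R r).phi n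

/-- `R` has quasi-`F`-split multi-height `h = (h₀, h₁, …)`: for every `r`, the number `h_r` is the
least `m ≥ 1` such that `Φ_{R,(h₀,…,h_{r-1},m)}` splits as a homomorphism of `R̄`-modules. -/
def HasMultiHeight (h : ℕ → ℕ) : Prop :=
  ∀ r, IsLeast {m | 1 ≤ m ∧ IsSplitMono (multiPhi p R r (Function.update h r m))} (h r)

end Construction

section Sequences

/-- The least integer `e ≥ 1` with `2^e (1 + a) - 2^(e-1) - N ≥ 0`. -/
def expo (N a : ℤ) : ℕ :=
  sInf {e : ℕ | 1 ≤ e ∧ 0 ≤ 2 ^ e * (1 + a) - 2 ^ (e - 1) - N}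

/-- The sequence `α_i` attached to `N = n - r`. -/
def alpha (N : ℤ) : ℕ → ℤ
  | 0 => 0
  | i + 1 => 2 ^ expo N (alpha N i) * (1 + alpha N i) - 2 ^ (expo N (alpha N i) - 1) - N

/-- The sequence `e_i` attached to `N = n - r`. -/
def eSeq (N : ℤ) (i : ℕ) : ℕ := expo N (alpha N i)

lemma expo_isLeast {N a : ℤ} (ha : 0 ≤ a) :
    IsLeast {e : ℕ | 1 ≤ e ∧ 0 ≤ 2 ^ e * (1 + a) - 2 ^ (e - 1) - N} (expo N a) := by
  refine ⟨Nat.sInf_mem ⟨N.toNat + 1, by omega, ?_⟩, fun _ h => Nat.sInf_le h⟩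
  have h1 : (N.toNat : ℤ) < 2 ^ N.toNat := by exact_mod_cast Nat.lt_two_pow_self
  have h2 : N ≤ N.toNat := Int.self_le_toNat N
  have h3 : (0 : ℤ) < 2 ^ N.toNat := by positivity
  rw [Nat.add_sub_cancel, pow_succ]
  nlinarith

lemma alpha_bounds {N : ℤ} (hN : 1 ≤ N) (i : ℕ) : 0 ≤ alpha N i ∧ alpha N i < N := by
  induction i with
  | zero => simp only [alpha]; omega
  | succ i ih =>
    obtain ⟨⟨h1, h2⟩, h3⟩ := expo_isLeast (N := N) ih.1
    refine ⟨h2, ?_⟩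
    simp only [alpha]
    generalize expo N (alpha N i) = e at h1 h2 h3 ⊢
    generalize alpha N i = a at h2 h3 ih ⊢
    obtain ⟨m, rfl⟩ : ∃ m, e = m + 1 := ⟨e - 1, by omega⟩
    rw [Nat.add_sub_cancel, pow_succ]
    rcases m with _ | m
    · simp; omega
    · have h4 : ¬ (0 ≤ 2 ^ (m + 1) * (1 + a) - 2 ^ m - N) := fun h => by
        have h' : m + 1 + 1 ≤ m + 1 := h3 ⟨by omega, h⟩
        omega
      rw [pow_succ] at h4 ⊢
      push Not at h4
      nlinarith

/-- For `N ≥ 1`, the number `e_i` is the smallest among all integers `e` satisfying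
`2^e (1 + α_i) - 2^(e-1) - N ≥ 0`. -/
lemma eSeq_isLeast {N : ℤ} (hN : 1 ≤ N) (i : ℕ) :
    IsLeast {e : ℤ | 0 ≤ (2 : ℚ) ^ e * (1 + alpha N i) - 2 ^ (e - 1) - N} (eSeq N i) := by
  obtain ⟨ha, haN⟩ := alpha_bounds hN i
  obtain ⟨⟨h1, h2⟩, h3⟩ := expo_isLeast (N := N) ha
  change IsLeast _ ((expo N (alpha N i) : ℕ) : ℤ)
  have key : ∀ e : ℕ, 1 ≤ e → ((0 ≤ (2 : ℚ) ^ (e : ℤ) * (1 + alpha N i) - 2 ^ ((e : ℤ) - 1) - N) ↔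
      0 ≤ 2 ^ e * (1 + alpha N i) - 2 ^ (e - 1) - N) := by
    intro e he
    have : ((e : ℤ) - 1) = ((e - 1 : ℕ) : ℤ) := by omega
    rw [this, zpow_natCast, zpow_natCast]
    exact_mod_cast Iff.rfl
  refine ⟨(key _ h1).mpr h2, ?_⟩
  intro e he
  by_cases hpos : 1 ≤ e
  · obtain ⟨m, rfl⟩ := Int.eq_ofNat_of_zero_le (by omega : 0 ≤ e)
    have hm : 1 ≤ m := by exact_mod_cast hpos
    exact_mod_cast h3 ⟨hm, (key m hm).mp he⟩
  · exfalso
    have hle : e ≤ 0 := by omega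
    have h5 : (2 : ℚ) ^ e ≤ 1 := zpow_le_one_of_nonpos₀ (by norm_num) hle
    have h6 : (0 : ℚ) < (2 : ℚ) ^ e := by positivity
    have h7 : (2 : ℚ) ^ (e - 1) = 2 ^ e / 2 := by rw [zpow_sub_one₀ (by norm_num)]; ring
    have h8 : (alpha N i : ℚ) + 1 ≤ N := by exact_mod_cast haN
    have h9 : (0 : ℚ) ≤ alpha N i := by exact_mod_cast ha
    have he' : 0 ≤ (2 : ℚ) ^ e * (1 + alpha N i) - 2 ^ (e - 1) - N := he
    rw [h7] at he'
    nlinarith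

/-- The set `([1,e₀] × ⋯ × [1,e_t] × {1} × {1} × ⋯) ∪ {(e₀, e₁, …)}`. -/
def candidates (N : ℤ) (t : ℕ) : Set (ℕ → ℕ) :=
  {h | (∀ i ≤ t, 1 ≤ h i ∧ h i ≤ eSeq N i) ∧ ∀ i, t < i → h i = 1} ∪ {eSeq N}

end Sequences

section Equations

open MvPowerSeries

/-- The power series `z² + x²y + xyⁿ + xy^{n-r}z + 2G`, in the variables `x = X 0`, `y = X 1`,
`z = X 2`. -/
def evenLift {W : Type*} [CommRing W] (n : ℕ) (r : ℤ) (G : MvPowerSeries (Fin 3) W) :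
    MvPowerSeries (Fin 3) W :=
  X 2 ^ 2 + X 0 ^ 2 * X 1 + X 0 * X 1 ^ n + X 0 * X 1 ^ (n - r).toNat * X 2 + 2 * G

/-- The power series `z² + x²y + yⁿz + xy^{n-r}z + 2G`. -/
def oddLift {W : Type*} [CommRing W] (n : ℕ) (r : ℤ) (G : MvPowerSeries (Fin 3) W) :
    MvPowerSeries (Fin 3) W :=
  X 2 ^ 2 + X 0 ^ 2 * X 1 + X 1 ^ n * X 2 + X 0 * X 1 ^ (n - r).toNat * X 2 + 2 * G

end Equations

end

end MultiHeight

/-!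
Write `R = A / (f)`, `P = A / 2`, `F` for the image of `f` in `P`, so that `R̄ = P / F`, and
`δ = (f² - φ(f)) / 2` modulo `2`, where `φ` is a lift of Frobenius to `A`. The proof translates
splittings into functionals on `P`, and then follows explicit functionals under an explicit operation.

*Coordinates.* Dwork's congruences for the ghost components give additive maps `W(A) → P`
(`FrobeniusLift.coord`). All additive maps on `W_n(R) / 2` which are linear for the action through
`Φ` are sums of functions of these coordinates (`exists_of_isFrobLinear`, `exists_isFrobLinear`). As
`P` is a power series ring over a perfect field, such functions are of the form
`a ↦ u^m (g a)`, where `u` is the trace (`tr`), which generates the dual of Frobenius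
(`exists_eq_trPow_mul`). Hence a homomorphism out of `Q_{R,(n)}` is a chain of power series
`g_0, …, g_{n-1}` whose consecutive members are related through `δ`.

*Pushouts.* Pasting pushout squares shows that `Q_{R,(n_0,…,n_r)}` is the pushout of `Q_{R,(n_0)}`
along `Φ_{R,(n_1,…,n_r)}` (`level_isPushout`). So homomorphisms out of it are again described by
chains, whose last member is admissible for `(n_1, …, n_r)` (`adm_succ_iff`).

*Functionals.* `Φ_{R,(n_0,…,n_r)}` splits if and only if the constant coefficient does not vanish on
the power series admissible for `(n_0, …, n_r)`. For a functional `ℓ` put `ξ_0 = ℓ ∘ u` and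
`ξ_{j+1} = δ · (ξ_j ∘ u)`. By `forall_chainValue_iff` a functional `ℓ` killed by `F` vanishes on all
chains if and only if `F ξ_j = 0` up to the last place, where `F ξ_j` has to vanish on the admissible
elements of the next level. Thus `h_i` is the least `m ≥ 1` with `F ξ_{m-1}(ℓ_i) ≠ 0`, where `ℓ_0` is
the constant coefficient and `ℓ_{i+1} = F ξ_{h_i - 1}(ℓ_i)` (`hasMultiHeight_iff`).

*Dynamics.* For the equations at hand, call `ℓ` clean of exponent `a` if its annihilator is
`(x, y^a, z)`, and dirty if it is not killed by both `x` and `z`. The constant coefficient is clean of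
exponent `1`. A dirty functional has height `1` and its successor is dirty (`Dirty.next`). A clean
functional of exponent `1 + α_i` has height at most `e_i`; its successor is dirty, or else its height
is `e_i` and the successor is clean of exponent `1 + α_{i+1}` (`Clean.exists_isHeight`). The
hypothesis on the coefficient of `xz` in `G` makes the term `G²` of `δ` harmless here
(`smul_socle_eq_zero`). Finally, heights depend only on annihilators, so the transition is
deterministic on clean functionals and, `α` being periodic, a clean functional which survives for one
period remains clean forever (`heights_of_states`).
-/

namespace MultiHeight

noncomputable section

universe u

/-! ### Additive coordinates on Witt vectors over a ring with a Frobenius lift -/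

section WittCoordinates

open WittVector

/-- A lift of Frobenius `φ` on a ring `A` without `2`-torsion, together with a surjection `red` from
`A` onto a model `P` of `A / 2`. -/
structure FrobeniusLift (A P : Type*) [CommRing A] [CommRing P] where
  φ : A →+* A
  red : A →+* P
  dvd_sub : ∀ a, (2 : A) ∣ a ^ 2 - φ a
  torsionFree : ∀ a : A, 2 * a = 0 → a = 0
  red_surjective : Function.Surjective red
  red_eq_zero : ∀ a, red a = 0 → (2 : A) ∣ a

theorem ghostComponent_eq_sum {A : Type*} [CommRing A] (x : WittVector 2 A) (n : ℕ) :
    ghostComponent n x = ∑ i ∈ Finset.range (n + 1), 2 ^ i * x.coeff i ^ 2 ^ (n - i) := by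
  rw [ghostComponent_apply, wittPolynomial_eq_sum_C_mul_X_pow]
  simp

theorem eq_teichmuller_add_verschiebung {A : Type*} [CommRing A] (x : WittVector 2 A) :
    x = teichmuller 2 (x.coeff 0) + verschiebung (x.shift 1) := by
  ext i
  rw [coeff_add_of_disjoint]
  · rcases i with _ | i
    · rw [teichmuller_coeff_zero, verschiebung_coeff_zero, add_zero]
    · rw [teichmuller_coeff_pos 2 _ _ (Nat.succ_pos i), verschiebung_coeff_succ, shift_coeff,
        zero_add, add_comm]
  · rintro (_ | i)
    · exact Or.inr (verschiebung_coeff_zero _)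
    · exact Or.inl (teichmuller_coeff_pos 2 _ _ (Nat.succ_pos i))

theorem two_eq_zero (P : Type*) [CommRing P] [CharP P 2] : (2 : P) = 0 := by
  exact_mod_cast CharP.cast_eq_zero P 2

namespace FrobeniusLift

variable {A P : Type*} [CommRing A] [CommRing P] (L : FrobeniusLift A P)

theorem torsionFree_pow (L : FrobeniusLift A P) (n : ℕ) (a b : A)
    (h : 2 ^ n * a = 2 ^ n * b) : a = b := by
  induction n with
  | zero => simpa using h
  | succ n ih =>
    refine ih (sub_eq_zero.mp (L.torsionFree _ ?_))
    rw [mul_sub, ← mul_assoc, ← mul_assoc, ← pow_succ', h, sub_self]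

/-- `w_n(x) - φ(w_{n-1}(x))`, where `w_n` are the ghost components and `w_{-1} = 0`. -/
def ghostDiff (n : ℕ) : WittVector 2 A →+ A :=
  (ghostComponent n).toAddMonoidHom -
    if n = 0 then 0 else (L.φ.comp (ghostComponent (n - 1))).toAddMonoidHom

theorem ghostDiff_zero (x : WittVector 2 A) : L.ghostDiff 0 x = ghostComponent 0 x := by
  simp [ghostDiff]

theorem ghostDiff_succ (n : ℕ) (x : WittVector 2 A) :
    L.ghostDiff (n + 1) x = ghostComponent (n + 1) x - L.φ (ghostComponent n x) := by
  simp [ghostDiff]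

theorem pow_dvd_sub (a : A) (k : ℕ) : (2 : A) ^ (k + 1) ∣ a ^ 2 ^ (k + 1) - L.φ a ^ 2 ^ k := by
  have := dvd_sub_pow_of_dvd_sub (p := 2) (by exact_mod_cast L.dvd_sub a) k
  rw [show a ^ 2 ^ (k + 1) = (a ^ 2) ^ 2 ^ k by rw [← pow_mul, ← pow_succ']]
  exact_mod_cast this

/-- Dwork's congruences between the ghost components of a Witt vector. -/
theorem dvd_ghostDiff (n : ℕ) (x : WittVector 2 A) : (2 : A) ^ n ∣ L.ghostDiff n x := by
  rcases n with _ | n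
  · simp
  · rw [ghostDiff_succ, ghostComponent_eq_sum, ghostComponent_eq_sum, Finset.sum_range_succ,
      map_sum, add_sub_right_comm, ← Finset.sum_sub_distrib]
    refine dvd_add (Finset.dvd_sum fun i hi => ?_) (dvd_mul_right _ _)
    obtain ⟨k, rfl⟩ : ∃ k, n = i + k := ⟨n - i, by have := Finset.mem_range.mp hi; omega⟩
    rw [map_mul, map_pow, map_pow, map_ofNat, ← mul_sub, add_assoc, pow_add]
    refine mul_dvd_mul_left _ ?_
    have h := L.pow_dvd_sub (x.coeff i) k
    rwa [Nat.add_sub_cancel_left, Nat.add_sub_cancel_left]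

/-- The additive map `b_n : W(A) → A` with `2 ^ n * b_n(x) = w_n(x) - φ(w_{n-1}(x))`. -/
def dwork (n : ℕ) : WittVector 2 A →+ A where
  toFun x := (L.dvd_ghostDiff n x).choose
  map_zero' := by
    apply L.torsionFree_pow n
    rw [← (L.dvd_ghostDiff n 0).choose_spec, map_zero, mul_zero]
  map_add' x y := by
    apply L.torsionFree_pow n
    rw [← (L.dvd_ghostDiff n (x + y)).choose_spec, map_add, mul_add,
      ← (L.dvd_ghostDiff n x).choose_spec, ← (L.dvd_ghostDiff n y).choose_spec]

theorem pow_mul_dwork (n : ℕ) (x : WittVector 2 A) : 2 ^ n * L.dwork n x = L.ghostDiff n x :=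
  (L.dvd_ghostDiff n x).choose_spec.symm

theorem dwork_zero (x : WittVector 2 A) : L.dwork 0 x = x.coeff 0 := by
  have := L.pow_mul_dwork 0 x
  rw [ghostDiff_zero, ghostComponent_eq_sum] at this
  simpa using this

theorem dwork_succ_verschiebung (n : ℕ) (x : WittVector 2 A) :
    L.dwork (n + 1) (verschiebung x) = L.dwork n x := by
  apply L.torsionFree_pow (n + 1)
  rw [pow_mul_dwork, pow_succ', mul_assoc, pow_mul_dwork, ghostDiff_succ]
  rcases n with _ | n
  · rw [ghostComponent_verschiebung, ghostComponent_zero_verschiebung, ghostDiff_zero, map_zero,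
      sub_zero]
    norm_num
  · rw [ghostComponent_verschiebung, ghostComponent_verschiebung, ghostDiff_succ, map_mul,
      mul_sub, map_natCast]
    norm_num

theorem two_mul_dwork_one (a : A) : 2 * L.dwork 1 (teichmuller 2 a) = a ^ 2 - L.φ a := by
  have := L.pow_mul_dwork 1 (teichmuller 2 a)
  rw [ghostDiff_succ, ghostComponent_teichmuller, ghostComponent_teichmuller] at this
  simpa using this

/-- The reduction `δ(a)` of `(a ^ 2 - φ(a)) / 2`. -/
def delta (a : A) : P := L.red (L.dwork 1 (teichmuller 2 a))

theorem delta_eq {a c : A} (h : a ^ 2 - L.φ a = 2 * c) : L.delta a = L.red c := by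
  rw [delta, L.torsionFree_pow 1 (L.dwork 1 (teichmuller 2 a)) c]
  rw [pow_one, two_mul_dwork_one, h]

/-- This follows from `2 ^ n * b_n([a]) = a ^ 2 ^ n - φ(a) ^ 2 ^ (n - 1)`, the right hand side for
`n + 2` being a difference of two squares. -/
theorem dwork_teichmuller_succ (n : ℕ) (a : A) :
    L.dwork (n + 2) (teichmuller 2 a) = L.dwork (n + 1) (teichmuller 2 a) *
      (a ^ 2 ^ (n + 1) - 2 ^ n * L.dwork (n + 1) (teichmuller 2 a)) := by
  apply L.torsionFree_pow (n + 2)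
  have h := L.pow_mul_dwork (n + 1) (teichmuller 2 a)
  rw [ghostDiff_succ, ghostComponent_teichmuller, ghostComponent_teichmuller, map_pow] at h
  rw [pow_mul_dwork, ghostDiff_succ, ghostComponent_teichmuller, ghostComponent_teichmuller,
    map_pow]
  have h1 : a ^ 2 ^ (n + 2) = (a ^ 2 ^ (n + 1)) ^ 2 := by rw [← pow_mul, ← pow_succ]
  have h2 : L.φ a ^ 2 ^ (n + 1) = (L.φ a ^ 2 ^ n) ^ 2 := by rw [← pow_mul, ← pow_succ]
  have h3 : L.φ a ^ 2 ^ n = a ^ 2 ^ (n + 1) - 2 ^ (n + 1) * L.dwork (n + 1) (teichmuller 2 a) := by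
    rw [h]; ring
  rw [h1, h2, h3]
  ring

variable [CharP P 2]

theorem red_two_mul (a : A) : L.red (2 * a) = 0 := by
  rw [map_mul, map_ofNat, two_eq_zero, zero_mul]

theorem red_φ (a : A) : L.red (L.φ a) = L.red a ^ 2 := by
  obtain ⟨c, hc⟩ := L.dvd_sub a
  have := congrArg L.red hc
  rw [red_two_mul, map_sub, map_pow, sub_eq_zero] at this
  exact this.symm

theorem red_dwork_mul (n : ℕ) (b : A) (x : WittVector 2 A) :
    L.red (L.dwork n (frobenius (teichmuller 2 b) * x)) =
      L.red b ^ 2 ^ (n + 1) * L.red (L.dwork n x) := by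
  have hw : ∀ m, ghostComponent m (frobenius (teichmuller 2 b) * x) =
      b ^ 2 ^ (m + 1) * ghostComponent m x := fun m => by
    rw [map_mul, ghostComponent_frobenius, ghostComponent_teichmuller]
  obtain ⟨c, hc⟩ : ∃ c, L.dwork n (frobenius (teichmuller 2 b) * x) =
      b ^ 2 ^ (n + 1) * L.dwork n x + 2 * c := by
    rcases n with _ | n
    · refine ⟨0, L.torsionFree_pow 0 _ _ ?_⟩
      rw [mul_zero, add_zero, mul_left_comm, pow_mul_dwork, pow_mul_dwork, ghostDiff_zero, hw,
        ghostDiff_zero]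
    · obtain ⟨c, hc⟩ := L.pow_dvd_sub b (n + 1)
      refine ⟨c * L.φ (ghostComponent n x), L.torsionFree_pow (n + 1) _ _ ?_⟩
      rw [pow_mul_dwork, mul_add, mul_left_comm, pow_mul_dwork, ghostDiff_succ, hw, hw,
        ghostDiff_succ, map_mul, map_pow]
      linear_combination (L.φ (ghostComponent n x)) * hc
  rw [hc, map_add, red_two_mul, add_zero, map_mul, map_pow]

/-- The additive coordinates `c_n : W(A) → P`, where `c_n = b_n + c_{n-1} ^ 2` modulo `2`. The
recursion makes `c_n` of a Teichmüller representative `[x]` a multiple of `x ^ 2` for `n ≥ 2`. -/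
def coord : ℕ → WittVector 2 A →+ P
  | 0 => L.red.toAddMonoidHom.comp (L.dwork 0)
  | n + 1 => L.red.toAddMonoidHom.comp (L.dwork (n + 1)) +
      (_root_.frobenius P 2).toAddMonoidHom.comp (coord n)

theorem coord_zero (x : WittVector 2 A) : L.coord 0 x = L.red (x.coeff 0) := by
  rw [← L.dwork_zero]; rfl

theorem coord_succ (n : ℕ) (x : WittVector 2 A) :
    L.coord (n + 1) x = L.red (L.dwork (n + 1) x) + L.coord n x ^ 2 := rfl

theorem coord_zero_verschiebung (x : WittVector 2 A) : L.coord 0 (verschiebung x) = 0 := by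
  rw [coord_zero, verschiebung_coeff_zero, map_zero]

theorem coord_succ_verschiebung (n : ℕ) (x : WittVector 2 A) :
    L.coord (n + 1) (verschiebung x) = L.coord n x := by
  induction n with
  | zero =>
    rw [coord_succ, coord_zero_verschiebung, dwork_succ_verschiebung, dwork_zero, coord_zero]
    ring
  | succ n ih => rw [coord_succ, ih, dwork_succ_verschiebung, coord_succ]

theorem coord_add_iterate_verschiebung (m n : ℕ) (x : WittVector 2 A) :
    L.coord (n + m) (verschiebung^[m] x) = L.coord n x := by
  induction m with
  | zero => rfl
  | succ m ih =>
    rw [Function.iterate_succ_apply', ← add_assoc, coord_succ_verschiebung, ih]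

theorem coord_iterate_verschiebung_of_lt {m n : ℕ} (h : n < m) (x : WittVector 2 A) :
    L.coord n (verschiebung^[m] x) = 0 := by
  obtain ⟨k, rfl⟩ : ∃ k, m = n + (k + 1) := ⟨m - n - 1, by omega⟩
  rw [Function.iterate_add_apply]
  have := L.coord_add_iterate_verschiebung n 0 (verschiebung^[k + 1] x)
  rw [zero_add] at this
  rw [this, Function.iterate_succ_apply', coord_zero_verschiebung]

theorem coord_mul (n : ℕ) (b : A) (x : WittVector 2 A) :
    L.coord n (frobenius (teichmuller 2 b) * x) = L.red b ^ 2 ^ (n + 1) * L.coord n x := by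
  induction n with
  | zero => exact L.red_dwork_mul 0 b x
  | succ n ih => rw [coord_succ, ih, red_dwork_mul, coord_succ]; ring

theorem coord_two_mul (n : ℕ) (x : WittVector 2 A) : L.coord n (2 * x) = 0 := by
  rw [two_mul, map_add, ← two_mul, two_eq_zero, zero_mul]

theorem coord_one (n : ℕ) : L.coord n 1 = 1 := by
  induction n with
  | zero => rw [coord_zero, one_coeff_zero, map_one]
  | succ n ih =>
    have h : L.dwork (n + 1) 1 = 0 := by
      apply L.torsionFree_pow (n + 1)
      rw [pow_mul_dwork, ghostDiff_succ, map_one, map_one, map_one, sub_self, mul_zero]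
    rw [coord_succ, ih, h, map_zero, zero_add, one_pow]

theorem coord_frobenius_teichmuller (n : ℕ) (b : A) :
    L.coord n (frobenius (teichmuller 2 b)) = L.red b ^ 2 ^ (n + 1) := by
  have := L.coord_mul n b 1
  rwa [mul_one, coord_one, mul_one] at this

theorem delta_mul (a b : A) :
    L.delta (a * b) = L.red a ^ 2 * L.delta b + L.red b ^ 2 * L.delta a := by
  have h : (a * b) ^ 2 - L.φ (a * b) = 2 * (a ^ 2 * L.dwork 1 (teichmuller 2 b) +
      L.φ b * L.dwork 1 (teichmuller 2 a)) := by
    rw [map_mul]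
    linear_combination -a ^ 2 * L.two_mul_dwork_one b - L.φ b * L.two_mul_dwork_one a
  rw [L.delta_eq h, map_add, map_mul, map_mul, map_pow, red_φ]
  rfl

theorem coord_zero_teichmuller (a : A) : L.coord 0 (teichmuller 2 a) = L.red a := by
  rw [coord_zero, teichmuller_coeff_zero]

theorem coord_one_teichmuller (a : A) :
    L.coord 1 (teichmuller 2 a) = L.delta a + L.red a ^ 2 := by
  rw [coord_succ, coord_zero_teichmuller]; rfl

theorem sq_dvd_coord_teichmuller (n : ℕ) (a : A) :
    L.red a ^ 2 ∣ L.coord (n + 2) (teichmuller 2 a) := by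
  induction n with
  | zero =>
    refine ⟨L.delta a + L.red a ^ 2, ?_⟩
    have h2 : (2 : P) = 0 := two_eq_zero P
    rw [coord_succ, coord_one_teichmuller, dwork_teichmuller_succ, map_mul, map_sub,
      map_mul, map_pow, map_pow, map_ofNat]
    change L.delta a * (L.red a ^ 2 ^ 1 - 2 ^ 0 * L.delta a) + _ = _
    linear_combination (L.delta a * L.red a ^ 2) * h2
  | succ n ih =>
    rw [coord_succ, dwork_teichmuller_succ, map_mul, map_sub, map_mul, map_pow, map_pow, map_ofNat,
      two_eq_zero, pow_succ 0 n, mul_zero, zero_mul, sub_zero]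
    refine dvd_add (Dvd.dvd.mul_left ?_ _) (ih.trans (dvd_pow_self _ two_ne_zero))
    exact pow_dvd_pow _ (by rw [pow_succ]; have := Nat.one_le_two_pow (n := n + 1); omega)

end FrobeniusLift

end WittCoordinates

section WittMaps

open WittVector

namespace FrobeniusLift

variable {A P : Type*} [CommRing A] [CommRing P] (L : FrobeniusLift A P) [CharP P 2]

theorem coord_zero_surjective : Function.Surjective (L.coord 0) := by
  intro a
  obtain ⟨b, rfl⟩ := L.red_surjective a
  exact ⟨teichmuller 2 b, L.coord_zero_teichmuller b⟩

theorem exists_of_coord_zero_eq_zero (x : WittVector 2 A) (hx : L.coord 0 x = 0) :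
    ∃ y z : WittVector 2 A, x = 2 * y + verschiebung z := by
  rw [coord_zero] at hx
  obtain ⟨c, hc⟩ := L.red_eq_zero _ hx
  refine ⟨teichmuller 2 c, (x - 2 * teichmuller 2 c).shift 1, ?_⟩
  have h : (x - 2 * teichmuller 2 c).coeff 0 = 0 := by
    have : constantCoeff (x - 2 * teichmuller 2 c) = 0 := by
      rw [map_sub, map_mul, map_ofNat]
      change x.coeff 0 - 2 * (teichmuller 2 c).coeff 0 = 0
      rw [teichmuller_coeff_zero, hc, sub_self]
    exact this
  have h2 := eq_teichmuller_add_verschiebung (x - 2 * teichmuller 2 c)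
  rw [h, teichmuller_zero, zero_add] at h2
  rw [← h2]; ring

theorem coord_zero_mul (x y : WittVector 2 A) :
    L.coord 0 (x * y) = L.coord 0 x * L.coord 0 y := by
  rw [coord_zero, mul_coeff_zero, map_mul, coord_zero, coord_zero]

theorem coord_zero_frobenius (x : WittVector 2 A) :
    L.coord 0 (frobenius x) = L.coord 0 x ^ 2 := by
  have h : (frobenius x).coeff 0 = x.coeff 0 ^ 2 + 2 * x.coeff 1 := by
    have := ghostComponent_frobenius 0 x
    rw [ghostComponent_eq_sum, ghostComponent_eq_sum] at this
    simpa [Finset.sum_range_succ] using this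
  rw [coord_zero, h, map_add, red_two_mul, add_zero, map_pow, coord_zero]

theorem coord_zero_iterate_frobenius (n : ℕ) (x : WittVector 2 A) :
    L.coord 0 (frobenius^[n] x) = L.coord 0 x ^ 2 ^ n := by
  induction n with
  | zero => simp
  | succ n ih =>
    rw [Function.iterate_succ_apply', coord_zero_frobenius, ih, ← pow_mul, ← pow_succ]

/-- An additive map on `W(A)` killing `2` and `V^n` is a sum of additive functions of the first `n`
coordinates, each of which inherits the Frobenius-linearity of the given map. -/
theorem exists_coord_expansion {Y : Type*} [CommRing Y] (q : P →+* Y) (e n : ℕ)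
    (B : WittVector 2 A →+ Y) (h2 : ∀ x, B (2 * x) = 0) (hV : ∀ x, B (verschiebung^[n] x) = 0)
    (hs : ∀ b x, B (frobenius (teichmuller 2 (b ^ 2 ^ e)) * x) = q (L.red b) * B x) :
    ∃ χ : ℕ → P →+ Y, (∀ j, n ≤ j → χ j = 0) ∧
      (∀ j b a, χ j (b ^ 2 ^ (e + j + 1) * a) = q b * χ j a) ∧
      ∀ x, B x = ∑ j ∈ Finset.range n, χ j (L.coord j x) := by
  induction n generalizing B with
  | zero => exact ⟨0, fun _ _ => rfl, fun _ _ _ => by simp, fun x => hV x⟩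
  | succ n ih =>
    have hker : ∀ x, L.coord 0 x = 0 → B (verschiebung^[n] x) = 0 := by
      intro x hx
      obtain ⟨y, z, rfl⟩ := L.exists_of_coord_zero_eq_zero x hx
      rw [iterate_map_add, map_add, ← Function.iterate_succ_apply, hV, add_zero, two_mul,
        iterate_map_add, ← two_mul, h2]
    -- the restriction to the image of `V^n` depends on the last coordinate only
    let top : P →+ Y := (L.coord 0).liftOfSurjective L.coord_zero_surjective
      ⟨B.comp ⟨⟨verschiebung^[n], iterate_map_zero _ _⟩, iterate_map_add _ _⟩,
        fun x hx => hker x hx⟩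
    have htop : ∀ x, top (L.coord 0 x) = B (verschiebung^[n] x) := fun x =>
      AddMonoidHom.liftOfRightInverse_comp_apply _ _ _ _ _
    have htops : ∀ b a, top (b ^ 2 ^ (e + n + 1) * a) = q b * top a := by
      intro b a
      obtain ⟨b, rfl⟩ := L.red_surjective b
      obtain ⟨x, rfl⟩ := L.coord_zero_surjective a
      have h := L.coord_zero_iterate_frobenius (n + 1) (teichmuller 2 (b ^ 2 ^ e))
      rw [coord_zero_teichmuller, map_pow L.red, ← pow_mul, ← pow_add, ← add_assoc] at h
      rw [← h, ← coord_zero_mul, htop, htop, ← hs, mul_comm, Function.iterate_succ_apply,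
        ← iterate_verschiebung_mul_left, mul_comm]
    obtain ⟨χ, h0, h1, h3⟩ := ih (B - top.comp (L.coord n))
      (fun x => by simp [h2, coord_two_mul])
      (fun x => by
        have := L.coord_add_iterate_verschiebung n 0 x
        rw [zero_add] at this
        simp [this, htop])
      (fun b x => by
        simp only [AddMonoidHom.sub_apply, AddMonoidHom.comp_apply, hs, coord_mul]
        rw [map_pow L.red, ← pow_mul, ← pow_add, ← add_assoc, htops, mul_sub])
    refine ⟨fun j => if j = n then top else χ j, ?_, ?_, ?_⟩
    · intro j hj
      simp only [if_neg (show j ≠ n by omega), h0 j (show n ≤ j by omega)]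
    · intro j b a
      by_cases hj : j = n
      · subst hj; simp only [if_true]; exact htops b a
      · simp only [if_neg hj]; exact h1 j b a
    · intro x
      rw [Finset.sum_range_succ, Finset.sum_congr rfl (g := fun j => χ j (L.coord j x))
        (fun j hj => by simp only [if_neg (Finset.mem_range.mp hj).ne]), ← h3]
      simp

/-- In terms of coordinates, vanishing on the Witt vectors with coordinates in `(f)` is a two-term
condition: all contributions of `f ^ 2` die, and `[f d]` is `f d` in the first coordinate,
`δ(f) d ^ 2` in the second one and zero in the others up to multiples of `f ^ 2`. -/
theorem vanish_iff {Y : Type*} [AddCommGroup Y] (n : ℕ) (χ : ℕ → P →+ Y)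
    (h0 : ∀ j, n ≤ j → χ j = 0) (f : A) :
    (∀ i < n, ∀ d, ∑ j ∈ Finset.range n,
      χ j (L.coord j (verschiebung^[i] (teichmuller 2 (f * d)))) = 0) ↔
    ∀ j d, χ j (L.red f * d) + χ (j + 1) (L.delta f * d ^ 2) = 0 := by
  -- the sum for `V^i [x]`, with a vanishing tail from `i + 2` on
  have hsum : ∀ i < n, ∀ x, (∀ j, i + 2 ≤ j → χ j (L.coord (j - i) (teichmuller 2 x)) = 0) →
      ∑ j ∈ Finset.range n, χ j (L.coord j (verschiebung^[i] (teichmuller 2 x))) =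
        χ i (L.red x) + χ (i + 1) (L.delta x + L.red x ^ 2) := by
    intro i hi x hx
    have hterm : ∀ j, χ j (L.coord j (verschiebung^[i] (teichmuller 2 x))) =
        (if j = i then χ i (L.red x) else 0) +
          if j = i + 1 then χ (i + 1) (L.delta x + L.red x ^ 2) else 0 := by
      intro j
      rcases lt_or_ge j i with hj | hj
      · rw [coord_iterate_verschiebung_of_lt L hj, map_zero, if_neg (by omega),
          if_neg (by omega), add_zero]
      · obtain ⟨k, rfl⟩ := Nat.exists_eq_add_of_le hj
        rw [add_comm i k, coord_add_iterate_verschiebung]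
        rcases k with _ | _ | k
        · simp [coord_zero_teichmuller]
        · rw [if_neg (by omega), if_pos (by omega), zero_add, zero_add, coord_one_teichmuller,
            add_comm 1 i]
        · have := hx (k + 1 + 1 + i) (by omega)
          rw [Nat.add_sub_cancel] at this
          rw [this, if_neg (by omega), if_neg (by omega), add_zero]
    rw [Finset.sum_congr rfl (fun j _ => hterm j), Finset.sum_add_distrib,
      Finset.sum_ite_eq', Finset.sum_ite_eq', if_pos (Finset.mem_range.mpr hi)]
    by_cases hn : i + 1 < n
    · rw [if_pos (Finset.mem_range.mpr hn)]
    · rw [if_neg (by simpa using hn), h0 (i + 1) (by omega), AddMonoidHom.zero_apply]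
  have hdelta : ∀ d, ∃ t, L.delta (f * d) + L.red (f * d) ^ 2 =
      L.delta f * L.red d ^ 2 + L.red f ^ 2 * t := fun d =>
    ⟨L.delta d + L.red d ^ 2, by rw [delta_mul, map_mul]; ring⟩
  have hsq : ∀ l d, ∃ t, L.coord (l + 2) (teichmuller 2 (f * d)) = L.red f ^ 2 * t := fun l d => by
    obtain ⟨t, ht⟩ := L.sq_dvd_coord_teichmuller l (f * d)
    exact ⟨L.red d ^ 2 * t, by rw [ht, map_mul]; ring⟩
  have htail : ∀ i d, (∀ j, i + 2 ≤ j → ∀ t, χ j (L.red f ^ 2 * t) = 0) →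
      ∀ j, i + 2 ≤ j → χ j (L.coord (j - i) (teichmuller 2 (f * d))) = 0 := by
    intro i d h j hj
    obtain ⟨t, ht⟩ := hsq (j - i - 2) d
    rw [show j - i = j - i - 2 + 2 by omega, ht, h j hj]
  constructor
  · intro h
    -- `χ_j` kills the multiples of `f ^ 2`, by descending induction on `j`
    have hK : ∀ k j, n ≤ j + k → ∀ t, χ j (L.red f ^ 2 * t) = 0 := by
      intro k
      induction k with
      | zero => intro j hj t; rw [h0 j hj, AddMonoidHom.zero_apply]
      | succ k ih =>
        intro j hj t
        rcases lt_or_ge j n with hjn | hjn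
        · obtain ⟨t, rfl⟩ := L.red_surjective t
          have h1 := h j hjn (f * t)
          rw [hsum j hjn _ (htail j (f * t) fun j' hj' => ih j' (by omega))] at h1
          obtain ⟨t', ht'⟩ := hdelta (f * t)
          rw [ht', show L.delta f * L.red (f * t) ^ 2 + L.red f ^ 2 * t' =
            L.red f ^ 2 * (L.delta f * L.red t ^ 2 + t') by rw [map_mul]; ring,
            ih (j + 1) (by omega), add_zero] at h1
          rw [← h1, map_mul L.red, map_mul L.red, ← mul_assoc, ← sq]
        · rw [h0 j hjn, AddMonoidHom.zero_apply]
    intro j d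
    rcases lt_or_ge j n with hjn | hjn
    · obtain ⟨d, rfl⟩ := L.red_surjective d
      have h1 := h j hjn d
      rw [hsum j hjn _ (htail j d fun j' _ => hK n j' (by omega))] at h1
      obtain ⟨t', ht'⟩ := hdelta d
      rwa [ht', map_add, hK n (j + 1) (by omega), add_zero, map_mul] at h1
    · rw [h0 j hjn, h0 (j + 1) (by omega), AddMonoidHom.zero_apply, AddMonoidHom.zero_apply,
        add_zero]
  · intro h
    have hK : ∀ k j, n ≤ j + k → ∀ t, χ j (L.red f ^ 2 * t) = 0 := by
      intro k
      induction k with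
      | zero => intro j hj t; rw [h0 j hj, AddMonoidHom.zero_apply]
      | succ k ih =>
        intro j hj t
        have h1 := h j (L.red f * t)
        rw [show L.delta f * (L.red f * t) ^ 2 = L.red f ^ 2 * (L.delta f * t ^ 2) by ring,
          ih (j + 1) (by omega), add_zero] at h1
        rw [← h1]; congr 1; ring
    intro i hi d
    rw [hsum i hi _ (htail i d fun j' _ => hK n j' (by omega))]
    obtain ⟨t', ht'⟩ := hdelta d
    rw [ht', map_add, hK n (i + 1) (by omega), add_zero, map_mul, h]

end FrobeniusLift

/-- Additive maps on `W(A)` which factor through `W_n(R) / 2`, for `R = A / (f)`. -/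
theorem eq_zero_of_toWBar_eq_zero {A R : Type*} [CommRing A] [CommRing R] (π : A →+* R)
    (hπ : Function.Surjective π) (f : A) (hf : ∀ a, π a = 0 → f ∣ a) {Y : Type*} [AddCommGroup Y]
    (n : ℕ) (B : WittVector 2 A →+ Y) (h2 : ∀ x, B (2 * x) = 0)
    (hV : ∀ x, B (verschiebung^[n] x) = 0)
    (hT : ∀ i < n, ∀ d, B (verschiebung^[i] (teichmuller 2 (f * d))) = 0)
    (x : WittVector 2 A) (hx : toWBar 2 R n (WittVector.map π x) = 0) : B x = 0 := by
  have key : ∀ (n : ℕ) (B : WittVector 2 A →+ Y), (∀ x, B (verschiebung^[n] x) = 0) →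
      (∀ i < n, ∀ d, B (verschiebung^[i] (teichmuller 2 (f * d))) = 0) →
      ∀ y : WittVector 2 A, (∀ i < n, π (y.coeff i) = 0) → B y = 0 := by
    intro n
    induction n with
    | zero => intro B hV _ y _; exact hV y
    | succ n ih =>
      intro B hV hT y hy
      obtain ⟨d, hd⟩ := hf _ (hy 0 (Nat.succ_pos n))
      rw [eq_teichmuller_add_verschiebung y, map_add, hd]
      have h1 := hT 0 (Nat.succ_pos n) d
      rw [Function.iterate_zero, id] at h1
      rw [h1, zero_add]
      refine ih (B.comp verschiebung) (fun x => ?_) (fun i hi d => ?_) (y.shift 1) (fun i hi => ?_)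
      · have := hV x
        rwa [Function.iterate_succ_apply'] at this
      · have := hT (i + 1) (Nat.succ_lt_succ hi) d
        rwa [Function.iterate_succ_apply'] at this
      · rw [shift_coeff, add_comm]
        exact hy (i + 1) (Nat.succ_lt_succ hi)
  have h1 := Ideal.Quotient.eq_zero_iff_mem.mp hx
  obtain ⟨c, hc⟩ := Ideal.mem_span_singleton'.mp h1
  obtain ⟨c, rfl⟩ := truncate_surjective 2 n R c
  obtain ⟨c, rfl⟩ := WittVector.map_surjective π hπ c
  have h3 : truncate n (WittVector.map π (x - 2 * c)) = 0 := by
    rw [map_sub, map_sub, ← hc, map_mul, map_mul, map_ofNat, map_ofNat]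
    push_cast
    ring
  rw [← RingHom.mem_ker, mem_ker_truncate] at h3
  have h4 := key n B hV hT (x - 2 * c) (fun i hi => by
    have := h3 i hi
    rwa [map_coeff] at this)
  rw [map_sub, h2, sub_zero] at h4
  exact h4

end WittMaps

/-! ### The trace map on power series over a perfect field -/

section Trace

open MvPowerSeries

variable {k : Type*} [Field k] [CharP k 2] {σ : Type*}

instance : CharP (MvPowerSeries σ k) 2 :=
  charP_of_injective_ringHom (C_injective (σ := σ) (R := k)) 2

theorem coeff_two_smul_sq (d : σ →₀ ℕ) (a : MvPowerSeries σ k) :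
    coeff (2 • d) (a ^ 2) = coeff d a ^ 2 := by
  rw [← map_frobenius_expand 2 two_ne_zero, coeff_map, coeff_expand_smul, frobenius_def]

theorem coeff_sq_of_odd {m : σ →₀ ℕ} {i : σ} (h : ¬ 2 ∣ m i) (a : MvPowerSeries σ k) :
    coeff m (a ^ 2) = 0 := by
  rw [← map_frobenius_expand 2 two_ne_zero, coeff_map, coeff_expand_of_not_dvd 2 _ _ h, map_zero]

/-- The exponent vector with entries `0` and `1` given by `e`. -/
def parity [Fintype σ] (e : σ → Fin 2) : σ →₀ ℕ :=
  Finsupp.equivFunOnFinite.symm fun i => (e i : ℕ)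

@[simp] theorem parity_apply [Fintype σ] (e : σ → Fin 2) (i : σ) : parity e i = (e i : ℕ) := rfl

theorem coeff_parity_monomial_mul_sq [Fintype σ] (d : σ →₀ ℕ) (e e' : σ → Fin 2)
    (c : MvPowerSeries σ k) :
    coeff (2 • d + parity e') (monomial (parity e) 1 * c ^ 2) =
      if e = e' then coeff d c ^ 2 else 0 := by
  classical
  split_ifs with h
  · subst h
    rw [add_comm, coeff_add_monomial_mul, one_mul, coeff_two_smul_sq]
  · obtain ⟨i, hi⟩ := Function.ne_iff.mp h
    rw [coeff_monomial_mul]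
    split_ifs with hle
    · rw [one_mul]
      apply coeff_sq_of_odd (i := i)
      have h1 := hle i
      simp only [Finsupp.tsub_apply, Finsupp.add_apply, Finsupp.smul_apply, smul_eq_mul,
        parity_apply] at h1 ⊢
      have h2 : (e i : ℕ) ≠ e' i := fun h => hi (Fin.ext h)
      have h3 := (e i).isLt
      have h4 := (e' i).isLt
      omega
    · rfl

variable [PerfectRing k 2]

/-- The component of a power series along the exponents congruent to `s` modulo `2`, rescaled by
`x ^ (2 d + s) ↦ x ^ d` and with square roots of the coefficients. -/
def sqrtPart (s : σ →₀ ℕ) : MvPowerSeries σ k →+ MvPowerSeries σ k where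
  toFun a := fun d => (frobeniusEquiv k 2).symm (coeff (2 • d + s) a)
  map_zero' := by
    ext d
    change (frobeniusEquiv k 2).symm (coeff (2 • d + s) 0) = 0
    rw [coeff_zero, map_zero]
  map_add' a b := by
    ext d
    change (frobeniusEquiv k 2).symm (coeff (2 • d + s) (a + b)) =
      (frobeniusEquiv k 2).symm (coeff (2 • d + s) a) +
        (frobeniusEquiv k 2).symm (coeff (2 • d + s) b)
    rw [map_add, map_add]

theorem coeff_sqrtPart (s d : σ →₀ ℕ) (a : MvPowerSeries σ k) :
    coeff d (sqrtPart s a) = (frobeniusEquiv k 2).symm (coeff (2 • d + s) a) := rfl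

theorem coeff_sqrtPart_sq (s d : σ →₀ ℕ) (a : MvPowerSeries σ k) :
    coeff d (sqrtPart s a) ^ 2 = coeff (2 • d + s) a := by
  rw [coeff_sqrtPart, ← frobenius_def, frobenius_apply_frobeniusEquiv_symm]

variable [Fintype σ]

theorem sqrtPart_monomial_mul_sq (e e' : σ → Fin 2) (c : MvPowerSeries σ k) :
    sqrtPart (parity e') (monomial (parity e) 1 * c ^ 2) = if e = e' then c else 0 := by
  ext d
  rw [coeff_sqrtPart, coeff_parity_monomial_mul_sq]
  split_ifs with h
  · rw [← frobenius_def, frobeniusEquiv_symm_apply_frobenius]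
  · rw [map_zero, coeff_zero]

/-- The trace map: it sends `x ^ (2 d + 1) a ^ 2` to `x ^ d a` and kills the monomials with an
even exponent. It generates `Hom(F_* P, P)`. -/
def tr : MvPowerSeries σ k →+ MvPowerSeries σ k := sqrtPart (parity fun _ => 1)

theorem tr_monomial_mul (e : σ → Fin 2) (a : MvPowerSeries σ k) :
    tr (monomial (parity fun i => 1 - e i) 1 * a) = sqrtPart (parity e) a := by
  ext d
  rw [tr, coeff_sqrtPart, coeff_sqrtPart]
  have h : 2 • d + parity (fun _ : σ => (1 : Fin 2)) =
      parity (fun i => 1 - e i) + (2 • d + parity e) := by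
    ext i
    simp only [Finsupp.add_apply, parity_apply]
    generalize e i = c
    fin_cases c <;> simp [add_comm]
  rw [h, coeff_add_monomial_mul, one_mul]

/-- The iterates of the trace map. -/
def trPow (m : ℕ) : MvPowerSeries σ k →+ MvPowerSeries σ k where
  toFun := tr^[m]
  map_zero' := iterate_map_zero _ _
  map_add' := iterate_map_add _ _

theorem trPow_zero (a : MvPowerSeries σ k) : trPow 0 a = a := rfl

theorem trPow_add (m n : ℕ) (a : MvPowerSeries σ k) : trPow (m + n) a = trPow m (trPow n a) :=
  Function.iterate_add_apply _ _ _ _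

theorem trPow_succ (m : ℕ) (a : MvPowerSeries σ k) : trPow (m + 1) a = trPow m (tr a) := rfl

theorem trPow_succ' (m : ℕ) (a : MvPowerSeries σ k) : trPow (m + 1) a = tr (trPow m a) :=
  Function.iterate_succ_apply' _ _ _

variable [DecidableEq σ]

/-- Power series over a perfect field of characteristic `2` form a free module over their squares,
with basis the monomials whose exponents are `0` or `1`. -/
theorem eq_sum_sqrtPart (a : MvPowerSeries σ k) :
    a = ∑ e : σ → Fin 2, monomial (parity e) 1 * sqrtPart (parity e) a ^ 2 := by
  ext m
  obtain ⟨d, e, rfl⟩ : ∃ (d : σ →₀ ℕ) (e : σ → Fin 2), m = 2 • d + parity e := by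
    refine ⟨Finsupp.equivFunOnFinite.symm fun i => m i / 2,
      fun i => ⟨m i % 2, Nat.mod_lt _ two_pos⟩, ?_⟩
    ext i
    exact (Nat.div_add_mod (m i) 2).symm
  rw [map_sum, Finset.sum_congr rfl (fun e' _ => coeff_parity_monomial_mul_sq d e' e _)]
  simp [coeff_sqrtPart_sq]

theorem sqrtPart_sq_mul (e : σ → Fin 2) (a b : MvPowerSeries σ k) :
    sqrtPart (parity e) (a ^ 2 * b) = a * sqrtPart (parity e) b := by
  conv_lhs => rw [eq_sum_sqrtPart b, Finset.mul_sum]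
  simp_rw [mul_left_comm (a ^ 2), ← mul_pow, map_sum, sqrtPart_monomial_mul_sq]
  simp

theorem tr_sq_mul (a b : MvPowerSeries σ k) : tr (a ^ 2 * b) = a * tr b := sqrtPart_sq_mul _ a b

theorem trPow_pow_mul (m : ℕ) (a b : MvPowerSeries σ k) :
    trPow m (a ^ 2 ^ m * b) = a * trPow m b := by
  induction m generalizing b with
  | zero => simp [trPow_zero]
  | succ m ih => rw [trPow_succ, pow_succ, pow_mul, tr_sq_mul, ih, trPow_succ]

/-- Every `2^{-m}`-linear map from `P` to a quotient of `P` is a multiple of the iterated trace. -/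
theorem exists_eq_trPow_mul {Y : Type*} [CommRing Y] (q : MvPowerSeries σ k →+* Y)
    (hq : Function.Surjective q) (m : ℕ) (χ : MvPowerSeries σ k →+ Y)
    (h : ∀ b a, χ (b ^ 2 ^ m * a) = q b * χ a) : ∃ g, ∀ a, χ a = q (trPow m (g * a)) := by
  induction m generalizing χ with
  | zero =>
    obtain ⟨g, hg⟩ := hq (χ 1)
    refine ⟨g, fun a => ?_⟩
    have := h a 1
    rw [pow_zero, pow_one, mul_one] at this
    rw [this, trPow_zero, map_mul, hg, mul_comm]
  | succ m ih =>
    have hx : ∀ e : σ → Fin 2, ∃ g, ∀ a,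
        χ (monomial (parity e) 1 * a ^ 2) = q (trPow m (g * a)) := by
      intro e
      obtain ⟨g, hg⟩ := ih ((χ.comp (AddMonoidHom.mulLeft (monomial (parity e) 1))).comp
        (frobenius (MvPowerSeries σ k) 2).toAddMonoidHom) (fun b a => by
          have := h b (monomial (parity e) 1 * a ^ 2)
          refine Eq.trans ?_ this
          change χ (_ * (b ^ 2 ^ m * a) ^ 2) = _
          congr 1
          ring)
      exact ⟨g, hg⟩
    choose g hg using hx
    refine ⟨∑ e, g e ^ 2 * monomial (parity fun i => 1 - e i) 1, fun a => ?_⟩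
    conv_lhs => rw [eq_sum_sqrtPart a, map_sum]
    rw [Finset.sum_mul, map_sum, map_sum]
    refine Finset.sum_congr rfl fun e _ => ?_
    rw [hg, mul_assoc, trPow_succ, tr_sq_mul, tr_monomial_mul]

/-- The pairing given by the iterated trace is nondegenerate modulo every principal ideal. -/
theorem pow_dvd_of_forall_dvd_trPow (m : ℕ) (f g : MvPowerSeries σ k)
    (h : ∀ a, f ∣ trPow m (g * a)) : f ^ 2 ^ m ∣ g := by
  induction m generalizing g with
  | zero => simpa [trPow_zero] using h 1
  | succ m ih =>
    rw [eq_sum_sqrtPart g]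
    refine Finset.dvd_sum fun e _ => Dvd.dvd.mul_left ?_ _
    rw [pow_succ, pow_mul]
    refine pow_dvd_pow_of_dvd (ih _ fun a => ?_) 2
    have := h (monomial (parity fun i => 1 - e i) 1 * a ^ 2)
    rwa [trPow_succ, show g * (monomial (parity fun i => 1 - e i) 1 * a ^ 2) =
      a ^ 2 * (monomial (parity fun i => 1 - e i) 1 * g) by ring, tr_sq_mul, tr_monomial_mul,
      mul_comm a] at this

end Trace

/-! ### Functionals on power series and their Frobenius -/

section Functionals

open MvPowerSeries

/-- Additive functionals on a ring `P`, a `P`-module by `(a • ℓ) b = ℓ (a * b)`. The module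
structure depends on the type synonym, so that it is not confused with other actions on `P →+ k`. -/
def Functional (P k : Type*) [CommRing P] [AddCommGroup k] : Type _ := P →+ k

namespace Functional

variable {P k : Type*} [CommRing P] [AddCommGroup k]

instance : AddCommGroup (Functional P k) := inferInstanceAs (AddCommGroup (P →+ k))

instance : FunLike (Functional P k) P k := inferInstanceAs (FunLike (P →+ k) P k)

instance : AddMonoidHomClass (Functional P k) P k :=
  inferInstanceAs (AddMonoidHomClass (P →+ k) P k)

theorem ext {l l' : Functional P k} (h : ∀ a, l a = l' a) : l = l' := DFunLike.ext _ _ h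

theorem zero_apply (a : P) : (0 : Functional P k) a = 0 := rfl

instance : Module P (Functional P k) where
  smul a l := AddMonoidHom.comp (show P →+ k from l) (AddMonoidHom.mulLeft a)
  one_smul l := ext fun b => congrArg l (one_mul b)
  mul_smul a a' l := ext fun b => congrArg l (by
    change a * a' * b = a' * (a * b)
    ring)
  smul_zero _ := rfl
  smul_add _ _ _ := rfl
  add_smul a a' l := ext fun b => by
    change l ((a + a') * b) = l (a * b) + l (a' * b)
    rw [add_mul, map_add]
  zero_smul l := ext fun b => by
    change l (0 * b) = 0
    rw [zero_mul, map_zero]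

theorem smul_apply (a : P) (l : Functional P k) (b : P) : (a • l) b = l (a * b) := rfl

theorem eq_zero_iff (l : Functional P k) : l = 0 ↔ ∀ a, l a = 0 :=
  ⟨fun h a => by rw [h, zero_apply], fun h => ext h⟩

end Functional

variable {k : Type*} [Field k] [CharP k 2] [PerfectRing k 2] {σ : Type*} [Fintype σ]

/-- The Frobenius `ℓ ↦ ℓ ∘ tr` on functionals on power series. Under the duality between functionals
and the top local cohomology of `P`, it corresponds to the Frobenius action on the latter. -/
def fr : Functional (MvPowerSeries σ k) k →+ Functional (MvPowerSeries σ k) k where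
  toFun l := AddMonoidHom.comp (show MvPowerSeries σ k →+ k from l) tr
  map_zero' := rfl
  map_add' _ _ := rfl

theorem fr_apply (l : Functional (MvPowerSeries σ k) k) (a : MvPowerSeries σ k) :
    fr l a = l (tr a) := rfl

/-- The functionals `ξ_0 = F(ℓ)` and `ξ_{j+1} = δ F(ξ_j)`. -/
def xi (δ : MvPowerSeries σ k) (l : Functional (MvPowerSeries σ k) k) :
    ℕ → Functional (MvPowerSeries σ k) k
  | 0 => fr l
  | j + 1 => δ • fr (xi δ l j)

theorem xi_succ_apply (δ : MvPowerSeries σ k) (l : Functional (MvPowerSeries σ k) k) (j : ℕ)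
    (a : MvPowerSeries σ k) : xi δ l (j + 1) a = xi δ l j (tr (δ * a)) := rfl

variable [DecidableEq σ]

theorem fr_smul (a : MvPowerSeries σ k) (l : Functional (MvPowerSeries σ k) k) :
    fr (a • l) = a ^ 2 • fr l :=
  Functional.ext fun b => by
    rw [fr_apply, Functional.smul_apply, Functional.smul_apply, fr_apply, tr_sq_mul]

theorem smul_fr_eq_zero_iff (w : MvPowerSeries σ k) (l : Functional (MvPowerSeries σ k) k) :
    w • fr l = 0 ↔ ∀ c, tr (w * c) • l = 0 := by
  constructor
  · intro h c
    refine Functional.ext fun d => ?_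
    have := (Functional.eq_zero_iff _).mp h (d ^ 2 * c)
    rwa [Functional.smul_apply, fr_apply, mul_left_comm, tr_sq_mul, mul_comm] at this
  · intro h
    refine Functional.ext fun c => ?_
    have := (Functional.eq_zero_iff _).mp (h c) 1
    rwa [Functional.smul_apply, mul_one] at this

theorem sq_smul_xi (f δ : MvPowerSeries σ k) (l : Functional (MvPowerSeries σ k) k)
    (hl : f • l = 0) (m : ℕ) (h : ∀ j < m, f • xi δ l j = 0) : f ^ 2 • xi δ l m = 0 := by
  rcases m with _ | m
  · rw [xi, ← fr_smul, hl, map_zero]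
  · rw [xi, smul_comm, ← fr_smul, h m (Nat.lt_succ_self m), map_zero, smul_zero]

/-! ### Chains of power series -/

/-- `c` is a possible value at the start of a chain of length `m + 1` which ends in `S`. This
describes the homomorphisms out of `Q_{R,(m+1)}`, in terms of the power series `g_0, …, g_m` which
represent them in coordinates. -/
def IsFedderValue (f δ : MvPowerSeries σ k) (e m : ℕ) (S : MvPowerSeries σ k → Prop)
    (c : MvPowerSeries σ k) : Prop :=
  ∃ g : ℕ → MvPowerSeries σ k, (∀ j, m < j → g j = 0) ∧
    (∀ j, f ^ 2 ^ (e + j + 1) ∣ f * g j + tr (g (j + 1) * δ)) ∧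
    (∃ c', S c' ∧ g m = f ^ (2 ^ (e + m + 1) - 1) * c') ∧
    f ^ 2 ^ e ∣ ∑ j ∈ Finset.range (m + 1), trPow (j + 1) (g j) - f ^ (2 ^ e - 1) * c

/-- The condition obtained from `IsFedderValue` by writing `g_j` as a multiple of
`f ^ (2 ^ (e + j + 1) - 2)`; it does not depend on `e`. -/
def IsChainValue (f δ : MvPowerSeries σ k) (m : ℕ) (S : MvPowerSeries σ k → Prop)
    (c : MvPowerSeries σ k) : Prop :=
  ∃ h : ℕ → MvPowerSeries σ k, (∀ j < m, f ∣ h j - tr (δ * h (j + 1))) ∧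
    (∃ c', S c' ∧ h m = f * c') ∧
    f ∣ ∑ j ∈ Finset.range (m + 1), trPow (j + 1) (f ^ (2 ^ (j + 1) - 2) * h j) - c

theorem tr_pow_sub_two_mul (f a : MvPowerSeries σ k) (n : ℕ) :
    tr (f ^ (2 ^ (n + 1) - 2) * a) = f ^ (2 ^ n - 1) * tr a := by
  rw [show f ^ (2 ^ (n + 1) - 2) = (f ^ (2 ^ n - 1)) ^ 2 by
    rw [← pow_mul]; congr 1; rw [pow_succ]; omega, tr_sq_mul]

theorem trPow_shift (f a : MvPowerSeries σ k) (e j : ℕ) :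
    trPow (j + 1) (f ^ (2 ^ (e + j + 1) - 2) * a) =
      f ^ (2 ^ e - 1) * trPow (j + 1) (f ^ (2 ^ (j + 1) - 2) * a) := by
  rw [← trPow_pow_mul, ← mul_assoc, ← pow_mul, ← pow_add]
  congr 3
  have h1 := Nat.one_le_two_pow (n := e)
  have h2 : 2 ^ 1 ≤ 2 ^ (j + 1) := Nat.pow_le_pow_right two_pos (by omega)
  rw [add_assoc, pow_add 2 e]
  generalize 2 ^ (j + 1) = b at *
  obtain ⟨a, ha⟩ : ∃ a, 2 ^ e = a + 1 := ⟨2 ^ e - 1, by omega⟩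
  rw [ha, Nat.add_sub_cancel, add_mul, one_mul]
  omega

/-- The divisibilities force `g_j` to be a multiple of `f ^ (2 ^ (e + j + 1) - 2)`, by descending
induction on `j`; dividing by these powers gives the chain. -/
theorem isFedderValue_iff {f : MvPowerSeries σ k} (hf : f ≠ 0) (δ : MvPowerSeries σ k) (e m : ℕ)
    (S : MvPowerSeries σ k → Prop) (c : MvPowerSeries σ k) :
    IsFedderValue f δ e m S c ↔ IsChainValue f δ m S c := by
  have h2 : ∀ n, 2 ≤ 2 ^ (n + 1) := fun n => by
    have := Nat.one_le_two_pow (n := n); rw [pow_succ]; omega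
  have hchar : ∀ a b : MvPowerSeries σ k, a - b = a + b := fun a b => CharTwo.sub_eq_add a b
  -- common reformulation of the last conditions
  have hlast : ∀ h : ℕ → MvPowerSeries σ k,
      f ^ 2 ^ e ∣ ∑ j ∈ Finset.range (m + 1), trPow (j + 1) (f ^ (2 ^ (e + j + 1) - 2) * h j) -
        f ^ (2 ^ e - 1) * c ↔
      f ∣ ∑ j ∈ Finset.range (m + 1), trPow (j + 1) (f ^ (2 ^ (j + 1) - 2) * h j) - c := by
    intro h
    simp_rw [trPow_shift]
    rw [← Finset.mul_sum, ← mul_sub]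
    conv_lhs => rw [show 2 ^ e = 2 ^ e - 1 + 1 from
      (Nat.sub_add_cancel Nat.one_le_two_pow).symm, pow_succ, Nat.add_sub_cancel]
    exact mul_dvd_mul_iff_left (pow_ne_zero _ hf)
  have hstep : ∀ j (a b : MvPowerSeries σ k),
      f ^ 2 ^ (e + j + 1) ∣ f * (f ^ (2 ^ (e + j + 1) - 2) * a) +
        tr (f ^ (2 ^ (e + (j + 1) + 1) - 2) * b * δ) ↔ f ∣ a - tr (δ * b) := by
    intro j a b
    rw [mul_assoc, ← add_assoc e j 1, tr_pow_sub_two_mul, ← mul_assoc, ← pow_succ',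
      show 2 ^ (e + j + 1) - 2 + 1 = 2 ^ (e + j + 1) - 1 by have := h2 (e + j); omega, ← mul_add,
      hchar, mul_comm b]
    conv_lhs => rw [show 2 ^ (e + j + 1) = 2 ^ (e + j + 1) - 1 + 1 from
      (Nat.sub_add_cancel Nat.one_le_two_pow).symm, pow_succ, Nat.add_sub_cancel]
    exact mul_dvd_mul_iff_left (pow_ne_zero _ hf)
  have htop : ∀ c', f ^ (2 ^ (e + m + 1) - 1) * c' = f ^ (2 ^ (e + m + 1) - 2) * (f * c') := by
    intro c'
    rw [← mul_assoc, ← pow_succ]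
    congr 2
    have := h2 (e + m); omega
  constructor
  · rintro ⟨g, h0, h1, ⟨c', hc', hgm⟩, h3⟩
    have hdiv : ∀ i j, i + j = m → ∃ h, g j = f ^ (2 ^ (e + j + 1) - 2) * h := by
      intro i
      induction i with
      | zero =>
        intro j hj
        rw [zero_add] at hj
        subst hj
        exact ⟨f * c', by rw [hgm, htop]⟩
      | succ i ih =>
        intro j hj
        obtain ⟨h, hh⟩ := ih (j + 1) (by omega)
        obtain ⟨d, hd⟩ := h1 j
        refine ⟨tr (h * δ) + f * d, mul_left_cancel₀ hf ?_⟩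
        rw [hh, mul_assoc, ← add_assoc e j 1, tr_pow_sub_two_mul] at hd
        have e1 : f ^ 2 ^ (e + j + 1) = f ^ (2 ^ (e + j + 1) - 2) * f ^ 2 := by
          rw [← pow_add]; congr 1; have := h2 (e + j); omega
        have e2 : f ^ (2 ^ (e + j + 1) - 1) = f ^ (2 ^ (e + j + 1) - 2) * f := by
          rw [← pow_succ]; congr 1; have := h2 (e + j); omega
        rw [e1, e2] at hd
        have h20 := two_eq_zero (MvPowerSeries σ k)
        linear_combination hd - (f ^ (2 ^ (e + j + 1) - 2) * f * tr (h * δ)) * h20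
    have hall : ∀ j, ∃ h, (j ≤ m → g j = f ^ (2 ^ (e + j + 1) - 2) * h) := fun j => by
      by_cases hj : j ≤ m
      · obtain ⟨h, hh⟩ := hdiv (m - j) j (by omega)
        exact ⟨h, fun _ => hh⟩
      · exact ⟨0, fun h => absurd h hj⟩
    choose h hh using hall
    refine ⟨h, fun j hj => ?_, ⟨c', hc', ?_⟩, ?_⟩
    · have := h1 j
      rw [hh j hj.le, hh (j + 1) hj] at this
      exact (hstep j _ _).mp this
    · have := hh m le_rfl
      rw [hgm, htop] at this
      exact (mul_left_cancel₀ (pow_ne_zero _ hf) this).symm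
    · rw [← hlast, Finset.sum_congr rfl (g := fun j => trPow (j + 1) (g j)) fun j hj => by
        rw [hh j (by have := Finset.mem_range.mp hj; omega)]]
      exact h3
  · rintro ⟨h, h1, ⟨c', hc', hm⟩, h3⟩
    refine ⟨fun j => if j ≤ m then f ^ (2 ^ (e + j + 1) - 2) * h j else 0, ?_, ?_,
      ⟨c', hc', ?_⟩, ?_⟩
    · intro j hj
      simp only [if_neg (not_le.mpr hj)]
    · intro j
      rcases lt_trichotomy j m with hj | rfl | hj
      · simp only [if_pos hj.le, if_pos (show j + 1 ≤ m from hj)]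
        exact (hstep j _ _).mpr (h1 j hj)
      · simp only [if_pos le_rfl, if_neg (show ¬ j + 1 ≤ j by omega), zero_mul, map_zero, add_zero]
        refine ⟨c', ?_⟩
        rw [hm, ← htop, ← mul_assoc, ← pow_succ', Nat.sub_add_cancel Nat.one_le_two_pow]
      · simp only [if_neg (not_le.mpr hj), if_neg (show ¬ j + 1 ≤ m by omega), zero_mul, mul_zero,
          map_zero, add_zero, dvd_zero]
    · simp only [if_pos le_rfl]
      rw [hm, htop]
    · rw [← hlast] at h3
      rw [Finset.sum_congr rfl (g := fun j => trPow (j + 1) (f ^ (2 ^ (e + j + 1) - 2) * h j))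
        fun j hj => by simp only [if_pos (show j ≤ m by have := Finset.mem_range.mp hj; omega)]]
      exact h3

/-- The contributions of `h_j`, `j ≥ 1`, to the value of a chain are in the image of `f` under the
trace. -/
theorem exists_sum_eq (f : MvPowerSeries σ k) (m : ℕ) (h : ℕ → MvPowerSeries σ k) :
    ∃ t, ∑ j ∈ Finset.range (m + 1), trPow (j + 1) (f ^ (2 ^ (j + 1) - 2) * h j) =
      tr (h 0) + if m = 0 then 0 else tr (f * t) := by
  refine ⟨∑ j ∈ Finset.range m, trPow (j + 1) (f ^ (2 ^ (j + 1) - 2) * h (j + 1)), ?_⟩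
  rw [Finset.sum_range_succ', add_comm]
  congr 1
  · simp [trPow_succ, trPow_zero]
  · split_ifs with hm
    · subst hm; simp
    · rw [Finset.mul_sum, map_sum]
      refine Finset.sum_congr rfl fun j _ => ?_
      rw [trPow_succ', ← trPow_pow_mul, ← mul_assoc, ← pow_add]
      congr 4
      have := Nat.one_le_two_pow (n := j)
      rw [pow_succ 2 (j + 1), pow_succ 2 j]
      omega

/-- A functional killed by `f` vanishes on all chain values if and only if `f ξ_j` is zero for
`j < m` and `f ξ_m` vanishes on the set in which the chains end. -/
theorem forall_chainValue_iff (f δ : MvPowerSeries σ k) (m : ℕ)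
    (S : MvPowerSeries σ k → Prop) (hS : S 0) (l : Functional (MvPowerSeries σ k) k)
    (hl : f • l = 0) :
    (∀ c, IsChainValue f δ m S c → l c = 0) ↔
      (∀ j < m, f • xi δ l j = 0) ∧ ∀ c, S c → (f • xi δ l m) c = 0 := by
  have hfl : ∀ a, l (f * a) = 0 := (Functional.eq_zero_iff _).mp hl
  constructor
  · intro H
    -- the chain which ends with `f a` in place `i` and continues with zeros
    have key : ∀ i ≤ m, (∀ j < i, f • xi δ l j = 0) → ∀ a, (i = m → S a) →
        (f • xi δ l i) a = 0 := by
      intro i hi hlt a ha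
      let h : ℕ → MvPowerSeries σ k := fun j =>
        if j ≤ i then (fun b => tr (δ * b))^[i - j] (f * a) else 0
      have hstep : ∀ j < i, h j = tr (δ * h (j + 1)) := fun j hj => by
        simp only [h, if_pos hj.le, if_pos (show j + 1 ≤ i from hj)]
        rw [show i - j = i - (j + 1) + 1 by omega, Function.iterate_succ_apply']
      have hi' : h i = f * a := by simp [h]
      have hgt : ∀ j, i < j → h j = 0 := fun j hj => by simp only [h, if_neg (not_le.mpr hj)]
      have hxi : ∀ j ≤ i, l (tr (h 0)) = xi δ l j (h j) := by
        intro j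
        induction j with
        | zero => intro _; rfl
        | succ j ih => intro hj; rw [ih (by omega), hstep j hj, xi_succ_apply]
      obtain ⟨t, ht⟩ := exists_sum_eq f m h
      have h1 := H _ ⟨h, fun j hj => ?_, ⟨if i = m then a else 0, ?_, ?_⟩,
        by rw [sub_self]; exact dvd_zero f⟩
      · rw [ht, map_add, hxi i le_rfl, hi'] at h1
        rw [Functional.smul_apply, ← h1, left_eq_add]
        split_ifs with hm
        · rw [map_zero]
        · rcases Nat.eq_zero_or_pos i with rfl | hi0
          · rw [Finset.sum_congr rfl (g := fun j => if j = 0 then tr (f * a) else 0)] at ht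
            · rw [Finset.sum_ite_eq', if_pos (Finset.mem_range.mpr (Nat.succ_pos m)), hi',
                if_neg hm, left_eq_add] at ht
              rw [ht, map_zero]
            · intro j _
              rcases j with _ | j
              · simp [hi', trPow_succ, trPow_zero]
              · simp [hgt (j + 1) (Nat.succ_pos j)]
          · exact (Functional.eq_zero_iff _).mp (hlt 0 hi0) t
      · rcases lt_trichotomy j i with hji | rfl | hji
        · rw [hstep j hji, sub_self]; exact dvd_zero f
        · rw [hi', hgt (j + 1) (Nat.lt_succ_self j), mul_zero, map_zero, sub_zero]
          exact dvd_mul_right f a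
        · rw [hgt j hji, hgt (j + 1) (by omega), mul_zero, map_zero, sub_zero]; exact dvd_zero f
      · split_ifs with him
        · exact ha him
        · exact hS
      · split_ifs with him
        · rw [← him, hi']
        · rw [hgt m (by omega), mul_zero]
    have hlt : ∀ i < m, f • xi δ l i = 0 := by
      intro i
      induction i using Nat.strong_induction_on with
      | _ i ih =>
        intro hi
        exact Functional.ext fun a =>
          key i hi.le (fun j hj => ih j hj (by omega)) a (fun h => absurd h hi.ne)
    exact ⟨hlt, fun c hc => key m le_rfl hlt c fun _ => hc⟩
  · rintro ⟨hlt, htop⟩ c ⟨h, h1, ⟨c', hc', hm⟩, d, hd⟩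
    obtain ⟨t, ht⟩ := exists_sum_eq f m h
    have hc : l c = l (tr (h 0)) := by
      rw [ht] at hd
      have : c = tr (h 0) + (if m = 0 then 0 else tr (f * t)) - f * d := by rw [← hd]; ring
      rw [this, map_sub, hfl, sub_zero, map_add]
      split_ifs with hm0
      · rw [map_zero, add_zero]
      · have := (Functional.eq_zero_iff _).mp (hlt 0 (Nat.pos_of_ne_zero hm0)) t
        rw [Functional.smul_apply, xi, fr_apply] at this
        rw [this, add_zero]
    have hxi : ∀ j ≤ m, l c = xi δ l j (h j) := by
      intro j
      induction j with
      | zero => intro _; exact hc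
      | succ j ih =>
        intro hj
        obtain ⟨d, hd⟩ := h1 j hj
        rw [ih (by omega), xi_succ_apply, show h j = tr (δ * h (j + 1)) + f * d by rw [← hd]; ring,
          map_add, ← Functional.smul_apply, hlt j hj, Functional.zero_apply, add_zero]
    rw [hxi m le_rfl, hm, ← Functional.smul_apply, htop c' hc']

end Functionals

/-! ### Homomorphisms out of the iterated pushouts -/

section PushoutStructure

variable (p : ℕ) [Fact p.Prime] (R : Type u) [CommRing R]

/-- The module `Q_{R,(n₀,…,n_{r+1})}`, defined by a pushout along `Ψ_{R,(n₁,…,n_{r+1})}`, is also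
the pushout of `Q_{R,(n₀)}` along the composite `Φ_{R,(n₁,…,n_{r+1})}`; this follows by pasting the
squares of all lower levels. -/
theorem level_isPushout (r : ℕ) (n : ℕ → ℕ) :
    ∃ ι : Q p R (n 0) ⟶ (level p R (r + 1)).upper n,
      (level p R (r + 1)).phi n = phi p R (n 0) ≫ ι ∧
      IsPushout ((frobPush p R (n 0)).map ((level p R r).phi (tail n))) (ver p R (n 0))
        ((level p R (r + 1)).ver n) ι := by
  induction r with
  | zero => exact ⟨_, rfl, IsPushout.of_hasPushout _ _⟩
  | succ r ih =>
    obtain ⟨ι, h1, h2⟩ := ih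
    let ψ : (level p R (r + 1)).upper n ⟶ (level p R (r + 2)).upper n := (level p R (r + 2)).psi n
    refine ⟨ι ≫ ψ, ?_, ?_⟩
    · exact (congrArg (· ≫ ψ) h1).trans (Category.assoc _ _ _)
    · have h3 : IsPushout ((frobPush p R (n 0)).map ((level p R (r + 1)).psi (tail n)))
          ((level p R (r + 1)).ver n) ((level p R (r + 2)).ver n) ψ :=
        IsPushout.of_hasPushout _ _
      have h4 := h2.paste_horiz h3
      have h5 : (frobPush p R (n 0)).map ((level p R r).phi (tail n)) ≫
          (frobPush p R (n 0)).map ((level p R (r + 1)).psi (tail n)) =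
          (frobPush p R (n 0)).map ((level p R (r + 1)).phi (tail n)) :=
        ((frobPush p R (n 0)).map_comp _ _).symm
      exact (congrArg (fun g => IsPushout g (ver p R (n 0)) ((level p R (r + 2)).ver n) (ι ≫ ψ))
        h5).mp h4

variable {p R}

/-- An additive map `ψ : M → R̄` with `ψ (a ^ (p ^ e) • m) = a * ψ m`, that is, a homomorphism of
`R̄`-modules `F^e_* M → R̄`. -/
def IsFrobLinear {M : Type u} [AddCommGroup M] [Module (ModP p R) M] (e : ℕ)
    (ψ : M →+ ModP p R) : Prop :=
  ∀ (a : ModP p R) (m : M), ψ (a ^ p ^ e • m) = a * ψ m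

/-- The homomorphism `F^e_* M → R̄` given by a Frobenius-linear map. -/
def IsFrobLinear.hom {M : ModuleCat.{u} (ModP p R)} {e : ℕ} {ψ : M →+ ModP p R}
    (h : IsFrobLinear e ψ) : (frobPush p R e).obj M ⟶ unitMod p R :=
  ModuleCat.ofHom (X := (frobPush p R e).obj M) (Y := unitMod p R)
    { toFun := fun m => ψ m
      map_add' := fun m m' => map_add ψ m m'
      map_smul' := fun a m => by
        have := h a m
        rw [← frob_pow_apply] at this
        exact this }

/-- The Frobenius-linear map underlying a homomorphism `F^e_* M → R̄`. -/
def frobHomFun {M : ModuleCat.{u} (ModP p R)} {e : ℕ}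
    (g : (frobPush p R e).obj M ⟶ unitMod p R) : M →+ ModP p R where
  toFun m := g.hom (show (frobPush p R e).obj M from m)
  map_zero' := map_zero g.hom
  map_add' m m' := map_add g.hom m m'

theorem isFrobLinear_frobHomFun {M : ModuleCat.{u} (ModP p R)} {e : ℕ}
    (g : (frobPush p R e).obj M ⟶ unitMod p R) : IsFrobLinear e (frobHomFun g) := by
  intro a m
  have := map_smul g.hom a (show (frobPush p R e).obj M from m)
  rw [← frob_pow_apply]
  exact this

/-- Frobenius-linear maps on `Q_{R,(n₀,…,n_{r+1})}` are obtained by gluing. -/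
theorem exists_glue (r : ℕ) (n : ℕ → ℕ) (e : ℕ)
    (α : (level p R r).upper (tail n) →+ ModP p R) (hα : IsFrobLinear (e + n 0) α)
    (β : Q p R (n 0) →+ ModP p R) (hβ : IsFrobLinear e β)
    (h : ∀ a : ModP p R, α (((level p R r).phi (tail n)).hom a) = β (verAdd p R (n 0) a)) :
    ∃ γ : (level p R (r + 1)).upper n →+ ModP p R, IsFrobLinear e γ ∧
      ∀ a : ModP p R, γ (((level p R (r + 1)).phi n).hom a) = β (phiRing p R (n 0) a) := by
  obtain ⟨ι, h1, h2⟩ := level_isPushout p R r n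
  have h3 := h2.map (frobPush p R e)
  have hα' : IsFrobLinear (M := (frobPush p R (n 0)).obj ((level p R r).upper (tail n))) e
      (show (frobPush p R (n 0)).obj ((level p R r).upper (tail n)) →+ ModP p R from α) := by
    intro a m
    have := hα a m
    rw [pow_add, pow_mul, ← frob_pow_apply] at this
    exact this
  have hw : (frobPush p R e).map ((frobPush p R (n 0)).map ((level p R r).phi (tail n))) ≫
      hα'.hom = (frobPush p R e).map (ver p R (n 0)) ≫ hβ.hom := by
    ext a
    exact h a
  refine ⟨frobHomFun (h3.desc hα'.hom hβ.hom hw), isFrobLinear_frobHomFun _, fun a => ?_⟩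
  have h4 := h3.inr_desc hα'.hom hβ.hom hw
  have h5 := congrArg (fun g => g.hom (phiRing p R (n 0) a)) h4
  rw [h1]
  exact h5

/-- Conversely, a Frobenius-linear map on `Q_{R,(n₀,…,n_{r+1})}` restricts to compatible maps on the
two pieces of the pushout. -/
theorem exists_restrict (r : ℕ) (n : ℕ → ℕ) (e : ℕ)
    (γ : (level p R (r + 1)).upper n →+ ModP p R) (hγ : IsFrobLinear e γ) :
    ∃ (α : (level p R r).upper (tail n) →+ ModP p R) (β : Q p R (n 0) →+ ModP p R),
      IsFrobLinear (e + n 0) α ∧ IsFrobLinear e β ∧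
      (∀ a : ModP p R, α (((level p R r).phi (tail n)).hom a) = β (verAdd p R (n 0) a)) ∧
      ∀ a : ModP p R, γ (((level p R (r + 1)).phi n).hom a) = β (phiRing p R (n 0) a) := by
  obtain ⟨ι, h1, h2⟩ := level_isPushout p R r n
  let v := (level p R (r + 1)).ver n
  refine ⟨γ.comp
    { toFun := fun m => v.hom (show (frobPush p R (n 0)).obj ((level p R r).upper (tail n)) from m)
      map_zero' := map_zero v.hom
      map_add' := fun a b => map_add v.hom a b }, γ.comp ι.hom.toAddMonoidHom, ?_, ?_, ?_, ?_⟩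
  · intro a m
    have h3 := map_smul v.hom (a ^ p ^ e)
      (show (frobPush p R (n 0)).obj ((level p R r).upper (tail n)) from m)
    have h4 := hγ a (v.hom (show (frobPush p R (n 0)).obj ((level p R r).upper (tail n)) from m))
    rw [pow_add, pow_mul, ← frob_pow_apply _ _ (n 0)]
    exact (congrArg γ h3).trans h4
  · intro a m
    have h3 := map_smul ι.hom (a ^ p ^ e) m
    have h4 := hγ a (ι.hom m)
    exact (congrArg γ h3).trans h4
  · intro a
    exact congrArg (fun g => γ (g.hom a)) h2.w
  · intro a
    rw [h1]
    rfl

/-- `Φ_{R,(n₀,…,n_r)}` splits if and only if some homomorphism to `R̄` maps the image of `1` to a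
unit. -/
theorem isSplitMono_iff (r : ℕ) (n : ℕ → ℕ) :
    IsSplitMono (multiPhi p R r n) ↔ ∃ ψ : (level p R r).upper n →+ ModP p R,
      IsFrobLinear 0 ψ ∧ IsUnit (ψ (((level p R r).phi n).hom (1 : ModP p R))) := by
  constructor
  · rintro ⟨⟨s⟩⟩
    refine ⟨s.retraction.hom.toAddMonoidHom, ?_, ?_⟩
    · intro a m
      rw [pow_zero, pow_one]
      exact map_smul s.retraction.hom a m
    · have : s.retraction.hom (((level p R r).phi n).hom (1 : ModP p R)) = 1 :=
        congrArg (fun g => g.hom (1 : ModP p R)) s.id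
      have h : IsUnit (1 : ModP p R) := isUnit_one
      rw [← this] at h
      exact h
  · rintro ⟨ψ, hψ, c, hc⟩
    refine ⟨⟨⟨ModuleCat.ofHom (Y := unitMod p R)
      { toFun := fun m => (↑c⁻¹ : ModP p R) * ψ m
        map_add' := fun m m' => by rw [map_add, mul_add]
        map_smul' := fun a m => by
          have := hψ a m
          rw [pow_zero, pow_one] at this
          rw [this]
          exact mul_left_comm _ _ _ }, ?_⟩⟩⟩
    refine ModuleCat.hom_ext (LinearMap.ext_ring ?_)
    have h : (↑c⁻¹ : ModP p R) * ψ (((level p R r).phi n).hom (1 : ModP p R)) = 1 := by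
      rw [← hc, Units.inv_mul]
    exact h

end PushoutStructure

/-! ### Frobenius-linear maps on `Q_{R,(n)}` for a hypersurface -/

section Hypersurface

open MvPowerSeries WittVector

variable {A : Type u} [CommRing A]

section Quot

variable {P : Type*} [CommRing P] (L : FrobeniusLift A P) (f : A)

/-- The surjection `P → R / 2` with kernel `(f)`, where `R = A / (f)`. -/
def quot : P →+* ModP 2 (A ⧸ Ideal.span {f}) :=
  L.red.liftOfSurjective L.red_surjective
    ⟨(Ideal.Quotient.mk (Ideal.span {((2 : ℕ) : A ⧸ Ideal.span {f})})).comp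
      (Ideal.Quotient.mk (Ideal.span {f})), by
      intro a ha
      obtain ⟨c, rfl⟩ := L.red_eq_zero a ha
      rw [RingHom.mem_ker, RingHom.comp_apply, Ideal.Quotient.eq_zero_iff_mem]
      refine Ideal.mem_span_singleton'.mpr ⟨Ideal.Quotient.mk _ c, ?_⟩
      rw [map_mul, map_ofNat, mul_comm]
      norm_num⟩

theorem quot_red (a : A) : quot L f (L.red a) =
    Ideal.Quotient.mk (Ideal.span {((2 : ℕ) : A ⧸ Ideal.span {f})})
      (Ideal.Quotient.mk (Ideal.span {f}) a) :=
  RingHom.liftOfRightInverse_comp_apply _ _ _ _ _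

theorem quot_surjective : Function.Surjective (quot L f) := by
  intro y
  obtain ⟨y, rfl⟩ := Ideal.Quotient.mk_surjective y
  obtain ⟨a, rfl⟩ := Ideal.Quotient.mk_surjective y
  exact ⟨L.red a, quot_red L f a⟩

variable [CharP P 2]

theorem quot_eq_zero_iff (w : P) : quot L f w = 0 ↔ L.red f ∣ w := by
  obtain ⟨a, rfl⟩ := L.red_surjective w
  rw [quot_red, Ideal.Quotient.eq_zero_iff_mem]
  constructor
  · intro h
    obtain ⟨c, hc⟩ := Ideal.mem_span_singleton'.mp h
    obtain ⟨c, rfl⟩ := Ideal.Quotient.mk_surjective c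
    have h1 : Ideal.Quotient.mk (Ideal.span {f}) (a - 2 * c) = 0 := by
      rw [map_sub, map_mul, map_ofNat, ← hc]
      push_cast
      ring
    obtain ⟨d, hd⟩ := Ideal.mem_span_singleton'.mp (Ideal.Quotient.eq_zero_iff_mem.mp h1)
    refine ⟨L.red d, ?_⟩
    have h2 := congrArg L.red hd
    rw [map_sub, L.red_two_mul, sub_zero, map_mul] at h2
    rw [← h2, mul_comm]
  · rintro ⟨d, hd⟩
    obtain ⟨d, rfl⟩ := L.red_surjective d
    rw [← map_mul, ← sub_eq_zero, ← map_sub] at hd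
    obtain ⟨c, hc⟩ := L.red_eq_zero _ hd
    refine Ideal.mem_span_singleton'.mpr ⟨Ideal.Quotient.mk _ c, ?_⟩
    have h1 : Ideal.Quotient.mk (Ideal.span {f}) (f * d) = 0 :=
      Ideal.Quotient.eq_zero_iff_mem.mpr (Ideal.mem_span_singleton'.mpr ⟨d, mul_comm _ _⟩)
    rw [show a = f * d + 2 * c by rw [← hc]; ring, map_add, h1, zero_add, map_mul, map_ofNat]
    push_cast
    ring

theorem toModP_map (x : WittVector 2 A) :
    toModP 2 (A ⧸ Ideal.span {f}) (WittVector.map (Ideal.Quotient.mk (Ideal.span {f})) x) =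
      quot L f (L.coord 0 x) := by
  rw [L.coord_zero, quot_red]
  rfl

theorem map_frobenius {S T : Type*} [CommRing S] [CommRing T] (g : S →+* T) (x : WittVector 2 S) :
    WittVector.map g (WittVector.frobenius x) = WittVector.frobenius (WittVector.map g x) := by
  ext i
  rw [map_coeff, coeff_frobenius, coeff_frobenius, MvPolynomial.aeval_def, MvPolynomial.aeval_def,
    MvPolynomial.hom_eval₂]
  congr 1
  · exact RingHom.ext_int _ _

/-- The projection `W(A) → W_n(R) / 2`. -/
def proj (n : ℕ) : WittVector 2 A →+* WBar 2 (A ⧸ Ideal.span {f}) n :=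
  (toWBar 2 _ n).comp (WittVector.map (Ideal.Quotient.mk (Ideal.span {f})))

theorem proj_surjective (n : ℕ) : Function.Surjective (proj f n) :=
  (Ideal.Quotient.mk_surjective.comp (truncate_surjective 2 n _)).comp
    (WittVector.map_surjective _ Ideal.Quotient.mk_surjective)

theorem phiRing_quot (n : ℕ) (x : WittVector 2 A) :
    phiRing 2 (A ⧸ Ideal.span {f}) n (quot L f (L.coord 0 x)) = proj f n (frobenius x) := by
  rw [← toModP_map, phiRing_toModP, ← map_frobenius]
  rfl

theorem map_iterate_verschiebung {S T : Type*} [CommRing S] [CommRing T] (g : S →+* T) (n : ℕ)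
    (x : WittVector 2 S) :
    WittVector.map g (verschiebung^[n] x) = verschiebung^[n] (WittVector.map g x) := by
  induction n with
  | zero => rfl
  | succ n ih =>
    rw [Function.iterate_succ_apply', map_verschiebung, ih, Function.iterate_succ_apply']

theorem verAdd_quot (n : ℕ) (x : WittVector 2 A) :
    verAdd 2 (A ⧸ Ideal.span {f}) n (quot L f (L.coord 0 x)) =
      proj f n (verschiebung^[n - 1] x) := by
  rw [← toModP_map, verAdd_toModP, ← map_iterate_verschiebung]
  rfl

theorem proj_eq_zero_of_truncate {n : ℕ} {x : WittVector 2 A}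
    (hx : truncate n (WittVector.map (Ideal.Quotient.mk (Ideal.span {f})) x) = 0) :
    proj f n x = 0 := by
  rw [proj, RingHom.comp_apply, toWBar, RingHom.comp_apply, hx, map_zero]

theorem proj_two_mul (n : ℕ) (x : WittVector 2 A) : proj f n (2 * x) = 0 := by
  have h1 : proj f n ((2 : ℕ) : WittVector 2 A) = 0 := by
    rw [proj, RingHom.comp_apply, map_natCast, toWBar_p]
  have h2 : (2 : WittVector 2 A) = ((2 : ℕ) : WittVector 2 A) := by norm_num
  rw [h2, map_mul, h1, zero_mul]

theorem proj_iterate_verschiebung (n : ℕ) (x : WittVector 2 A) :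
    proj f n (verschiebung^[n] x) = 0 := by
  apply proj_eq_zero_of_truncate
  rw [map_iterate_verschiebung, ← RingHom.mem_ker, mem_ker_truncate]
  intro i hi
  exact iterate_verschiebung_coeff_eq_zero _ hi

theorem proj_iterate_verschiebung_teichmuller (n i : ℕ) (d : A) :
    proj f n (verschiebung^[i] (teichmuller 2 (f * d))) = 0 := by
  apply proj_eq_zero_of_truncate
  rw [map_iterate_verschiebung, map_teichmuller, map_mul,
    Ideal.Quotient.eq_zero_iff_mem.mpr (Ideal.mem_span_singleton_self f), zero_mul,
    teichmuller_zero, iterate_map_zero, map_zero]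

end Quot

variable {k : Type*} [Field k] [CharP k 2] [PerfectRing k 2] {σ : Type*} [Fintype σ]
  [DecidableEq σ]

/-- The relation between consecutive `g_j` which makes the map on `W(A)` with the coordinates `g_j`
descend to `W_n(R) / 2`. -/
theorem trPow_relation_iff (F δ : MvPowerSeries σ k) (m : ℕ) (g g' : MvPowerSeries σ k) :
    (∀ d, F ∣ trPow m (g * (F * d)) + trPow (m + 1) (g' * (δ * d ^ 2))) ↔
      F ^ 2 ^ m ∣ F * g + tr (g' * δ) := by
  have h : ∀ d, trPow m (g * (F * d)) + trPow (m + 1) (g' * (δ * d ^ 2)) =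
      trPow m ((F * g + tr (g' * δ)) * d) := fun d => by
    rw [trPow_succ, show g' * (δ * d ^ 2) = d ^ 2 * (g' * δ) by ring, tr_sq_mul, ← map_add]
    congr 1
    ring
  simp_rw [h]
  refine ⟨pow_dvd_of_forall_dvd_trPow m F _, ?_⟩
  rintro ⟨c, hc⟩ d
  rw [hc, mul_assoc, trPow_pow_mul]
  exact dvd_mul_right _ _

variable (L : FrobeniusLift A (MvPowerSeries σ k)) (f : A)

/-- Every Frobenius-linear map on `Q_{R,(n)}` is given by power series `g_0, …, g_{n-1}`. -/
theorem exists_of_isFrobLinear (n e : ℕ)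
    (β : WBar 2 (A ⧸ Ideal.span {f}) n →+ ModP 2 (A ⧸ Ideal.span {f}))
    (hβ : ∀ a x, β (phiRing 2 _ n (a ^ 2 ^ e) * x) = a * β x) :
    ∃ g : ℕ → MvPowerSeries σ k, (∀ j, n ≤ j → g j = 0) ∧
      (∀ j, L.red f ^ 2 ^ (e + j + 1) ∣ L.red f * g j + tr (g (j + 1) * L.delta f)) ∧
      ∀ x, β (proj f n x) =
        ∑ j ∈ Finset.range n, quot L f (trPow (e + j + 1) (g j * L.coord j x)) := by
  let B : WittVector 2 A →+ ModP 2 (A ⧸ Ideal.span {f}) := β.comp (proj f n).toAddMonoidHom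
  have hB : ∀ x, B x = β (proj f n x) := fun _ => rfl
  obtain ⟨χ, hχ0, hχs, hχ⟩ := L.exists_coord_expansion (quot L f) e n B
    (fun x => by rw [hB, proj_two_mul, map_zero])
    (fun x => by rw [hB, proj_iterate_verschiebung, map_zero])
    (fun b x => by
      have h1 := phiRing_quot L f n (teichmuller 2 (b ^ 2 ^ e))
      rw [L.coord_zero_teichmuller, map_pow, map_pow] at h1
      rw [hB, map_mul, ← h1, hβ, hB])
  have hv := (L.vanish_iff n χ hχ0 f).mp (fun i hi d => by
    rw [← hχ, hB, proj_iterate_verschiebung_teichmuller, map_zero])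
  have hg : ∀ j, ∃ g, (n ≤ j → g = 0) ∧ ∀ a, χ j a = quot L f (trPow (e + j + 1) (g * a)) := by
    intro j
    by_cases hj : n ≤ j
    · refine ⟨0, fun _ => rfl, fun a => ?_⟩
      rw [hχ0 j hj, zero_mul, map_zero, map_zero, AddMonoidHom.zero_apply]
    · obtain ⟨g, hg⟩ := exists_eq_trPow_mul (quot L f) (quot_surjective L f) _ (χ j) (hχs j)
      exact ⟨g, fun h => absurd h hj, hg⟩
  choose g hg0 hg using hg
  refine ⟨g, hg0, fun j => ?_, fun x => ?_⟩
  · rw [← trPow_relation_iff]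
    intro d
    have h := hv j d
    rw [hg, hg, ← map_add] at h
    exact (quot_eq_zero_iff L f _).mp h
  · rw [← hB, hχ]
    exact Finset.sum_congr rfl fun j _ => hg j _

/-- Conversely, power series which satisfy the relations define a Frobenius-linear map. -/
theorem exists_isFrobLinear (n e : ℕ) (g : ℕ → MvPowerSeries σ k) (hg0 : ∀ j, n ≤ j → g j = 0)
    (hg : ∀ j, L.red f ^ 2 ^ (e + j + 1) ∣ L.red f * g j + tr (g (j + 1) * L.delta f)) :
    ∃ β : WBar 2 (A ⧸ Ideal.span {f}) n →+ ModP 2 (A ⧸ Ideal.span {f}),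
      (∀ a x, β (phiRing 2 _ n (a ^ 2 ^ e) * x) = a * β x) ∧
      ∀ x, β (proj f n x) =
        ∑ j ∈ Finset.range n, quot L f (trPow (e + j + 1) (g j * L.coord j x)) := by
  let χ : ℕ → MvPowerSeries σ k →+ ModP 2 (A ⧸ Ideal.span {f}) := fun j =>
    (quot L f).toAddMonoidHom.comp ((trPow (e + j + 1)).comp (AddMonoidHom.mulLeft (g j)))
  have hχ : ∀ j a, χ j a = quot L f (trPow (e + j + 1) (g j * a)) := fun _ _ => rfl
  let B : WittVector 2 A →+ ModP 2 (A ⧸ Ideal.span {f}) :=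
    ∑ j ∈ Finset.range n, (χ j).comp (L.coord j)
  have hB : ∀ x, B x = ∑ j ∈ Finset.range n, χ j (L.coord j x) := fun x => by simp [B]
  have hker : ∀ x, proj f n x = 0 → B x = 0 := by
    refine eq_zero_of_toWBar_eq_zero (Ideal.Quotient.mk (Ideal.span {f}))
      Ideal.Quotient.mk_surjective f (fun a ha => ?_) n B (fun x => ?_) (fun x => ?_) ?_
    · exact Ideal.mem_span_singleton.mp (Ideal.Quotient.eq_zero_iff_mem.mp ha)
    · rw [hB]
      exact Finset.sum_eq_zero fun j _ => by rw [L.coord_two_mul, map_zero]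
    · rw [hB]
      exact Finset.sum_eq_zero fun j hj => by
        rw [L.coord_iterate_verschiebung_of_lt (Finset.mem_range.mp hj), map_zero]
    · intro i hi d
      rw [hB]
      refine (L.vanish_iff n χ (fun j hj => ?_) f).mpr (fun j d => ?_) i hi d
      · ext a
        rw [hχ, hg0 j hj, zero_mul, map_zero, map_zero, AddMonoidHom.zero_apply]
      · rw [hχ, hχ, ← map_add, quot_eq_zero_iff]
        exact (trPow_relation_iff (L.red f) (L.delta f) (e + j + 1) (g j) (g (j + 1))).mpr (hg j) d
  let β : WBar 2 (A ⧸ Ideal.span {f}) n →+ ModP 2 (A ⧸ Ideal.span {f}) :=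
    (proj f n).toAddMonoidHom.liftOfSurjective (proj_surjective f n) ⟨B, hker⟩
  have hβ : ∀ x, β (proj f n x) = B x := fun x =>
    AddMonoidHom.liftOfRightInverse_comp_apply _ _ _ _ x
  refine ⟨β, ?_, fun x => (hβ x).trans (hB x)⟩
  intro a m
  obtain ⟨a, rfl⟩ := quot_surjective L f a
  obtain ⟨a, rfl⟩ := L.red_surjective a
  obtain ⟨x, rfl⟩ := proj_surjective f n m
  have h1 := phiRing_quot L f n (teichmuller 2 (a ^ 2 ^ e))
  rw [L.coord_zero_teichmuller, map_pow, map_pow] at h1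
  rw [h1, ← map_mul, hβ, hβ, hB, hB, Finset.mul_sum]
  refine Finset.sum_congr rfl fun j _ => ?_
  rw [L.coord_mul, map_pow, hχ, hχ, ← map_mul, ← trPow_pow_mul, ← pow_mul, ← pow_add, add_assoc]
  congr 2
  ring

end Hypersurface

/-! ### A criterion of Fedder type for splitting -/

section Fedder

open MvPowerSeries
open WittVector (frobenius teichmuller verschiebung)

variable {k : Type*} [Field k] [CharP k 2] [PerfectRing k 2] {σ : Type*} [Fintype σ]

/-- The functional `ℓ` has height `m`: among the functionals `F ξ_0, F ξ_1, …`, the `m`-th one is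
the first which does not vanish. -/
def IsHeight (F δ : MvPowerSeries σ k) (l : Functional (MvPowerSeries σ k) k) (m : ℕ) : Prop :=
  1 ≤ m ∧ (∀ j < m - 1, F • xi δ l j = 0) ∧ F • xi δ l (m - 1) ≠ 0

theorem IsHeight.unique {F δ : MvPowerSeries σ k} {l : Functional (MvPowerSeries σ k) k} {m m' : ℕ}
    (h : IsHeight F δ l m) (h' : IsHeight F δ l m') : m = m' := by
  obtain ⟨h1, h2, h3⟩ := h
  obtain ⟨h1', h2', h3'⟩ := h'
  by_contra hne
  rcases Nat.lt_or_gt_of_ne hne with hlt | hlt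
  · exact h3 (h2' _ (by omega))
  · exact h3' (h2 _ (by omega))

theorem isLeast_iff_isHeight (F δ : MvPowerSeries σ k) (l : Functional (MvPowerSeries σ k) k)
    (m : ℕ) : IsLeast {m | 1 ≤ m ∧ ¬ ∀ j < m, F • xi δ l j = 0} m ↔ IsHeight F δ l m := by
  constructor
  · rintro ⟨⟨h1, h2⟩, h3⟩
    have h4 : ∀ j < m - 1, F • xi δ l j = 0 := by
      intro j hj
      by_contra h
      have := h3 (show j + 1 ∈ _ from ⟨by omega, fun h' => h (h' j (by omega))⟩)
      omega
    refine ⟨h1, h4, fun h => h2 fun j hj => ?_⟩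
    rcases Nat.lt_or_ge j (m - 1) with hj' | hj'
    · exact h4 j hj'
    · rwa [show j = m - 1 by omega]
  · rintro ⟨h1, h2, h3⟩
    refine ⟨⟨h1, fun h => h3 (h _ (by omega))⟩, ?_⟩
    rintro m' ⟨h4, h5⟩
    by_contra h
    exact h5 fun j hj => h2 j (by omega)

/-- The functionals `ℓ_0 = ℓ` and `ℓ_{i+1} = F ξ_{h_i - 1}(ℓ_i)`. -/
def orbit (F δ : MvPowerSeries σ k) (h : ℕ → ℕ) (l : Functional (MvPowerSeries σ k) k) :
    ℕ → Functional (MvPowerSeries σ k) k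
  | 0 => l
  | i + 1 => F • xi δ (orbit F δ h l i) (h i - 1)

theorem orbit_tail (F δ : MvPowerSeries σ k) (h : ℕ → ℕ) (l : Functional (MvPowerSeries σ k) k)
    (i : ℕ) : orbit F δ (tail h) (F • xi δ l (h 0 - 1)) i = orbit F δ h l (i + 1) := by
  induction i with
  | zero => rfl
  | succ i ih => rw [orbit, ih]; rfl

/-- The constant coefficient as a functional. -/
def constFunctional {k σ : Type*} [Field k] : Functional (MvPowerSeries σ k) k :=
  (MvPowerSeries.constantCoeff (σ := σ) (R := k)).toAddMonoidHom

theorem constFunctional_apply {k σ : Type*} [Field k] (a : MvPowerSeries σ k) :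
    constFunctional a = MvPowerSeries.constantCoeff a := rfl

/-- The functionals `F ξ_j` which arise from `ℓ` along the heights `n_0, …, n_r` vanish. For `ℓ`
killed by `F`, this means that `ℓ` vanishes on all admissible elements, see `forall_adm_iff`. -/
def IsKilled (F δ : MvPowerSeries σ k) :
    ℕ → (ℕ → ℕ) → Functional (MvPowerSeries σ k) k → Prop
  | 0, n, l => ∀ j < n 0, F • xi δ l j = 0
  | r + 1, n, l => (∀ j < n 0 - 1, F • xi δ l j = 0) ∧
      IsKilled F δ r (tail n) (F • xi δ l (n 0 - 1))

theorem isKilled_update_iff (F δ : MvPowerSeries σ k) (r : ℕ) (h : ℕ → ℕ) (m : ℕ)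
    (l : Functional (MvPowerSeries σ k) k)
    (hh : ∀ i < r, IsHeight F δ (orbit F δ h l i) (h i)) :
    IsKilled F δ r (Function.update h r m) l ↔ ∀ j < m, F • xi δ (orbit F δ h l r) j = 0 := by
  induction r generalizing h l with
  | zero => rw [IsKilled, Function.update_self, orbit]
  | succ r ih =>
    have h1 : tail (Function.update h (r + 1) m) = Function.update (tail h) r m := by
      funext i
      simp only [tail, Function.update_apply, Nat.add_right_cancel_iff]
    rw [IsKilled, h1, Function.update_of_ne (by omega), ih, orbit_tail]
    · exact and_iff_right (hh 0 (by omega)).2.1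
    · intro i hi
      rw [orbit_tail]
      exact hh (i + 1) (by omega)

theorem smul_constFunctional {k σ : Type*} [Field k] {a : MvPowerSeries σ k}
    (ha : MvPowerSeries.constantCoeff a = 0) :
    a • (constFunctional : Functional (MvPowerSeries σ k) k) = 0 :=
  Functional.ext fun b => by
    rw [Functional.smul_apply, constFunctional_apply, map_mul, ha, zero_mul, Functional.zero_apply]

variable {A : Type u} [CommRing A] (L : FrobeniusLift A (MvPowerSeries σ k)) (f : A)

/-- `c` is admissible if the map `a ↦ trPow e (F ^ (2 ^ e - 1) * c * a)` on `R̄ = P / F` extends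
along `Φ_{R,(n₀,…,n_r)}` to a Frobenius-linear map on `Q_{R,(n₀,…,n_r)}`. -/
def Adm (r : ℕ) (n : ℕ → ℕ) (e : ℕ) (c : MvPowerSeries σ k) : Prop :=
  ∃ ψ : (level 2 (A ⧸ Ideal.span {f}) r).upper n →+ ModP 2 (A ⧸ Ideal.span {f}),
    IsFrobLinear e ψ ∧ ∀ a, ψ (((level 2 (A ⧸ Ideal.span {f}) r).phi n).hom (quot L f a)) =
      quot L f (trPow e (L.red f ^ (2 ^ e - 1) * c * a))

theorem adm_zero_of_zero (r : ℕ) (n : ℕ → ℕ) (e : ℕ) : Adm L f r n e 0 :=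
  ⟨0, fun a m => (mul_zero a).symm, fun a => by rw [mul_zero, zero_mul, map_zero, map_zero]; rfl⟩

variable [DecidableEq σ]

/-- The Frobenius-linear endomorphisms of `R̄ = P / F` are the maps
`a ↦ trPow e (F ^ (2 ^ e - 1) * c * a)`. -/
theorem exists_trPow_of_isFrobLinear (hf : L.red f ≠ 0) (e : ℕ)
    (θ : ModP 2 (A ⧸ Ideal.span {f}) →+ ModP 2 (A ⧸ Ideal.span {f}))
    (hθ : ∀ a b, θ (a ^ 2 ^ e * b) = a * θ b) :
    ∃ c, ∀ a, θ (quot L f a) = quot L f (trPow e (L.red f ^ (2 ^ e - 1) * c * a)) := by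
  obtain ⟨g, hg⟩ := exists_eq_trPow_mul (quot L f) (quot_surjective L f) e
    (θ.comp (quot L f).toAddMonoidHom) (fun b a => by
      have h := hθ (quot L f b) (quot L f a)
      rw [← map_pow, ← map_mul] at h
      exact h)
  have h1 : L.red f ^ 2 ^ e ∣ g * L.red f := by
    refine pow_dvd_of_forall_dvd_trPow e _ _ fun a => ?_
    rw [← quot_eq_zero_iff, mul_assoc, ← hg, AddMonoidHom.comp_apply]
    have h2 : quot L f (L.red f * a) = 0 := (quot_eq_zero_iff L f _).mpr (dvd_mul_right _ _)
    exact (congrArg θ h2).trans (map_zero θ)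
  obtain ⟨c, hc⟩ := h1
  have h3 : L.red f ^ 2 ^ e = L.red f ^ (2 ^ e - 1) * L.red f := by
    rw [← pow_succ, Nat.sub_add_cancel Nat.one_le_two_pow]
  rw [h3, mul_right_comm] at hc
  refine ⟨c, fun a => ?_⟩
  rw [← mul_right_cancel₀ hf hc]
  exact hg a

theorem verAdd_comp_mul {R : Type u} [CommRing R] (N e : ℕ) (β : WBar 2 R N →+ ModP 2 R)
    (hβ : ∀ a x, β (phiRing 2 _ N (a ^ 2 ^ e) * x) = a * β x) (a b : ModP 2 R) :
    β (verAdd 2 R N (a ^ 2 ^ (e + N) * b)) = a * β (verAdd 2 R N b) := by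
  rw [pow_add, pow_mul, ← frob_pow_apply, verAdd_mul, hβ]

/-- The value at `Φ` of the map with coordinates `g_j`. -/
theorem sum_trPow_frobenius (m e : ℕ) (g : ℕ → MvPowerSeries σ k) (a : A) :
    ∑ j ∈ Finset.range (m + 1), quot L f (trPow (e + j + 1)
      (g j * L.coord j (frobenius (teichmuller 2 a)))) =
    quot L f (trPow e ((∑ j ∈ Finset.range (m + 1), trPow (j + 1) (g j)) * L.red a)) := by
  rw [Finset.sum_mul, map_sum, map_sum]
  refine Finset.sum_congr rfl fun j _ => ?_
  rw [L.coord_frobenius_teichmuller, add_assoc, trPow_add, mul_comm, trPow_pow_mul, mul_comm]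

theorem quot_trPow_eq_iff (e : ℕ) (g g' : MvPowerSeries σ k) :
    (∀ a : A, quot L f (trPow e (g * L.red a)) = quot L f (trPow e (g' * L.red a))) ↔
      L.red f ^ 2 ^ e ∣ g - g' := by
  have h : ∀ a, quot L f (trPow e (g * L.red a)) = quot L f (trPow e (g' * L.red a)) ↔
      L.red f ∣ trPow e ((g - g') * L.red a) := fun a => by
    rw [← quot_eq_zero_iff, sub_mul, map_sub, map_sub, sub_eq_zero]
  simp_rw [h]
  constructor
  · intro H
    refine pow_dvd_of_forall_dvd_trPow e _ _ fun a => ?_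
    obtain ⟨a, rfl⟩ := L.red_surjective a
    exact H a
  · rintro ⟨c, hc⟩ a
    rw [hc, mul_assoc, trPow_pow_mul]
    exact dvd_mul_right _ _

/-- Frobenius-linear maps on `Q_{R,(m+1)}` with prescribed values on `Φ` and on `V^m`. -/
theorem exists_isFrobLinear_iff {N m : ℕ} (hN : N = m + 1) (e : ℕ)
    (S : MvPowerSeries σ k → Prop) (hS : ∀ c d, S c → S (c + L.red f * d))
    (c : MvPowerSeries σ k) :
    (∃ β : WBar 2 (A ⧸ Ideal.span {f}) N →+ ModP 2 (A ⧸ Ideal.span {f}),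
      (∀ a x, β (phiRing 2 _ N (a ^ 2 ^ e) * x) = a * β x) ∧
      (∀ a, β (phiRing 2 _ N (quot L f a)) =
        quot L f (trPow e (L.red f ^ (2 ^ e - 1) * c * a))) ∧
      ∃ c', S c' ∧ ∀ a, β (verAdd 2 _ N (quot L f a)) =
        quot L f (trPow (e + N) (L.red f ^ (2 ^ (e + N) - 1) * c' * a))) ↔
    IsFedderValue (L.red f) (L.delta f) e m S c := by
  subst hN
  -- the values of the map with coordinates `g_j` on `Φ` and on `V^m`
  have hΦ : ∀ (β : WBar 2 (A ⧸ Ideal.span {f}) (m + 1) →+ ModP 2 (A ⧸ Ideal.span {f}))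
      (g : ℕ → MvPowerSeries σ k), (∀ x, β (proj f (m + 1) x) =
        ∑ j ∈ Finset.range (m + 1), quot L f (trPow (e + j + 1) (g j * L.coord j x))) → ∀ a : A,
      β (phiRing 2 _ (m + 1) (quot L f (L.red a))) =
        quot L f (trPow e ((∑ j ∈ Finset.range (m + 1), trPow (j + 1) (g j)) * L.red a)) :=
    fun β g h a => by
      rw [← sum_trPow_frobenius, ← h, ← phiRing_quot L f, L.coord_zero_teichmuller]
  have hV : ∀ (β : WBar 2 (A ⧸ Ideal.span {f}) (m + 1) →+ ModP 2 (A ⧸ Ideal.span {f}))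
      (g : ℕ → MvPowerSeries σ k), (∀ x, β (proj f (m + 1) x) =
        ∑ j ∈ Finset.range (m + 1), quot L f (trPow (e + j + 1) (g j * L.coord j x))) → ∀ a : A,
      β (verAdd 2 _ (m + 1) (quot L f (L.red a))) =
        quot L f (trPow (e + (m + 1)) (g m * L.red a)) := fun β g h a => by
    rw [← L.coord_zero_teichmuller a, verAdd_quot, h, Finset.sum_range_succ, Finset.sum_eq_zero,
      zero_add, Nat.add_sub_cancel]
    · have h1 := L.coord_add_iterate_verschiebung m 0 (teichmuller 2 a)
      rw [zero_add] at h1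
      rw [h1, add_assoc]
    · intro j hj
      rw [Nat.add_sub_cancel, L.coord_iterate_verschiebung_of_lt (Finset.mem_range.mp hj), mul_zero,
        map_zero, map_zero]
  constructor
  · rintro ⟨β, hβ, h1, c', hc', h2⟩
    obtain ⟨g, hg0, hg, hβg⟩ := exists_of_isFrobLinear L f (m + 1) e β hβ
    have h3 : L.red f ^ 2 ^ (e + m + 1) ∣ g m - L.red f ^ (2 ^ (e + m + 1) - 1) * c' := by
      rw [add_assoc, ← quot_trPow_eq_iff]
      intro a
      rw [← hV β g hβg, h2]
    obtain ⟨d, hd⟩ := h3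
    refine ⟨g, fun j hj => hg0 j hj, hg, ⟨c' + L.red f * d, hS _ _ hc', ?_⟩, ?_⟩
    · rw [mul_add, ← mul_assoc, ← pow_succ, Nat.sub_add_cancel Nat.one_le_two_pow, ← hd]
      ring
    · rw [← quot_trPow_eq_iff]
      intro a
      rw [← hΦ β g hβg, h1]
  · rintro ⟨g, hg0, hg, ⟨c', hc', hgm⟩, h⟩
    obtain ⟨β, hβ, hβg⟩ := exists_isFrobLinear L f (m + 1) e g hg0 hg
    refine ⟨β, hβ, fun a => ?_, c', hc', fun a => ?_⟩
    · obtain ⟨a, rfl⟩ := L.red_surjective a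
      rw [hΦ β g hβg]
      exact (quot_trPow_eq_iff L f e _ _).mpr h a
    · obtain ⟨a, rfl⟩ := L.red_surjective a
      rw [hV β g hβg, hgm, add_assoc]

theorem Adm.add_mul {r : ℕ} {n : ℕ → ℕ} {e : ℕ} {c : MvPowerSeries σ k} (h : Adm L f r n e c)
    (d : MvPowerSeries σ k) : Adm L f r n e (c + L.red f * d) := by
  obtain ⟨ψ, hψ, h⟩ := h
  refine ⟨ψ, hψ, fun a => ?_⟩
  obtain ⟨a, rfl⟩ := L.red_surjective a
  rw [h]
  refine (quot_trPow_eq_iff L f e _ _).mpr ⟨-d, ?_⟩ a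
  have h1 : L.red f ^ 2 ^ e = L.red f ^ (2 ^ e - 1) * L.red f := by
    rw [← pow_succ, Nat.sub_add_cancel Nat.one_le_two_pow]
  rw [h1]
  ring

theorem adm_zero_iff (hf : L.red f ≠ 0) (n : ℕ → ℕ) (m e : ℕ) (hn : n 0 = m + 1)
    (c : MvPowerSeries σ k) :
    Adm L f 0 n e c ↔ IsFedderValue (L.red f) (L.delta f) e m (fun _ => True) c := by
  rw [← exists_isFrobLinear_iff L f hn e _ (fun _ _ => id)]
  constructor
  · rintro ⟨ψ, hψ, h⟩
    obtain ⟨c', hc'⟩ := exists_trPow_of_isFrobLinear L f hf (e + n 0)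
      (AddMonoidHom.comp (show WBar 2 _ (n 0) →+ _ from ψ) (verAdd 2 _ (n 0)))
      (verAdd_comp_mul (n 0) e ψ hψ)
    exact ⟨ψ, hψ, h, c', trivial, hc'⟩
  · rintro ⟨β, hβ, h, -⟩
    exact ⟨β, hβ, h⟩

theorem adm_succ_iff (hf : L.red f ≠ 0) (r : ℕ) (n : ℕ → ℕ) (m e : ℕ) (hn : n 0 = m + 1)
    (c : MvPowerSeries σ k) :
    Adm L f (r + 1) n e c ↔
      IsFedderValue (L.red f) (L.delta f) e m (Adm L f r (tail n) (e + n 0)) c := by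
  rw [← exists_isFrobLinear_iff L f hn e _ fun _ d h => h.add_mul L f d]
  constructor
  · rintro ⟨γ, hγ, h⟩
    obtain ⟨α, β, hα, hβ, h1, h2⟩ := exists_restrict r n e γ hγ
    obtain ⟨c', hc'⟩ := exists_trPow_of_isFrobLinear L f hf (e + n 0)
      (AddMonoidHom.comp (show WBar 2 _ (n 0) →+ _ from β) (verAdd 2 _ (n 0)))
      (verAdd_comp_mul (n 0) e β hβ)
    exact ⟨β, hβ, fun a => (h2 _).symm.trans (h a), c', ⟨α, hα, fun a => (h1 _).trans (hc' a)⟩, hc'⟩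
  · rintro ⟨β, hβ, h, c', ⟨α, hα, h1⟩, h2⟩
    obtain ⟨γ, hγ, h3⟩ := exists_glue r n e α hα β hβ (fun a => by
      obtain ⟨a, rfl⟩ := quot_surjective L f a
      exact (h1 a).trans (h2 a).symm)
    exact ⟨γ, hγ, fun a => (h3 _).trans (h a)⟩

theorem isSplitMono_iff_adm (hf0 : L.red f ≠ 0)
    (hf : constantCoeff (L.red f) = 0) (r : ℕ) (n : ℕ → ℕ) :
    IsSplitMono (multiPhi 2 (A ⧸ Ideal.span {f}) r n) ↔
      ∃ c, Adm L f r n 0 c ∧ constantCoeff c ≠ 0 := by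
  rw [isSplitMono_iff]
  have hu : ∀ c : MvPowerSeries σ k, IsUnit (quot L f c) ↔ constantCoeff c ≠ 0 := by
    intro c
    constructor
    · intro h h0
      obtain ⟨d, hd⟩ := h.exists_right_inv
      obtain ⟨d, rfl⟩ := quot_surjective L f d
      rw [← map_one (quot L f), ← map_mul, ← sub_eq_zero, ← map_sub, quot_eq_zero_iff] at hd
      obtain ⟨w, hw⟩ := hd
      have := congrArg constantCoeff hw
      rw [map_sub, map_mul, map_mul, h0, hf] at this
      simp at this
    · intro h
      exact (MvPowerSeries.isUnit_iff_constantCoeff.mpr (isUnit_iff_ne_zero.mpr h)).map _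
  constructor
  · rintro ⟨ψ, hψ, h1⟩
    obtain ⟨c, hc⟩ := exists_trPow_of_isFrobLinear L f hf0 0
      (ψ.comp ((level 2 _ r).phi n).hom.toAddMonoidHom) (fun a b => by
        have h := hψ a (((level 2 _ r).phi n).hom b)
        rw [← map_smul, pow_zero, pow_one] at h
        rw [pow_zero, pow_one]
        exact h)
    refine ⟨c, ⟨ψ, hψ, hc⟩, ?_⟩
    rw [← hu]
    have := hc 1
    rw [map_one, mul_one, trPow_zero, pow_zero, Nat.sub_self, pow_zero, one_mul] at this
    rw [← this]
    exact h1
  · rintro ⟨c, ⟨ψ, hψ, h1⟩, hc⟩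
    refine ⟨ψ, hψ, ?_⟩
    have := h1 1
    rw [map_one, mul_one, trPow_zero, pow_zero, Nat.sub_self, pow_zero, one_mul] at this
    rw [this, hu]
    exact hc

theorem smul_smul_xi (F δ : MvPowerSeries σ k) (l : Functional (MvPowerSeries σ k) k)
    (hl : F • l = 0) (m : ℕ) (h : ∀ j < m, F • xi δ l j = 0) : F • F • xi δ l m = 0 := by
  rw [smul_smul, ← sq, sq_smul_xi F δ l hl m h]

theorem forall_adm_iff (hf : L.red f ≠ 0) (r : ℕ) (n : ℕ → ℕ) (e : ℕ) (hn : ∀ i ≤ r, 1 ≤ n i)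
    (l : Functional (MvPowerSeries σ k) k) (hl : L.red f • l = 0) :
    (∀ c, Adm L f r n e c → l c = 0) ↔ IsKilled (L.red f) (L.delta f) r n l := by
  induction r generalizing n e l with
  | zero =>
    obtain ⟨m, hm⟩ : ∃ m, n 0 = m + 1 := ⟨n 0 - 1, by have := hn 0 le_rfl; omega⟩
    simp_rw [adm_zero_iff L f hf n m e hm, isFedderValue_iff hf]
    rw [forall_chainValue_iff _ _ _ _ trivial l hl, IsKilled, hm]
    simp only [forall_const]
    rw [← Functional.eq_zero_iff]
    constructor
    · rintro ⟨h1, h2⟩ j hj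
      rcases Nat.lt_succ_iff_lt_or_eq.mp hj with h | rfl
      exacts [h1 j h, h2]
    · exact fun h => ⟨fun j hj => h j (by omega), h m (by omega)⟩
  | succ r ih =>
    obtain ⟨m, hm⟩ : ∃ m, n 0 = m + 1 := ⟨n 0 - 1, by have := hn 0 (by omega); omega⟩
    simp_rw [adm_succ_iff L f hf r n m e hm, isFedderValue_iff hf]
    rw [forall_chainValue_iff _ _ _ _ (adm_zero_of_zero L f r _ _) l hl, IsKilled, hm,
      Nat.add_sub_cancel]
    refine and_congr_right fun h => ih (tail n) _ (fun i hi => hn (i + 1) (by omega)) _ ?_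
    exact smul_smul_xi _ _ l hl m h

/-- The multi-height of `A / (f)` in terms of the functionals `ℓ_i`. -/
theorem hasMultiHeight_iff (hf0 : L.red f ≠ 0) (hf : MvPowerSeries.constantCoeff (L.red f) = 0)
    (h : ℕ → ℕ) : HasMultiHeight 2 (A ⧸ Ideal.span {f}) h ↔
      ∀ r, IsHeight (L.red f) (L.delta f)
        (orbit (L.red f) (L.delta f) h constFunctional r) (h r) := by
  have hl := smul_constFunctional hf
  have key : ∀ r, (∀ i < r, IsHeight (L.red f) (L.delta f)
      (orbit (L.red f) (L.delta f) h constFunctional i) (h i)) →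
      (IsLeast {m | 1 ≤ m ∧ IsSplitMono (multiPhi 2 (A ⧸ Ideal.span {f}) r
        (Function.update h r m))} (h r) ↔ IsHeight (L.red f) (L.delta f)
        (orbit (L.red f) (L.delta f) h constFunctional r) (h r)) := by
    intro r hr
    rw [← isLeast_iff_isHeight]
    refine iff_of_eq (congrArg (fun s => IsLeast s (h r))
      (Set.ext fun m => and_congr_right fun hm => ?_))
    rw [isSplitMono_iff_adm L f hf0 hf, ← isKilled_update_iff _ _ r h m _ hr,
      ← forall_adm_iff L f hf0 r _ 0 (fun i hi => ?_) _ hl]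
    · push Not
      rfl
    · rw [Function.update_apply]
      split_ifs with hi'
      exacts [hm, (hr i (by omega)).1]
  constructor
  · intro H r
    induction r using Nat.strong_induction_on with
    | _ r ih => exact (key r ih).mp (H r)
  · exact fun H r => (key r fun i _ => H i).mpr (H r)

end Fedder

/-! ### Power series over the Witt vectors of a perfect field -/

section PowerSeriesLift

open MvPowerSeries

variable (σ : Type*) (k : Type*) [Field k] [CharP k 2]

theorem coeff_zero_eq_zero_of_two_dvd {a : WittVector 2 k} (h : 2 ∣ a) :
    WittVector.constantCoeff a = 0 := by
  obtain ⟨b, rfl⟩ := h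
  rw [map_mul, map_ofNat, two_eq_zero k, zero_mul]

variable [PerfectRing k 2]

theorem two_dvd_of_coeff_zero {a : WittVector 2 k} (h : a.coeff 0 = 0) : 2 ∣ a := by
  obtain ⟨b, hb⟩ := (WittVector.frobenius_bijective 2 k).surjective (a.shift 1)
  have h1 := eq_teichmuller_add_verschiebung a
  rw [h, WittVector.teichmuller_zero, zero_add, ← hb, WittVector.verschiebung_frobenius] at h1
  exact ⟨b, by rw [h1]; exact mul_comm _ _⟩

theorem two_dvd_of_map_eq_zero {a : MvPowerSeries σ (WittVector 2 k)}
    (h : MvPowerSeries.map WittVector.constantCoeff a = 0) : 2 ∣ a := by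
  have h1 : ∀ d, ∃ b, coeff d a = 2 * b := fun d => by
    refine two_dvd_of_coeff_zero k ?_
    have := congrArg (coeff d) h
    rwa [coeff_map, map_zero] at this
  choose b hb using h1
  let b' : MvPowerSeries σ (WittVector 2 k) := fun d => b d
  refine ⟨b', ?_⟩
  ext1 d
  rw [hb, two_mul, two_mul, map_add]
  rfl

/-- The lift of Frobenius on `W(k)[[x_i]]` which is the Frobenius on `W(k)` and maps `x_i` to
`x_i ^ 2`. -/
def powerSeriesLift : FrobeniusLift (MvPowerSeries σ (WittVector 2 k)) (MvPowerSeries σ k) where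
  φ := (MvPowerSeries.map WittVector.frobenius).comp
    (MvPowerSeries.expand 2 two_ne_zero).toRingHom
  red := MvPowerSeries.map WittVector.constantCoeff
  dvd_sub a := by
    apply two_dvd_of_map_eq_zero
    have h : (WittVector.constantCoeff (p := 2) (R := k)).comp WittVector.frobenius =
        (_root_.frobenius k 2).comp WittVector.constantCoeff :=
      RingHom.ext fun x => WittVector.coeff_frobenius_charP 2 x 0
    rw [map_sub, map_pow, sub_eq_zero]
    change _ = MvPowerSeries.map WittVector.constantCoeff (MvPowerSeries.map WittVector.frobenius
      (MvPowerSeries.expand 2 two_ne_zero a))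
    rw [← map_frobenius_expand 2 two_ne_zero, ← map_expand, ← RingHom.comp_apply,
      ← RingHom.comp_apply, ← MvPowerSeries.map_comp, ← MvPowerSeries.map_comp, h]
  torsionFree a h := by
    ext1 d
    have h1 := congrArg (coeff d) h
    rw [two_mul, map_add, map_zero, ← two_mul] at h1
    refine (mul_eq_zero.mp h1).resolve_left ?_
    exact_mod_cast WittVector.p_nonzero 2 k
  red_surjective := by
    intro a
    let b : MvPowerSeries σ (WittVector 2 k) := fun d => WittVector.teichmuller 2 (coeff d a)
    refine ⟨b, ?_⟩
    ext1 d
    rw [coeff_map]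
    exact WittVector.teichmuller_coeff_zero 2 _
  red_eq_zero _ h := two_dvd_of_map_eq_zero σ k h

variable {σ k}

theorem powerSeriesLift_red_X (i : σ) : (powerSeriesLift σ k).red (X i) = X i :=
  MvPowerSeries.map_X _ _

theorem powerSeriesLift_φ_X (i : σ) : (powerSeriesLift σ k).φ (X i) = X i ^ 2 := by
  have h : MvPowerSeries.map (WittVector.frobenius (p := 2) (R := k)) (X i ^ 2) =
      (X i : MvPowerSeries σ (WittVector 2 k)) ^ 2 := by
    rw [map_pow, MvPowerSeries.map_X]
  exact (congrArg _ (expand_X 2 two_ne_zero i)).trans h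

/-- The values of `Δ` on a sum of four elements on which `φ` is the square, up to a multiple of
`2`. -/
theorem FrobeniusLift.delta_sum {A P : Type*} [CommRing A] [CommRing P] [CharP P 2]
    (L : FrobeniusLift A P) {a b c d : A} (ha : L.φ a = a ^ 2) (hb : L.φ b = b ^ 2)
    (hc : L.φ c = c ^ 2) (hd : L.φ d = d ^ 2) (g : A) :
    L.delta (a + b + c + d + 2 * g) =
      L.red (a * b + a * c + a * d + b * c + b * d + c * d) + L.red g ^ 2 := by
  rw [L.delta_eq (c := a * b + a * c + a * d + b * c + b * d + c * d - L.φ g +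
    2 * (g * (a + b + c + d) + g ^ 2)), map_add, map_sub, L.red_two_mul, L.red_φ, add_zero,
    CharTwo.sub_eq_add]
  rw [map_add, map_add, map_add, map_add, map_mul, map_ofNat, ha, hb, hc, hd]
  ring

end PowerSeriesLift

/-! ### Functionals on power series in three variables -/

section ThreeVariables

open MvPowerSeries

/-- The monomial `x ^ p * y ^ j * z ^ q`. -/
def mon (k : Type*) [Field k] (p j q : ℕ) : MvPowerSeries (Fin 3) k :=
  X 0 ^ p * X 1 ^ j * X 2 ^ q

theorem mon_mul {k : Type*} [Field k] (p j q p' j' q' : ℕ) :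
    mon k p j q * mon k p' j' q' = mon k (p + p') (j + j') (q + q') := by
  simp only [mon]
  ring

theorem mon_pow {k : Type*} [Field k] (p j q e : ℕ) :
    mon k p j q ^ e = mon k (p * e) (j * e) (q * e) := by
  simp only [mon]
  ring

theorem mon_zero {k : Type*} [Field k] : mon k 0 0 0 = 1 := by
  simp [mon]

theorem monomial_eq_mon {k : Type*} [Field k] (d : Fin 3 →₀ ℕ) :
    monomial d 1 = mon k (d 0) (d 1) (d 2) := by
  rw [mon, monomial_eq', map_one, one_mul, Finsupp.prod_fintype _ _ fun _ => pow_zero _,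
    Fin.prod_univ_three]

/-- A power series is a constant plus a combination of the variables. -/
theorem exists_eq_C_add {k : Type*} [Field k] (a : MvPowerSeries (Fin 3) k) :
    ∃ p q r, a = C (constantCoeff a) + mon k 1 0 0 * p + mon k 0 1 0 * q + mon k 0 0 1 * r := by
  classical
  let t : ((Fin 3 →₀ ℕ) → Prop) → MvPowerSeries (Fin 3) k := fun S d =>
    if S d then coeff d a else 0
  have ht : ∀ S d, coeff d (t S) = if S d then coeff d a else 0 := fun _ _ => rfl
  obtain ⟨p, hp⟩ : (X 0 : MvPowerSeries (Fin 3) k) ∣ a - t fun d => d 0 = 0 := by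
    rw [X_dvd_iff]
    intro d hd
    rw [map_sub, ht, if_pos hd, sub_self]
  obtain ⟨q, hq⟩ : (X 1 : MvPowerSeries (Fin 3) k) ∣
      (t fun d => d 0 = 0) - t fun d => d 0 = 0 ∧ d 1 = 0 := by
    rw [X_dvd_iff]
    intro d hd
    rw [map_sub, ht, ht]
    by_cases h0 : d 0 = 0 <;> simp [hd, h0]
  obtain ⟨r, hr⟩ : (X 2 : MvPowerSeries (Fin 3) k) ∣
      (t fun d => d 0 = 0 ∧ d 1 = 0) - C (constantCoeff a) := by
    rw [X_dvd_iff]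
    intro d hd
    rw [map_sub, ht, coeff_C]
    have h : (d 0 = 0 ∧ d 1 = 0) ↔ d = 0 := by
      constructor
      · rintro ⟨h0, h1⟩
        ext i
        fin_cases i
        exacts [h0, h1, hd]
      · rintro rfl
        exact ⟨rfl, rfl⟩
    simp only [h]
    split_ifs with hd0
    · rw [hd0, coeff_zero_eq_constantCoeff_apply, sub_self]
    · rw [sub_self]
  refine ⟨p, q, r, ?_⟩
  have h0 : mon k 1 0 0 = X 0 := by simp [mon]
  have h1 : mon k 0 1 0 = X 1 := by simp [mon]
  have h2 : mon k 0 0 1 = X 2 := by simp [mon]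
  rw [h0, h1, h2, ← hp, ← hq, ← hr]
  ring

variable {k : Type*} [Field k] [CharP k 2] [PerfectRing k 2]

/-- The trace of a monomial. -/
theorem tr_mon (p j q : ℕ) : tr (mon k p j q) =
    if p % 2 = 1 ∧ j % 2 = 1 ∧ q % 2 = 1 then mon k (p / 2) (j / 2) (q / 2) else 0 := by
  let e : Fin 3 → Fin 2 := ![⟨p % 2, Nat.mod_lt _ two_pos⟩, ⟨j % 2, Nat.mod_lt _ two_pos⟩,
    ⟨q % 2, Nat.mod_lt _ two_pos⟩]
  have h : mon k p j q = monomial (parity e) 1 * mon k (p / 2) (j / 2) (q / 2) ^ 2 := by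
    rw [monomial_eq_mon, mon_pow]
    change _ = mon k (p % 2) (j % 2) (q % 2) * _
    rw [mon_mul]
    congr 1 <;> omega
  rw [h, tr, sqrtPart_monomial_mul_sq]
  refine if_congr ?_ rfl rfl
  constructor
  · intro he
    exact ⟨congrArg Fin.val (congrFun he 0), congrArg Fin.val (congrFun he 1),
      congrArg Fin.val (congrFun he 2)⟩
  · rintro ⟨h0, h1, h2⟩
    funext i
    fin_cases i
    exacts [Fin.ext h0, Fin.ext h1, Fin.ext h2]

/-- If `w • fr l` is killed by two of the variables, two traces suffice to decide whether it
vanishes. -/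
theorem smul_fr_eq_zero_of (w : MvPowerSeries (Fin 3) k)
    (l : Functional (MvPowerSeries (Fin 3) k) k)
    (hx : mon k 1 0 0 • w • fr l = 0)
    (hz : mon k 0 0 1 • w • fr l = 0)
    (h1 : tr w • l = 0) (hy : tr (w * mon k 0 1 0) • l = 0) : w • fr l = 0 := by
  rw [smul_smul, smul_fr_eq_zero_iff] at hx hz
  rw [smul_fr_eq_zero_iff]
  intro c
  rw [eq_sum_sqrtPart c, Finset.mul_sum, map_sum, Finset.sum_smul]
  refine Finset.sum_eq_zero fun e _ => ?_
  rw [show ∀ a b : MvPowerSeries (Fin 3) k, w * (a * b ^ 2) = b ^ 2 * (w * a) by intros; ring,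
    tr_sq_mul, mul_smul]
  suffices h : tr (w * monomial (parity e) 1) • l = 0 by rw [h, smul_zero]
  rw [monomial_eq_mon, parity_apply, parity_apply, parity_apply]
  have h01 : ∀ i : Fin 2, (i : ℕ) = 0 ∨ (i : ℕ) = 1 := by decide
  rcases h01 (e 0) with h0 | h0
  · rcases h01 (e 2) with h2 | h2
    · rw [h0, h2]
      rcases h01 (e 1) with h3 | h3
      · rwa [h3, mon_zero, mul_one]
      · rwa [h3]
    · have := hz (mon k (e 0) (e 1) 0)
      rwa [mul_comm _ w, mul_assoc, mon_mul, zero_add, zero_add, add_zero, ← h2] at this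
  · have := hx (mon k 0 (e 1) (e 2))
    rwa [mul_comm _ w, mul_assoc, mon_mul, zero_add, zero_add, add_zero, ← h0] at this

end ThreeVariables

/-! ### Traces of multiples of the equation -/

section Equation

open MvPowerSeries

variable {k : Type*} [Field k] [CharP k 2]

/-- The equation `z² + x²y + x^α y^n z^β + x y^N z`; the two cases of interest are `(α, β) = (1, 0)`
and `(α, β) = (0, 1)`. -/
def eqn (k : Type*) [Field k] (n N α β : ℕ) : MvPowerSeries (Fin 3) k :=
  mon k 0 0 2 + mon k 2 1 0 + mon k α n β + mon k 1 N 1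

/-- The value of `Δ` on a lift `z² + x²y + x^α y^n z^β + x y^N z + 2G` of the equation, where `G` is
given modulo `2`: the second elementary symmetric polynomial in the four monomials, plus `G²`. -/
def deltaEqn (n N α β : ℕ) (G : MvPowerSeries (Fin 3) k) : MvPowerSeries (Fin 3) k :=
  mon k 0 0 2 * mon k 2 1 0 + mon k 0 0 2 * mon k α n β + mon k 0 0 2 * mon k 1 N 1 +
    mon k 2 1 0 * mon k α n β + mon k 2 1 0 * mon k 1 N 1 + mon k α n β * mon k 1 N 1 + G ^ 2

/-- In characteristic `2`, a multiple of `e₁ * (e₂ + G²)` in four monomials, written so that the trace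
of each summand can be read off. -/
theorem mul_sum_mul {R : Type*} [CommRing R] [CharP R 2] (c A B T D G : R) :
    c * ((A + B + T + D) * (A * B + A * T + A * D + B * T + B * D + T * D + G ^ 2)) =
      (A + B + T + D + A) ^ 2 * (c * A) + (A + B + T + D + B) ^ 2 * (c * B) +
      (A + B + T + D + T) ^ 2 * (c * T) + (A + B + T + D + D) ^ 2 * (c * D) +
      (c * (A * B * T) + c * (A * B * D) + c * (A * T * D) + c * (B * T * D)) +
      G ^ 2 * (c * (A + B + T + D)) := by
  linear_combination c * (4 * (A + B + T + D) * (A * B + A * T + A * D + B * T + B * D + T * D) -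
    2 * (A + B + T + D) ^ 3 - 2 * (A * B * T + A * B * D + A * T * D + B * T * D)) *
    two_eq_zero R

variable [PerfectRing k 2] {n N α β : ℕ} {G : MvPowerSeries (Fin 3) k}

theorem tr_mon_mul_eqn (p j q : ℕ) : tr (mon k p j q * eqn k n N α β) =
    tr (mon k p j (q + 2)) + tr (mon k (p + 2) (j + 1) q) + tr (mon k (p + α) (j + n) (q + β)) +
      tr (mon k (p + 1) (j + N) (q + 1)) := by
  rw [eqn, mul_add, mul_add, mul_add, mon_mul, mon_mul, mon_mul, mon_mul, map_add, map_add, map_add]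
  rfl

/-- The trace of a monomial multiple of the product of the equation and its `Δ`, modulo the
equation. -/
theorem tr_mon_mul_eqn_mul_delta_smul (l : Functional (MvPowerSeries (Fin 3) k) k)
    (hl : eqn k n N α β • l = 0) (p j q : ℕ) :
    tr (mon k p j q * (eqn k n N α β * deltaEqn n N α β G)) • l =
      (mon k 0 0 2 * tr (mon k p j (q + 2)) + mon k 2 1 0 * tr (mon k (p + 2) (j + 1) q) +
      mon k α n β * tr (mon k (p + α) (j + n) (q + β)) +
      mon k 1 N 1 * tr (mon k (p + 1) (j + N) (q + 1)) +
      (tr (mon k (p + (2 + α)) (j + (1 + n)) (q + (2 + β))) +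
        tr (mon k (p + 3) (j + (1 + N)) (q + 3)) +
        tr (mon k (p + (α + 1)) (j + (n + N)) (q + (2 + β + 1))) +
        tr (mon k (p + (2 + α + 1)) (j + (1 + n + N)) (q + (β + 1)))) +
      G * tr (mon k p j q * eqn k n N α β)) • l := by
  have h : ∀ a b : MvPowerSeries (Fin 3) k, ((eqn k n N α β + a) * b) • l = (a * b) • l :=
    fun a b => by
      rw [add_mul, add_smul, mul_comm (eqn k n N α β), mul_smul, hl, smul_zero, zero_add]
  have h1 := mul_sum_mul (mon k p j q) (mon k 0 0 2) (mon k 2 1 0) (mon k α n β) (mon k 1 N 1) G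
  rw [← eqn, ← deltaEqn] at h1
  simp only [mon_mul, zero_add, add_zero] at h1
  rw [h1]
  simp only [map_add, tr_sq_mul, add_smul, h]

/-- The traces of `y^j` times the equation. -/
theorem tr_y_eqn (hαβ : α + β = 1) (j : ℕ) : tr (mon k 0 j 0 * eqn k n N α β) =
    if (N + j) % 2 = 1 then mon k 0 ((N + j) / 2) 0 else 0 := by
  rw [tr_mon_mul_eqn, tr_mon, tr_mon, tr_mon, tr_mon, if_neg (by omega),
    if_neg (by omega), if_neg (by omega), zero_add, zero_add, zero_add]
  simp [add_comm j N]

theorem tr_xyz_eqn (hαβ : α + β = 1) : tr (mon k 1 1 1 * eqn k n N α β) = mon k 0 0 1 := by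
  rw [tr_mon_mul_eqn, tr_mon, tr_mon, tr_mon, tr_mon, if_pos (by omega),
    if_neg (by omega), if_neg (by omega), if_neg (by omega)]
  simp

theorem tr_xz_eqn (hαβ : α + β = 1) : tr (mon k 1 0 1 * eqn k n N α β) = mon k 1 0 0 := by
  rw [tr_mon_mul_eqn, tr_mon, tr_mon, tr_mon, tr_mon, if_neg (by omega),
    if_pos (by omega), if_neg (by omega), if_neg (by omega)]
  simp

/-- For `(α, β) = (1, 0)` the multiplier is `z y^j`, for `(α, β) = (0, 1)` it is `x y^j`. -/
theorem tr_mon_eqn (hαβ : α + β = 1) (j : ℕ) : tr (mon k β j α * eqn k n N α β) =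
    if (n + j) % 2 = 1 then mon k 0 ((n + j) / 2) 0 else 0 := by
  have h : α = 1 ∧ β = 0 ∨ α = 0 ∧ β = 1 := by omega
  rw [tr_mon_mul_eqn, tr_mon, tr_mon, tr_mon, tr_mon, if_neg (by omega), if_neg (by omega),
    zero_add, zero_add]
  rcases h with ⟨rfl, rfl⟩ | ⟨rfl, rfl⟩ <;> simp [add_comm j n]

theorem tr_y_eqn_mul_delta (hαβ : α + β = 1) (l : Functional (MvPowerSeries (Fin 3) k) k)
    (hl : eqn k n N α β • l = 0) (j : ℕ) :
    tr (mon k 0 j 0 * (eqn k n N α β * deltaEqn n N α β G)) • l =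
      if (N + j) % 2 = 1 then ((G + mon k 1 N 1) * mon k 0 ((N + j) / 2) 0) • l
      else mon k 1 ((N + j) / 2) 1 • l := by
  rw [tr_mon_mul_eqn_mul_delta_smul l hl, tr_y_eqn hαβ]
  have h : α = 1 ∧ β = 0 ∨ α = 0 ∧ β = 1 := by omega
  simp only [tr_mon]
  by_cases hj : (N + j) % 2 = 1
  · have h1 : (j + (1 + N)) % 2 ≠ 1 := by omega
    rcases h with ⟨rfl, rfl⟩ | ⟨rfl, rfl⟩ <;>
      simp [hj, h1, add_comm j N, add_mul, add_comm G]
  · have h1 : (j + (1 + N)) % 2 = 1 := by omega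
    have h2 : (j + (1 + N)) / 2 = (N + j) / 2 := by omega
    rcases h with ⟨rfl, rfl⟩ | ⟨rfl, rfl⟩ <;>
      simp [hj, h1, h2, add_comm j N]

theorem tr_xyz_eqn_mul_delta (hαβ : α + β = 1) (l : Functional (MvPowerSeries (Fin 3) k) k)
    (hl : eqn k n N α β • l = 0) :
    tr (mon k 1 1 1 * (eqn k n N α β * deltaEqn n N α β G)) • l =
      (mon k 0 0 3 + G * mon k 0 0 1) • l := by
  rw [tr_mon_mul_eqn_mul_delta_smul l hl, tr_xyz_eqn hαβ]
  have h : α = 1 ∧ β = 0 ∨ α = 0 ∧ β = 1 := by omega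
  simp only [tr_mon]
  rcases h with ⟨rfl, rfl⟩ | ⟨rfl, rfl⟩ <;> simp [mon_mul]

theorem tr_xz_eqn_mul_delta (hαβ : α + β = 1) (l : Functional (MvPowerSeries (Fin 3) k) k)
    (hl : eqn k n N α β • l = 0) :
    tr (mon k 1 0 1 * (eqn k n N α β * deltaEqn n N α β G)) • l =
      (mon k 3 1 0 + G * mon k 1 0 0) • l := by
  rw [tr_mon_mul_eqn_mul_delta_smul l hl, tr_xz_eqn hαβ]
  have h : α = 1 ∧ β = 0 ∨ α = 0 ∧ β = 1 := by omega
  simp only [tr_mon]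
  rcases h with ⟨rfl, rfl⟩ | ⟨rfl, rfl⟩ <;> simp [mon_mul]

end Equation

/-! ### Clean and dirty functionals -/

section Dynamics

open MvPowerSeries

section Basic

variable {k : Type*} [Field k]

theorem mon_smul_of_le {m : Functional (MvPowerSeries (Fin 3) k) k} {p j q p' j' q' : ℕ}
    (h : mon k p j q • m = 0) (hp : p ≤ p') (hj : j ≤ j') (hq : q ≤ q') :
    mon k p' j' q' • m = 0 := by
  obtain ⟨a, rfl⟩ := Nat.exists_eq_add_of_le' hp
  obtain ⟨b, rfl⟩ := Nat.exists_eq_add_of_le' hj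
  obtain ⟨c, rfl⟩ := Nat.exists_eq_add_of_le' hq
  rw [← mon_mul, mul_smul, h, smul_zero]

theorem eq_zero_of_C_smul {m : Functional (MvPowerSeries (Fin 3) k) k} {c : k}
    (h : (C c : MvPowerSeries (Fin 3) k) • m = 0) : c = 0 ∨ m = 0 := by
  by_cases hc : c = 0
  · exact Or.inl hc
  · right
    rw [← one_smul (MvPowerSeries (Fin 3) k) m, ← map_one C, ← inv_mul_cancel₀ hc, map_mul,
      mul_smul, h, smul_zero]

/-- The functional `ℓ` is killed by `x`, `z` and `y ^ a`, but not by `y ^ (a - 1)`; its annihilator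
is then `(x, y ^ a, z)`. -/
structure Clean (a : ℕ) (l : Functional (MvPowerSeries (Fin 3) k) k) : Prop where
  pos : 1 ≤ a
  x : mon k 1 0 0 • l = 0
  z : mon k 0 0 1 • l = 0
  y : mon k 0 a 0 • l = 0
  y_ne : mon k 0 (a - 1) 0 • l ≠ 0

/-- The functional `ℓ` is not killed by both `x` and `z`. -/
def Dirty (l : Functional (MvPowerSeries (Fin 3) k) k) : Prop :=
  ¬ (mon k 1 0 0 • l = 0 ∧ mon k 0 0 1 • l = 0)

theorem Clean.le {a j : ℕ} {l : Functional (MvPowerSeries (Fin 3) k) k} (h : Clean a l)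
    (hj : mon k 0 j 0 • l = 0) : a ≤ j := by
  by_contra hlt
  exact h.y_ne (mon_smul_of_le hj le_rfl (by omega) le_rfl)

theorem Clean.not_dirty {a : ℕ} {l : Functional (MvPowerSeries (Fin 3) k) k} (h : Clean a l) :
    ¬ Dirty l := not_not.mpr ⟨h.x, h.z⟩

theorem clean_constFunctional :
    Clean 1 (constFunctional : Functional (MvPowerSeries (Fin 3) k) k) where
  pos := le_rfl
  x := smul_constFunctional (by simp [mon])
  y := smul_constFunctional (by simp [mon])
  z := smul_constFunctional (by simp [mon])
  y_ne h := by
    have := (Functional.eq_zero_iff _).mp h 1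
    rw [Functional.smul_apply, constFunctional_apply] at this
    simp [mon] at this

/-- The annihilator of a clean functional depends only on its exponent. -/
theorem Clean.smul_eq_zero {a : ℕ} {l l' : Functional (MvPowerSeries (Fin 3) k) k}
    (h : Clean a l) (h' : Clean a l') {g : MvPowerSeries (Fin 3) k} (hg : g • l = 0) :
    g • l' = 0 := by
  suffices H : ∀ b ≤ a, ∀ g : MvPowerSeries (Fin 3) k, (g * mon k 0 (a - b) 0) • l = 0 →
      (g * mon k 0 (a - b) 0) • l' = 0 by
    have := H a le_rfl g
    rw [Nat.sub_self, mon_zero, mul_one] at this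
    exact this hg
  intro b
  induction b with
  | zero => exact fun _ g _ => by rw [Nat.sub_zero, mul_smul, h'.y, smul_zero]
  | succ b ih =>
    intro hb g hg
    obtain ⟨p, q, r, hpqr⟩ := exists_eq_C_add g
    set c := constantCoeff g
    have hstep : ∀ m : Functional (MvPowerSeries (Fin 3) k) k, mon k 1 0 0 • m = 0 →
        mon k 0 0 1 • m = 0 → (g * mon k 0 (a - (b + 1)) 0) • m =
          (C c * mon k 0 (a - (b + 1)) 0) • m + (q * mon k 0 (a - b) 0) • m := fun m hx hz => by
      have e1 : g * mon k 0 (a - (b + 1)) 0 =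
          C c * mon k 0 (a - (b + 1)) 0 + q * mon k 0 (a - b) 0 +
          (p * mon k 0 (a - (b + 1)) 0 * mon k 1 0 0 +
            r * mon k 0 (a - (b + 1)) 0 * mon k 0 0 1) := by
        have e2 : mon k 0 (a - b) 0 = mon k 0 1 0 * mon k 0 (a - (b + 1)) 0 := by
          rw [mon_mul]
          congr 1
          omega
        rw [e2, hpqr]
        ring
      rw [e1, add_smul, add_smul, add_smul, mul_smul _ (mon k 1 0 0), mul_smul _ (mon k 0 0 1), hx,
        hz, smul_zero, smul_zero, add_zero, add_zero]
    rw [hstep l h.x h.z] at hg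
    have hc : c = 0 := by
      have h1 := congrArg (mon k 0 b 0 • ·) hg
      simp only [smul_add, smul_zero, smul_smul] at h1
      rw [mul_left_comm, mon_mul, mul_left_comm, mon_mul, mul_smul q, zero_add,
        show b + (a - b) = a by omega, h.y, smul_zero, add_zero, mul_smul,
        show b + (a - (b + 1)) = a - 1 by omega] at h1
      exact (eq_zero_of_C_smul h1).resolve_right h.y_ne
    rw [hstep l' h'.x h'.z, hc, map_zero, zero_mul, zero_smul, zero_add]
    rw [hc, map_zero, zero_mul, zero_smul, zero_add] at hg
    exact ih (by omega) q hg

theorem mon_eq_monomial (p j q : ℕ) : mon k p j q =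
    monomial (Finsupp.single 0 p + Finsupp.single 1 j + Finsupp.single 2 q) 1 := by
  rw [monomial_eq_mon]
  simp

theorem coeff_mon_mul_eq_zero {p j q : ℕ} {d : Fin 3 →₀ ℕ} (i : Fin 3) (hi : d i < ![p, j, q] i)
    (a : MvPowerSeries (Fin 3) k) : coeff d (mon k p j q * a) = 0 := by
  rw [mon_eq_monomial, coeff_monomial_mul, if_neg]
  intro h
  have := h i
  fin_cases i <;> simp at this hi <;> omega

theorem coeff_mon_xz : coeff (Finsupp.single 0 1 + Finsupp.single 2 1) (mon k 1 0 1) = 1 := by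
  rw [mon_eq_monomial, coeff_monomial, if_pos]
  simp

/-- The expansion of a power series modulo `(x², y, z²)`. -/
theorem exists_eq_mod_socle (G : MvPowerSeries (Fin 3) k) : ∃ (g₀ g₁ g₂ : k)
    (p q r : MvPowerSeries (Fin 3) k), G = C g₀ + C g₁ * mon k 1 0 0 + C g₂ * mon k 0 0 1 +
      C (coeff (Finsupp.single 0 1 + Finsupp.single 2 1) G) * mon k 1 0 1 + mon k 2 0 0 * p +
      mon k 0 1 0 * q + mon k 0 0 2 * r := by
  obtain ⟨g₀, g₁, g₂, g₃, p, q, r, h⟩ : ∃ (g₀ g₁ g₂ g₃ : k) (p q r : MvPowerSeries (Fin 3) k),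
      G = C g₀ + C g₁ * mon k 1 0 0 + C g₂ * mon k 0 0 1 +
      C g₃ * mon k 1 0 1 + mon k 2 0 0 * p + mon k 0 1 0 * q + mon k 0 0 2 * r := by
    obtain ⟨p, q, r, h⟩ := exists_eq_C_add G
    obtain ⟨p₁, q₁, r₁, h₁⟩ := exists_eq_C_add p
    obtain ⟨p₂, q₂, r₂, h₂⟩ := exists_eq_C_add r
    obtain ⟨p₃, q₃, r₃, h₃⟩ := exists_eq_C_add (r₁ + p₂)
    refine ⟨constantCoeff G, constantCoeff p, constantCoeff r, constantCoeff (r₁ + p₂),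
      p₁ + mon k 0 0 1 * p₃, q + mon k 1 0 0 * q₁ + mon k 0 0 1 * q₂ + mon k 1 0 1 * q₃,
      r₂ + mon k 1 0 0 * r₃, ?_⟩
    have e1 : mon k 1 0 1 = mon k 1 0 0 * mon k 0 0 1 := by rw [mon_mul]
    have e2 : mon k 2 0 0 = mon k 1 0 0 ^ 2 := by rw [mon_pow]
    have e3 : mon k 0 0 2 = mon k 0 0 1 ^ 2 := by rw [mon_pow]
    rw [e1, e2, e3]
    linear_combination h + mon k 1 0 0 * h₁ + mon k 0 0 1 * h₂ +
      mon k 1 0 0 * mon k 0 0 1 * h₃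
  refine ⟨g₀, g₁, g₂, p, q, r, ?_⟩
  set d : Fin 3 →₀ ℕ := Finsupp.single 0 1 + Finsupp.single 2 1 with hd
  have hne : ∀ (i : Fin 3) (d' : Fin 3 →₀ ℕ), d i ≠ d' i → d ≠ d' := fun i d' h h' => h (h' ▸ rfl)
  have h1 := congrArg (coeff d) h
  rw [map_add, map_add, map_add, map_add, map_add, map_add, coeff_C_mul, coeff_C_mul, coeff_C_mul,
    coeff_mon_mul_eq_zero 0 (by simp [hd]), coeff_mon_mul_eq_zero 1 (by simp [hd]),
    coeff_mon_mul_eq_zero 2 (by simp [hd]), coeff_mon_xz, mon_eq_monomial, mon_eq_monomial, coeff_C,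
    coeff_monomial, coeff_monomial, if_neg (hne 0 _ (by simp [hd])),
    if_neg (hne 2 _ (by simp [hd])), if_neg (hne 0 _ (by simp [hd]))] at h1
  rw [h1]
  simpa using h

end Basic

section Transition

variable {k : Type*} [Field k] [CharP k 2] [PerfectRing k 2] {n N α β : ℕ}
  {G : MvPowerSeries (Fin 3) k} {l : Functional (MvPowerSeries (Fin 3) k) k}

/-- If `x` kills `f F(ℓ)`, then `ℓ` is killed by `x` and `z`. -/
theorem Dirty.smul_fr_ne (hαβ : α + β = 1) (h : Dirty l) :
    mon k 1 0 0 • eqn k n N α β • fr l ≠ 0 := by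
  intro h1
  rw [smul_smul, smul_fr_eq_zero_iff] at h1
  refine h ⟨?_, ?_⟩
  · have h2 := h1 (mon k 0 0 1)
    rwa [mul_right_comm, mon_mul, tr_xz_eqn hαβ] at h2
  · have h2 := h1 (mon k 0 1 1)
    rwa [mul_right_comm, mon_mul, tr_xyz_eqn hαβ] at h2

theorem Dirty.isHeight (hαβ : α + β = 1) (h : Dirty l) :
    IsHeight (eqn k n N α β) (deltaEqn n N α β G) l 1 :=
  ⟨le_rfl, fun _ hj => absurd hj (by omega), fun h0 =>
    h.smul_fr_ne (n := n) (N := N) hαβ (by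
      change eqn k n N α β • fr l = 0 at h0
      rw [h0, smul_zero])⟩

theorem Dirty.next (hαβ : α + β = 1) (h : Dirty l) :
    Dirty (eqn k n N α β • xi (deltaEqn n N α β G) l 0) :=
  fun h' => h.smul_fr_ne hαβ h'.1

/-- The functional `m` is killed by `(x², y, z²)`, but not by `xz`, which generates the socle of the
quotient by this ideal; the annihilator of `m` is then `(x², y, z²)`. -/
structure Socle (m : Functional (MvPowerSeries (Fin 3) k) k) : Prop where
  x : mon k 2 0 0 • m = 0
  y : mon k 0 1 0 • m = 0
  z : mon k 0 0 2 • m = 0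
  xz : mon k 1 0 1 • m ≠ 0

/-- If the height of a clean functional is not `1`, the exponents of the equation are large. -/
theorem Clean.two_mul_le (hαβ : α + β = 1) {a : ℕ} (h : Clean a l) (hf : eqn k n N α β • fr l = 0) :
    2 * a ≤ n ∧ 2 * a ≤ N := by
  rw [smul_fr_eq_zero_iff] at hf
  constructor
  · rcases Nat.even_or_odd' n with ⟨b, hb | hb⟩
    · have h1 := hf (mon k β 1 α)
      rw [mul_comm, tr_mon_eqn hαβ, if_pos (by omega)] at h1
      have := h.le h1
      omega
    · have h1 := hf (mon k β 0 α)
      rw [mul_comm, tr_mon_eqn hαβ, if_pos (by omega)] at h1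
      have := h.le h1
      omega
  · rcases Nat.even_or_odd' N with ⟨b, hb | hb⟩
    · have h1 := hf (mon k 0 1 0)
      rw [mul_comm, tr_y_eqn hαβ, if_pos (by omega)] at h1
      have := h.le h1
      omega
    · have h1 := hf (mon k 0 0 0)
      rw [mul_comm, tr_y_eqn hαβ, if_pos (by omega)] at h1
      have := h.le h1
      omega

theorem socle_fr {a : ℕ} (h : Clean a l) : Socle (mon k 0 (2 * a - 1) 0 • fr l) where
  x := by
    have h1 := fr_smul (mon k 1 0 0) l
    rw [h.x, map_zero, mon_pow] at h1
    rw [smul_comm, ← h1, smul_zero]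
  y := by
    have h1 := fr_smul (mon k 0 a 0) l
    rw [h.y, map_zero, mon_pow] at h1
    rw [smul_smul, mon_mul]
    have := h.pos
    exact mon_smul_of_le h1.symm (by omega) (by omega) (by omega)
  z := by
    have h1 := fr_smul (mon k 0 0 1) l
    rw [h.z, map_zero, mon_pow] at h1
    rw [smul_comm, ← h1, smul_zero]
  xz h1 := by
    rw [smul_smul, mon_mul, smul_fr_eq_zero_iff] at h1
    have h2 := h1 (mon k 0 0 0)
    have := h.pos
    rw [mon_mul, tr_mon, if_pos (by omega)] at h2
    have := h.le (mon_smul_of_le (j' := a - 1) h2 (by omega) (by omega) (by omega))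
    omega

/-- If `x f ξ_1 = 0`, then `G` lies in `(x², y, z²)` and thus kills every `m` with this annihilator.
Here the coefficient of `xz` in `G` matters. -/
theorem smul_socle_eq_zero (hαβ : α + β = 1) {a : ℕ} (h : Clean a l)
    (hG : coeff (Finsupp.single 0 1 + Finsupp.single 2 1) G = 0)
    (h0 : eqn k n N α β • fr l = 0)
    (h1 : mon k 1 0 0 • eqn k n N α β • xi (deltaEqn n N α β G) l 1 = 0)
    {m : Functional (MvPowerSeries (Fin 3) k) k} (hm : Socle m) : G • m = 0 := by
  obtain ⟨g₀, g₁, g₂, p, q, r, hg⟩ := exists_eq_mod_socle G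
  rw [hG, map_zero, zero_mul, add_zero] at hg
  have key : ∀ m : Functional (MvPowerSeries (Fin 3) k) k, Socle m → ∀ b, (b * G) • m =
      b • ((C g₀ : MvPowerSeries (Fin 3) k) • m + (C g₁ * mon k 1 0 0) • m +
        (C g₂ * mon k 0 0 1) • m) := fun m hm b => by
    rw [mul_smul]
    congr 1
    conv_lhs => rw [hg]
    simp only [add_smul]
    rw [mul_comm _ p, mul_comm _ q, mul_comm _ r, mul_smul p, mul_smul q, mul_smul r, hm.x, hm.y,
      hm.z, smul_zero, smul_zero, smul_zero, add_zero, add_zero, add_zero]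
  rw [xi, xi, smul_smul, smul_smul, smul_fr_eq_zero_iff] at h1
  set s := mon k 0 (2 * a - 1) 0 • fr l with hs
  have hsoc : Socle s := socle_fr h
  have hx2 : mon k 2 0 0 • fr l = 0 := by
    have h1 := fr_smul (mon k 1 0 0) l
    rw [h.x, map_zero, mon_pow] at h1
    exact h1.symm
  have hz2 : mon k 0 0 2 • fr l = 0 := by
    have h1 := fr_smul (mon k 0 0 1) l
    rw [h.z, map_zero, mon_pow] at h1
    exact h1.symm
  have hx : (mon k 1 0 0 * G) • s = 0 := by
    have h2 := h1 (mon k 0 0 1)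
    rw [show mon k 1 0 0 * eqn k n N α β * deltaEqn n N α β G * mon k 0 0 1 =
      mon k 1 0 0 * mon k 0 0 1 * (eqn k n N α β * deltaEqn n N α β G) by ring, mon_mul,
      tr_xz_eqn_mul_delta hαβ _ h0, add_smul, mon_smul_of_le hx2 (by omega) (by omega) (by omega),
      zero_add, mul_comm] at h2
    rw [hs, smul_comm, h2, smul_zero]
  have hz : (mon k 0 0 1 * G) • s = 0 := by
    have h2 := h1 (mon k 0 1 1)
    rw [show mon k 1 0 0 * eqn k n N α β * deltaEqn n N α β G * mon k 0 1 1 =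
      mon k 1 0 0 * mon k 0 1 1 * (eqn k n N α β * deltaEqn n N α β G) by ring, mon_mul,
      tr_xyz_eqn_mul_delta hαβ _ h0, add_smul, mon_smul_of_le hz2 (by omega) (by omega) (by omega),
      zero_add, mul_comm] at h2
    rw [hs, smul_comm, h2, smul_zero]
  rw [key s hsoc] at hx hz
  simp only [smul_add, smul_smul] at hx hz
  rw [show mon k 1 0 0 * (C g₁ * mon k 1 0 0) = C g₁ * mon k 2 0 0 by
    rw [mul_left_comm, mon_mul], mul_smul _ (mon k 2 0 0), hsoc.x, smul_zero, add_zero,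
    show mon k 1 0 0 * (C g₂ * mon k 0 0 1) = C g₂ * mon k 1 0 1 by
    rw [mul_left_comm, mon_mul], mul_comm, mul_smul, mul_smul] at hx
  rw [show mon k 0 0 1 * (C g₂ * mon k 0 0 1) = C g₂ * mon k 0 0 2 by
    rw [mul_left_comm, mon_mul], mul_smul _ (mon k 0 0 2), hsoc.z, smul_zero, add_zero,
    show mon k 0 0 1 * (C g₁ * mon k 1 0 0) = C g₁ * mon k 1 0 1 by
    rw [mul_left_comm, mon_mul], mul_comm, mul_smul, mul_smul] at hz
  have hg0 : g₀ = 0 := by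
    have h3 := congrArg (mon k 0 0 1 • ·) hx
    simp only [smul_add, smul_zero] at h3
    rw [smul_comm, smul_smul (mon k 0 0 1), mon_mul, smul_comm (mon k 0 0 1),
      smul_smul (mon k 0 0 1), mon_mul, mon_smul_of_le hsoc.z (q' := 1 + 1) (by omega) (by omega) (by omega),
        smul_zero,
      add_zero] at h3
    exact (eq_zero_of_C_smul h3).resolve_right hsoc.xz
  rw [hg0, map_zero, zero_smul, zero_add] at hx hz
  have hg1 := (eq_zero_of_C_smul hz).resolve_right hsoc.xz
  have hg2 := (eq_zero_of_C_smul hx).resolve_right hsoc.xz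
  have := key m hm 1
  rw [one_mul, hg0, hg1, hg2] at this
  simpa using this

/-- On such functionals, `δ` acts through its first summand `x²yz²`. -/
theorem socle_delta_smul_fr (hαβ : α + β = 1) (hn : 2 ≤ n) (hN : 2 ≤ N)
    {m : Functional (MvPowerSeries (Fin 3) k) k} (hm : Socle m) (hG : G • m = 0) :
    Socle (deltaEqn n N α β G • fr m) := by
  have hx := fr_smul (mon k 2 0 0) m
  have hy := fr_smul (mon k 0 1 0) m
  have hz := fr_smul (mon k 0 0 2) m
  have hG' := fr_smul G m
  rw [hm.x, map_zero, mon_pow] at hx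
  rw [hm.y, map_zero, mon_pow] at hy
  rw [hm.z, map_zero, mon_pow] at hz
  rw [hG, map_zero] at hG'
  have h : deltaEqn n N α β G • fr m = mon k 2 1 2 • fr m := by
    simp only [deltaEqn, add_smul, ← hG', mon_mul]
    rw [mon_smul_of_le hy.symm (p' := 0 + α) (by omega) (by omega) (by omega),
      mon_smul_of_le hy.symm (p' := 0 + 1) (by omega) (by omega) (by omega),
      mon_smul_of_le hy.symm (p' := 2 + α) (by omega) (by omega) (by omega),
      mon_smul_of_le hy.symm (p' := 2 + 1) (by omega) (by omega) (by omega),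
      mon_smul_of_le hy.symm (p' := α + 1) (by omega) (by omega) (by omega)]
    simp
  rw [h]
  constructor
  · rw [smul_smul, mon_mul]
    exact mon_smul_of_le hx.symm (by omega) (by omega) (by omega)
  · rw [smul_smul, mon_mul]
    exact mon_smul_of_le hy.symm (by omega) (by omega) (by omega)
  · rw [smul_smul, mon_mul]
    exact mon_smul_of_le hz.symm (by omega) (by omega) (by omega)
  · intro h1
    rw [smul_smul, mon_mul, smul_fr_eq_zero_iff] at h1
    have h2 := h1 (mon k 0 0 0)
    rw [mon_mul, tr_mon, if_pos (by omega)] at h2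
    exact hm.xz h2

end Transition

end Dynamics

section Transition

open MvPowerSeries

variable {k : Type*} [Field k] [CharP k 2] [PerfectRing k 2] {n N α β : ℕ}
  {G : MvPowerSeries (Fin 3) k} {l : Functional (MvPowerSeries (Fin 3) k) k}

/-- As long as the functionals `f ξ_j` vanish, `y ^ (2 ^ i * (2 * a - 1)) ξ_i` has annihilator
`(x², y, z²)`. -/
theorem Clean.socle_xi (hαβ : α + β = 1) {a : ℕ} (h : Clean a l)
    (hG : coeff (Finsupp.single 0 1 + Finsupp.single 2 1) G = 0) (i : ℕ)
    (hi : ∀ j ≤ i, eqn k n N α β • xi (deltaEqn n N α β G) l j = 0) :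
    Socle (mon k 0 (2 ^ i * (2 * a - 1)) 0 • xi (deltaEqn n N α β G) l i) := by
  induction i with
  | zero =>
    rw [pow_zero, one_mul]
    exact socle_fr h
  | succ i ih =>
    have h0 : eqn k n N α β • fr l = 0 := hi 0 (by omega)
    have h1 := hi 1 (by omega)
    obtain ⟨hn, hN⟩ := h.two_mul_le hαβ h0
    have hpos := h.pos
    have hs := ih fun j hj => hi j (by omega)
    have h2 := socle_delta_smul_fr hαβ (n := n) (N := N) (by omega) (by omega) hs
      (smul_socle_eq_zero hαβ h hG h0 (by rw [h1, smul_zero]) hs)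
    rw [fr_smul, mon_pow, smul_comm] at h2
    rw [xi, pow_succ, mul_right_comm]
    exact h2

/-- The lower bound for `f ξ_i`. -/
theorem Clean.y_smul_xi_ne (hαβ : α + β = 1) {a : ℕ} (h : Clean a l)
    (hG : coeff (Finsupp.single 0 1 + Finsupp.single 2 1) G = 0) (i : ℕ)
    (hi : ∀ j < i, eqn k n N α β • xi (deltaEqn n N α β G) l j = 0)
    (hN : N ≤ 2 ^ i * (2 * a - 1)) :
    mon k 0 (2 ^ i * (2 * a - 1) - N) 0 • eqn k n N α β • xi (deltaEqn n N α β G) l i ≠ 0 := by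
  intro h0
  have hpos := h.pos
  rcases i with _ | i
  · rw [pow_zero, one_mul] at hN h0
    rw [xi, smul_smul, smul_fr_eq_zero_iff] at h0
    have h1 := h0 1
    rw [mul_one, tr_y_eqn hαβ, if_pos (by omega)] at h1
    have := h.le h1
    omega
  · have hs := h.socle_xi hαβ hG i fun j hj => hi j (by omega)
    rw [xi, smul_smul, smul_smul, smul_fr_eq_zero_iff] at h0
    have h1 := h0 1
    have h2 : 2 ^ (i + 1) * (2 * a - 1) = 2 * (2 ^ i * (2 * a - 1)) := by ring
    rw [h2] at h1 hN
    rw [mul_one, mul_assoc, tr_y_eqn_mul_delta hαβ _ (hi i (by omega)), if_neg (by omega),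
      show (N + (2 * (2 ^ i * (2 * a - 1)) - N)) / 2 = 2 ^ i * (2 * a - 1) by omega] at h1
    apply hs.xz
    rw [smul_smul, mon_mul, add_zero, zero_add]
    exact h1

/-- The upper bound for `f ξ_i`, provided that it is killed by `x` and `z`. -/
theorem Clean.y_smul_xi_eq_zero (hαβ : α + β = 1) {a : ℕ} (h : Clean a l)
    (hG : coeff (Finsupp.single 0 1 + Finsupp.single 2 1) G = 0) (i : ℕ)
    (hi : ∀ j < i, eqn k n N α β • xi (deltaEqn n N α β G) l j = 0)
    (hx : ¬ Dirty (eqn k n N α β • xi (deltaEqn n N α β G) l i)) (b : ℕ)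
    (hb : 2 ^ i * (2 * a - 1) < N + b) :
    mon k 0 b 0 • eqn k n N α β • xi (deltaEqn n N α β G) l i = 0 := by
  obtain ⟨hx, hz⟩ := not_not.mp hx
  have hpos := h.pos
  rcases i with _ | i
  · rw [pow_zero, one_mul] at hb
    rw [xi] at hx hz ⊢
    rw [smul_smul]
    refine smul_fr_eq_zero_of _ _ ?_ ?_ ?_ ?_
    · rw [mul_smul, smul_comm, hx, smul_zero]
    · rw [mul_smul, smul_comm, hz, smul_zero]
    · rw [tr_y_eqn hαβ]
      split_ifs with h1
      · exact mon_smul_of_le h.y le_rfl (by omega) le_rfl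
      · exact zero_smul _ _
    · rw [mul_right_comm, mon_mul, tr_y_eqn hαβ]
      split_ifs with h1
      · exact mon_smul_of_le h.y le_rfl (by omega) le_rfl
      · exact zero_smul _ _
  · have hs := h.socle_xi hαβ hG i fun j hj => hi j (by omega)
    have h0 : eqn k n N α β • fr l = 0 := hi 0 (by omega)
    have hN := (h.two_mul_le hαβ h0).2
    have h1 : mon k 1 0 0 • eqn k n N α β • xi (deltaEqn n N α β G) l 1 = 0 := by
      rcases i with _ | i
      · exact hx
      · rw [hi 1 (by omega), smul_zero]
    have hGs := smul_socle_eq_zero hαβ h hG h0 h1 hs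
    have h2 : 2 ^ (i + 1) * (2 * a - 1) = 2 * (2 ^ i * (2 * a - 1)) := by ring
    rw [h2] at hb
    set s := 2 ^ i * (2 * a - 1)
    have hf := hi i (by omega)
    set η := xi (deltaEqn n N α β G) l i with hη
    -- both traces of the equation which matter kill `η`
    have key : ∀ b, 2 * s < N + b →
        tr (mon k 0 b 0 * (eqn k n N α β * deltaEqn n N α β G)) • η = 0 := by
      intro b hb
      rw [tr_y_eqn_mul_delta hαβ _ hf]
      split_ifs with hodd
      · obtain ⟨c, hc⟩ := Nat.exists_eq_add_of_le' (show s ≤ (N + b) / 2 by omega)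
        rw [hc, show mon k 0 (c + s) 0 = mon k 0 c 0 * mon k 0 s 0 by rw [mon_mul],
          mul_left_comm, mul_smul, mul_smul, add_smul, hGs,
          mon_smul_of_le hs.y (by omega) (by omega) (by omega), add_zero, smul_zero]
      · obtain ⟨c, hc⟩ := Nat.exists_eq_add_of_le' (show s + 1 ≤ (N + b) / 2 by omega)
        rw [hc, show mon k 1 (c + (s + 1)) 1 = mon k 1 c 1 * (mon k 0 1 0 * mon k 0 s 0) by
          rw [mon_mul, mon_mul]
          congr 1
          ring, mul_smul, mul_smul, hs.y, smul_zero]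
    rw [xi, ← hη] at hx hz ⊢
    rw [smul_smul, smul_smul]
    refine smul_fr_eq_zero_of _ _ ?_ ?_ ?_ ?_
    · rw [mul_assoc, mul_smul, mul_smul, smul_comm, hx, smul_zero]
    · rw [mul_assoc, mul_smul, mul_smul, smul_comm, hz, smul_zero]
    · rw [mul_assoc]
      exact key b hb
    · rw [mul_assoc (mon k 0 b 0), mul_right_comm, mon_mul]
      exact key (b + 1) (by omega)

/-- A clean functional of exponent `a` has a height `m`, which is at most the least `e ≥ 1` with
`N ≤ 2 ^ (e - 1) * (2 * a - 1)`. The next functional is dirty, or `m = e` and it is clean. -/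
theorem Clean.exists_isHeight (hαβ : α + β = 1) {a : ℕ} (h : Clean a l)
    (hG : coeff (Finsupp.single 0 1 + Finsupp.single 2 1) G = 0) (e : ℕ)
    (he : N ≤ 2 ^ e * (2 * a - 1)) (hlt : ∀ e' < e, 2 ^ e' * (2 * a - 1) < N) :
    ∃ m, IsHeight (eqn k n N α β) (deltaEqn n N α β G) l (m + 1) ∧ m ≤ e ∧
      (Dirty (eqn k n N α β • xi (deltaEqn n N α β G) l m) ∨
        m = e ∧ Clean (2 ^ e * (2 * a - 1) - N + 1)
          (eqn k n N α β • xi (deltaEqn n N α β G) l m)) := by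
  classical
  have hex : ∃ j, j ≤ e ∧ eqn k n N α β • xi (deltaEqn n N α β G) l j ≠ 0 := by
    by_contra! H
    exact h.y_smul_xi_ne hαβ hG e (fun j hj => H j hj.le) he (by rw [H e le_rfl, smul_zero])
  obtain ⟨hme, hm⟩ := Nat.find_spec hex
  set m := Nat.find hex
  have hmin : ∀ j < m, eqn k n N α β • xi (deltaEqn n N α β G) l j = 0 := fun j hj => by
    by_contra hne
    exact Nat.find_min hex hj ⟨by omega, hne⟩
  refine ⟨m, ⟨by omega, hmin, hm⟩, hme, ?_⟩
  by_cases hd : Dirty (eqn k n N α β • xi (deltaEqn n N α β G) l m)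
  · exact Or.inl hd
  · right
    have hle := h.y_smul_xi_eq_zero hαβ hG m hmin hd
    rcases hme.lt_or_eq with hlt' | heq
    · exfalso
      have := hle 0 (by have := hlt m hlt'; omega)
      rw [mon_zero, one_smul] at this
      exact hm this
    · rw [heq] at hle hmin hd ⊢
      obtain ⟨hx, hz⟩ := not_not.mp hd
      exact ⟨rfl, by omega, hx, hz, hle _ (by omega), h.y_smul_xi_ne hαβ hG e hmin he⟩

end Transition

/-! ### Dependence on annihilators -/

section Determinism

/-- Two functionals have the same annihilator. -/
def SameAnn {P k : Type*} [CommRing P] [AddCommGroup k] (l l' : Functional P k) : Prop :=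
  ∀ g : P, g • l = 0 ↔ g • l' = 0

theorem SameAnn.smul {P k : Type*} [CommRing P] [AddCommGroup k] {l l' : Functional P k}
    (h : SameAnn l l') (w : P) : SameAnn (w • l) (w • l') :=
  fun g => by rw [smul_smul, smul_smul, h]

variable {k : Type*} [Field k] [CharP k 2] [PerfectRing k 2] {σ : Type*} [Fintype σ]
  [DecidableEq σ]

variable {l l' : Functional (MvPowerSeries σ k) k}

theorem SameAnn.fr (h : SameAnn l l') : SameAnn (fr l) (MultiHeight.fr l') := fun g => by
  rw [smul_fr_eq_zero_iff, smul_fr_eq_zero_iff]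
  exact forall_congr' fun c => h _

theorem SameAnn.xi (h : SameAnn l l') (δ : MvPowerSeries σ k) (j : ℕ) :
    SameAnn (xi δ l j) (MultiHeight.xi δ l' j) := by
  induction j with
  | zero => exact h.fr
  | succ j ih => exact ih.fr.smul δ

theorem SameAnn.smul_xi_eq_zero_iff (h : SameAnn l l') (f δ : MvPowerSeries σ k) (j : ℕ) :
    f • MultiHeight.xi δ l j = 0 ↔ f • MultiHeight.xi δ l' j = 0 := h.xi δ j f

theorem SameAnn.isHeight (h : SameAnn l l') {f δ : MvPowerSeries σ k} {m : ℕ}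
    (hm : IsHeight f δ l m) : IsHeight f δ l' m :=
  ⟨hm.1, fun j hj => (h.smul_xi_eq_zero_iff f δ j).mp (hm.2.1 j hj),
    fun h0 => hm.2.2 ((h.smul_xi_eq_zero_iff f δ _).mpr h0)⟩

end Determinism

/-! ### The sequences `α_i` and `e_i` -/

section Combinatorics

theorem alpha_succ (N : ℤ) (i : ℕ) :
    alpha N (i + 1) = 2 ^ eSeq N i * (1 + alpha N i) - 2 ^ (eSeq N i - 1) - N := rfl

theorem alpha_add_eq {N : ℤ} {s t : ℕ} (h : alpha N s = alpha N t) (i : ℕ) :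
    alpha N (s + i) = alpha N (t + i) := by
  induction i with
  | zero => exact h
  | succ i ih => rw [← add_assoc, ← add_assoc, alpha, alpha, ih]

theorem exists_alpha_periodic {N : ℤ} (hN : 1 ≤ N) :
    ∃ s t : ℕ, s < t ∧ ∀ i, alpha N (s + i) = alpha N (t + i) := by
  obtain ⟨s, -, t, -, hne, h⟩ := Set.infinite_univ.exists_ne_map_eq_of_mapsTo
    (f := alpha N) (fun i _ => Set.mem_Icc.mpr ⟨(alpha_bounds hN i).1, (alpha_bounds hN i).2.le⟩)
    (Set.finite_Icc 0 N)
  rcases Nat.lt_or_gt_of_ne hne with hlt | hlt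
  · exact ⟨s, t, hlt, alpha_add_eq h⟩
  · exact ⟨t, s, hlt, alpha_add_eq h.symm⟩

theorem candidates_finite (N : ℤ) (t : ℕ) : (candidates N t).Finite := by
  refine Set.Finite.union ?_ (Set.finite_singleton _)
  have h := (Set.finite_Icc (0 : Fin (t + 1) → ℕ) fun i => eSeq N i).image
    (fun g i => if hi : i < t + 1 then g ⟨i, hi⟩ else 1)
  refine h.subset fun h hh => ⟨fun i => h i, ?_, ?_⟩
  · rw [Set.mem_Icc]
    exact ⟨fun i => Nat.zero_le _, fun i => (hh.1 i (Nat.lt_succ_iff.mp i.isLt)).2⟩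
  · funext i
    by_cases hi : i < t + 1
    · simp [hi]
    · simp [hi, hh.2 i (by omega)]

/-- The exponent `1 + α_i` of a clean functional at place `i`. -/
def cleanExp (N : ℤ) (i : ℕ) : ℕ := (1 + alpha N i).toNat

theorem cleanExp_cast {N : ℤ} (hN : 1 ≤ N) (i : ℕ) : (cleanExp N i : ℤ) = 1 + alpha N i := by
  have := (alpha_bounds hN i).1
  rw [cleanExp]
  omega

theorem two_pow_mul_sub {N : ℤ} (hN : 1 ≤ N) (i e : ℕ) :
    ((2 ^ e * (2 * cleanExp N i - 1) : ℕ) : ℤ) = 2 ^ (e + 1) * (1 + alpha N i) - 2 ^ e := by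
  have h := cleanExp_cast hN i
  have h1 := (alpha_bounds hN i).1
  rw [Nat.cast_mul, Nat.cast_sub (by omega), Nat.cast_mul, h]
  push_cast
  ring

theorem eSeq_pos {N : ℤ} (hN : 1 ≤ N) (i : ℕ) : 1 ≤ eSeq N i :=
  (expo_isLeast (alpha_bounds hN i).1).1.1

theorem le_two_pow_mul {N : ℤ} (hN : 1 ≤ N) (i : ℕ) :
    N.toNat ≤ 2 ^ (eSeq N i - 1) * (2 * cleanExp N i - 1) := by
  have h := (expo_isLeast (N := N) (alpha_bounds hN i).1).1.2
  have h1 := eSeq_pos hN i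
  have h2 := two_pow_mul_sub hN i (eSeq N i - 1)
  rw [Nat.sub_add_cancel h1] at h2
  change 0 ≤ 2 ^ eSeq N i * (1 + alpha N i) - 2 ^ (eSeq N i - 1) - N at h
  omega

theorem two_pow_mul_lt {N : ℤ} (hN : 1 ≤ N) (i e : ℕ) (he : e < eSeq N i - 1) :
    2 ^ e * (2 * cleanExp N i - 1) < N.toNat := by
  have h2 := two_pow_mul_sub hN i e
  by_contra hlt
  have h := (expo_isLeast (N := N) (alpha_bounds hN i).1).2
    (show e + 1 ∈ _ from ⟨by omega, by rw [Nat.add_sub_cancel]; omega⟩)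
  change eSeq N i ≤ e + 1 at h
  omega

theorem cleanExp_succ {N : ℤ} (hN : 1 ≤ N) (i : ℕ) :
    cleanExp N (i + 1) = 2 ^ (eSeq N i - 1) * (2 * cleanExp N i - 1) - N.toNat + 1 := by
  have h := cleanExp_cast hN (i + 1)
  have h1 := eSeq_pos hN i
  have h2 := two_pow_mul_sub hN i (eSeq N i - 1)
  have h3 := le_two_pow_mul hN i
  rw [Nat.sub_add_cancel h1] at h2
  rw [alpha_succ] at h
  omega

/-- The possible sequences of heights, for a sequence of states which are clean up to some place and
dirty afterwards. By determinism, the step from clean to dirty cannot occur after a full period of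
`α`, as the same step would have occurred one period earlier. -/
theorem heights_of_states {N : ℤ} (hN : 1 ≤ N) (h : ℕ → ℕ) (hpos : ∀ i, 1 ≤ h i)
    (Cl Di : ℕ → Prop) (h0 : Cl 0) (hne : ∀ i, Cl i → ¬ Di i)
    (hCl : ∀ i, Cl i → h i ≤ eSeq N i ∧ (Di (i + 1) ∨ h i = eSeq N i ∧ Cl (i + 1)))
    (hDi : ∀ i, Di i → h i = 1 ∧ Di (i + 1))
    (hdet : ∀ i j, Cl i → Cl j → alpha N i = alpha N j → Di (i + 1) → Di (j + 1)) :
    (∀ i, h i ≤ eSeq N i) ∧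
      (∀ j, h j < eSeq N j → ∀ i, j < i → h i = 1) ∧
      (∀ s t : ℕ, s < t → (∀ i, alpha N (s + i) = alpha N (t + i)) →
        ((∃ j, 2 ≤ h (t + j)) → ∀ i, eSeq N i = h i) ∧
        (candidates N t).Finite ∧ h ∈ candidates N t) := by
  by_cases hall : ∀ i, Cl i
  · have he : ∀ i, h i = eSeq N i := fun i =>
      ((hCl i (hall i)).2.resolve_left (hne _ (hall (i + 1)))).1
    refine ⟨fun i => (he i).le, fun j hj => absurd (he j) hj.ne, fun s t _ _ =>
      ⟨fun _ i => (he i).symm, candidates_finite N t, Or.inr (funext he)⟩⟩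
  · -- the last clean place
    obtain ⟨m, hm, hd⟩ : ∃ m, (∀ i ≤ m, Cl i) ∧ Di (m + 1) := by
      classical
      push Not at hall
      have hs := Nat.find_spec hall
      have hmin := fun j => Nat.find_min hall (m := j)
      obtain ⟨m, hm⟩ : ∃ m, Nat.find hall = m + 1 :=
        Nat.exists_eq_succ_of_ne_zero fun h => hs (h ▸ h0)
      rw [hm] at hs hmin
      have hc : ∀ i ≤ m, Cl i := fun i hi => not_not.mp (hmin i (by omega))
      exact ⟨m, hc, (hCl m (hc m le_rfl)).2.resolve_right fun h => hs h.2⟩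
    have hdi : ∀ i, Di (m + 1 + i) := fun i => by
      induction i with
      | zero => exact hd
      | succ i ih => exact (hDi _ ih).2
    have hone : ∀ i, m < i → h i = 1 := fun i hi => by
      obtain ⟨j, rfl⟩ := Nat.exists_eq_add_of_le (show m + 1 ≤ i from hi)
      exact (hDi _ (hdi j)).1
    have hlt : ∀ i < m, h i = eSeq N i := fun i hi =>
      ((hCl i (hm i hi.le)).2.resolve_left (hne _ (hm (i + 1) hi))).1
    have hle : ∀ i, h i ≤ eSeq N i := fun i => by
      rcases Nat.lt_or_ge m i with hi | hi
      · rw [hone i hi]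
        exact eSeq_pos hN i
      · exact (hCl i (hm i hi)).1
    refine ⟨hle, fun j hj i hi => hone i ?_, fun s t hst hper => ?_⟩
    · by_contra hi'
      exact hj.ne (hlt j (by omega))
    · have hmt : m < t := by
        by_contra hmt
        -- the place one period before `m` is clean with the same exponent
        have h1 := hper (m - t)
        rw [Nat.add_sub_cancel' (by omega)] at h1
        exact hne _ (hm (s + (m - t) + 1) (by omega))
          (hdet m _ (hm m le_rfl) (hm _ (by omega)) h1.symm hd)
      refine ⟨fun ⟨j, hj⟩ => ?_, candidates_finite N t, Or.inl ⟨fun i _ => ⟨hpos i, hle i⟩,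
        fun i hi => hone i (by omega)⟩⟩
      have := hone (t + j) (by omega)
      omega

end Combinatorics

/-! ### The multi-height -/

section Final

open MvPowerSeries

variable {k : Type*} [Field k] [CharP k 2] [PerfectRing k 2] {n α β : ℕ} {N : ℤ}
  {G : MvPowerSeries (Fin 3) k} {l : Functional (MvPowerSeries (Fin 3) k) k}

theorem Clean.exists_isHeight_eSeq (hN : 1 ≤ N) (hαβ : α + β = 1)
    (hG : coeff (Finsupp.single 0 1 + Finsupp.single 2 1) G = 0) {i : ℕ}
    (h : Clean (cleanExp N i) l) :
    ∃ m, IsHeight (eqn k n N.toNat α β) (deltaEqn n N.toNat α β G) l m ∧ m ≤ eSeq N i ∧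
      (Dirty (eqn k n N.toNat α β • xi (deltaEqn n N.toNat α β G) l (m - 1)) ∨
        m = eSeq N i ∧ Clean (cleanExp N (i + 1))
          (eqn k n N.toNat α β • xi (deltaEqn n N.toNat α β G) l (m - 1))) := by
  obtain ⟨m, hm, hle, hor⟩ := h.exists_isHeight (n := n) hαβ hG (eSeq N i - 1) (le_two_pow_mul hN i)
    (fun e he => two_pow_mul_lt hN i e he)
  have h1 := eSeq_pos hN i
  refine ⟨m + 1, hm, by omega, ?_⟩
  rw [Nat.add_sub_cancel, cleanExp_succ hN]
  refine hor.imp_right fun ⟨h2, h3⟩ => ⟨by omega, h3⟩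

/-- Two clean functionals with equal exponents have the same annihilator, so that heights and
cleanness evolve in the same way from both; this gives the determinism needed in
`heights_of_states`. -/
theorem heights_orbit (hN : 1 ≤ N) (hαβ : α + β = 1)
    (hG : coeff (Finsupp.single 0 1 + Finsupp.single 2 1) G = 0) (h : ℕ → ℕ)
    (hh : ∀ r, IsHeight (eqn k n N.toNat α β) (deltaEqn n N.toNat α β G)
      (orbit (eqn k n N.toNat α β) (deltaEqn n N.toNat α β G) h constFunctional r) (h r)) :
    (∀ i, h i ≤ eSeq N i) ∧
      (∀ j, h j < eSeq N j → ∀ i, j < i → h i = 1) ∧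
      (∀ s t : ℕ, s < t → (∀ i, alpha N (s + i) = alpha N (t + i)) →
        ((∃ j, 2 ≤ h (t + j)) → ∀ i, eSeq N i = h i) ∧
        (candidates N t).Finite ∧ h ∈ candidates N t) := by
  set f := eqn k n N.toNat α β
  set δ := deltaEqn n N.toNat α β G
  refine heights_of_states hN h (fun i => (hh i).1)
    (fun i => Clean (cleanExp N i) (orbit f δ h constFunctional i))
    (fun i => Dirty (orbit f δ h constFunctional i)) ?_ (fun i hi => hi.not_dirty)
    (fun i hi => ?_) (fun i hi => ?_) (fun i j hi hj hij hd => ?_)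
  · exact clean_constFunctional
  · obtain ⟨m, hm, hle, hor⟩ := hi.exists_isHeight_eSeq (n := n) hN hαβ hG
    obtain rfl := hm.unique (hh i)
    exact ⟨hle, hor⟩
  · have h1 : 1 = h i := (hi.isHeight hαβ).unique (hh i)
    refine ⟨h1.symm, ?_⟩
    have h2 := hi.next (n := n) (N := N.toNat) (G := G) hαβ
    rw [orbit, ← h1]
    exact h2
  · have hs : SameAnn (orbit f δ h constFunctional i) (orbit f δ h constFunctional j) := by
      have hj' : Clean (cleanExp N i) (orbit f δ h constFunctional j) := by
        rwa [cleanExp, hij]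
      exact fun g => ⟨fun hg => hi.smul_eq_zero hj' hg, fun hg => hj'.smul_eq_zero hi hg⟩
    have h1 : h i = h j := (hs.isHeight (hh i)).unique (hh j)
    intro hd'
    apply hd
    rw [orbit] at hd' ⊢
    rw [← h1] at hd'
    have h2 := (hs.xi δ (h i - 1)).smul f
    exact ⟨(h2 _).mpr hd'.1, (h2 _).mpr hd'.2⟩

theorem exists_heights (hN : 1 ≤ N) (hαβ : α + β = 1)
    (hG : coeff (Finsupp.single 0 1 + Finsupp.single 2 1) G = 0) :
    ∃ h : ℕ → ℕ, ∀ r, IsHeight (eqn k n N.toNat α β) (deltaEqn n N.toNat α β G)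
      (orbit (eqn k n N.toNat α β) (deltaEqn n N.toNat α β G) h constFunctional r) (h r) := by
  set f := eqn k n N.toNat α β
  set δ := deltaEqn n N.toNat α β G
  have hstep : ∀ i (l : {l : Functional (MvPowerSeries (Fin 3) k) k //
      Clean (cleanExp N i) l ∨ Dirty l}), ∃ m, IsHeight f δ l.1 m ∧
      (Clean (cleanExp N (i + 1)) (f • xi δ l.1 (m - 1)) ∨ Dirty (f • xi δ l.1 (m - 1))) := by
    rintro i ⟨l, hl | hl⟩
    · obtain ⟨m, hm, -, hor⟩ := hl.exists_isHeight_eSeq (n := n) hN hαβ hG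
      exact ⟨m, hm, hor.symm.imp_left And.right⟩
    · exact ⟨1, hl.isHeight hαβ, Or.inr (hl.next hαβ)⟩
  choose m hm hnext using hstep
  let state : ∀ i, {l : Functional (MvPowerSeries (Fin 3) k) k //
      Clean (cleanExp N i) l ∨ Dirty l} := fun i => Nat.rec
    ⟨constFunctional, Or.inl clean_constFunctional⟩ (fun i l => ⟨_, hnext i l⟩) i
  have hs : ∀ i, orbit f δ (fun i => m i (state i)) constFunctional i = (state i).1 := by
    intro i
    induction i with
    | zero => rfl
    | succ i ih => rw [orbit, ih]
  exact ⟨fun i => m i (state i), fun r => by rw [hs]; exact hm r (state r)⟩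

theorem eqn_eq {k : Type*} [Field k] (n N α β : ℕ) : eqn k n N α β =
    X 2 ^ 2 + X 0 ^ 2 * X 1 + X 0 ^ α * X 1 ^ n * X 2 ^ β + X 0 * X 1 ^ N * X 2 := by
  simp [eqn, mon]

theorem constantCoeff_eqn {k : Type*} [Field k] (n N : ℕ)
    (hαβ : α + β = 1) : constantCoeff (eqn k n N α β) = 0 := by
  have h : α = 1 ∧ β = 0 ∨ α = 0 ∧ β = 1 := by omega
  rw [eqn_eq]
  rcases h with ⟨rfl, rfl⟩ | ⟨rfl, rfl⟩ <;> simp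

theorem eqn_ne_zero (n N : ℕ) (hαβ : α + β = 1) : eqn k n N α β ≠ 0 := by
  intro h
  have h1 := tr_xz_eqn (k := k) (n := n) (N := N) hαβ
  rw [h, mul_zero, map_zero] at h1
  have h2 := congrArg (coeff (Finsupp.single 0 1)) h1
  simp [mon_eq_monomial] at h2

/-- The reduction of the lift `z² + x²y + x^α y^n z^β + x y^N z + 2G`. -/
theorem red_lift (n N α β : ℕ) (G : MvPowerSeries (Fin 3) (WittVector 2 k)) :
    (powerSeriesLift (Fin 3) k).red (X 2 ^ 2 + X 0 ^ 2 * X 1 + X 0 ^ α * X 1 ^ n * X 2 ^ β +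
      X 0 * X 1 ^ N * X 2 + 2 * G) = eqn k n N α β := by
  rw [map_add, FrobeniusLift.red_two_mul, add_zero, eqn_eq]
  simp only [map_add, map_mul, map_pow, powerSeriesLift_red_X]

theorem delta_lift (n N α β : ℕ) (G : MvPowerSeries (Fin 3) (WittVector 2 k)) :
    (powerSeriesLift (Fin 3) k).delta (X 2 ^ 2 + X 0 ^ 2 * X 1 + X 0 ^ α * X 1 ^ n * X 2 ^ β +
      X 0 * X 1 ^ N * X 2 + 2 * G) = deltaEqn n N α β ((powerSeriesLift (Fin 3) k).red G) := by
  rw [FrobeniusLift.delta_sum]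
  · simp only [map_add, map_mul, map_pow, powerSeriesLift_red_X, deltaEqn, mon, pow_zero, pow_one,
      one_mul, mul_one]
  · rw [map_pow, powerSeriesLift_φ_X]
  all_goals
    simp only [map_mul, map_pow, powerSeriesLift_φ_X]
    ring

/-- Both families of equations are treated at once: `(α, β)` is `(1, 0)` or `(0, 1)`. -/
theorem multiHeight_lift (hN : 1 ≤ N) (hαβ : α + β = 1)
    (G : MvPowerSeries (Fin 3) (WittVector 2 k))
    (hG : (2 : WittVector 2 k) ∣ coeff (Finsupp.single 0 1 + Finsupp.single 2 1) G)
    (f : MvPowerSeries (Fin 3) (WittVector 2 k))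
    (hf : f = X 2 ^ 2 + X 0 ^ 2 * X 1 + X 0 ^ α * X 1 ^ n * X 2 ^ β + X 0 * X 1 ^ N.toNat * X 2 +
      2 * G) :
    (∃ h, HasMultiHeight 2 (MvPowerSeries (Fin 3) (WittVector 2 k) ⧸ Ideal.span {f}) h) ∧
    ∀ h, HasMultiHeight 2 (MvPowerSeries (Fin 3) (WittVector 2 k) ⧸ Ideal.span {f}) h →
      (∀ i, h i ≤ eSeq N i) ∧
      (∀ j, h j < eSeq N j → ∀ i, j < i → h i = 1) ∧
      (∀ s t : ℕ, s < t → (∀ i, alpha N (s + i) = alpha N (t + i)) →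
        ((∃ j, 2 ≤ h (t + j)) → ∀ i, eSeq N i = h i) ∧
        (candidates N t).Finite ∧ h ∈ candidates N t) := by
  have hred : (powerSeriesLift (Fin 3) k).red f = eqn k n N.toNat α β := by rw [hf, red_lift]
  have hdelta : (powerSeriesLift (Fin 3) k).delta f =
      deltaEqn n N.toNat α β ((powerSeriesLift (Fin 3) k).red G) := by rw [hf, delta_lift]
  have hG' : coeff (Finsupp.single 0 1 + Finsupp.single 2 1)
      ((powerSeriesLift (Fin 3) k).red G) = 0 :=
    (coeff_map _ _ _).trans (coeff_zero_eq_zero_of_two_dvd k hG)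
  have key := hasMultiHeight_iff (powerSeriesLift (Fin 3) k) f
    (by rw [hred]; exact eqn_ne_zero _ _ hαβ) (by rw [hred]; exact constantCoeff_eqn _ _ hαβ)
  rw [hred, hdelta] at key
  simp_rw [key]
  exact ⟨exists_heights hN hαβ hG', fun h hh => heights_orbit hN hαβ hG' h hh⟩

end Final

end

end MultiHeight

theorem mainTheorem5 {k : Type*} [Field k] [CharP k 2] [PerfectRing k 2]
    (n : ℕ) (r : ℤ) (hrn : r < n)
    (G : MvPowerSeries (Fin 3) (WittVector 2 k))
    (hG : (2 : WittVector 2 k) ∣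
      MvPowerSeries.coeff (Finsupp.single 0 1 + Finsupp.single 2 1) G)
    (f : MvPowerSeries (Fin 3) (WittVector 2 k))
    (hf : f = MultiHeight.evenLift n r G ∨ f = MultiHeight.oddLift n r G) :
    -- (1)
    (∃ s t : ℕ, s < t ∧
      ∀ i, MultiHeight.alpha (n - r) (s + i) = MultiHeight.alpha (n - r) (t + i)) ∧
    -- the multi-height of `A / (f)` exists
    (∃ h : ℕ → ℕ, MultiHeight.HasMultiHeight 2
      (MvPowerSeries (Fin 3) (WittVector 2 k) ⧸ Ideal.span {f}) h) ∧
    ∀ h : ℕ → ℕ, MultiHeight.HasMultiHeight 2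
      (MvPowerSeries (Fin 3) (WittVector 2 k) ⧸ Ideal.span {f}) h →
      -- (2)
      (∀ i, h i ≤ MultiHeight.eSeq (n - r) i) ∧
      -- (3)
      (∀ j, h j < MultiHeight.eSeq (n - r) j → ∀ i, j < i → h i = 1) ∧
      -- (4) and the final assertion, for any `s < t` as in (1)
      (∀ s t : ℕ, s < t →
        (∀ i, MultiHeight.alpha (n - r) (s + i) = MultiHeight.alpha (n - r) (t + i)) →
        ((∃ j, 2 ≤ h (t + j)) → ∀ i, MultiHeight.eSeq (n - r) i = h i) ∧
        (MultiHeight.candidates (n - r) t).Finite ∧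
        h ∈ MultiHeight.candidates (n - r) t) := by
  have hN : (1 : ℤ) ≤ n - r := by omega
  refine ⟨MultiHeight.exists_alpha_periodic hN, ?_⟩
  rcases hf with hf | hf
  · exact MultiHeight.multiHeight_lift (n := n) (α := 1) (β := 0) hN rfl G hG f (by
      rw [hf, MultiHeight.evenLift, pow_one, pow_zero, mul_one])
  · exact MultiHeight.multiHeight_lift (n := n) (α := 0) (β := 1) hN rfl G hG f (by
      rw [hf, MultiHeight.oddLift, pow_one, pow_zero, one_mul])
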